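/- Let $K$ be a field of characteristic $0$ and let $q\in K$ be nonzero and not a root of unity (for instance $K=\mathbb{Q}(q)$ with $q$ an indeterminate, or $K=\mathbb{C}$). Let $N\ge 0$ be an integer. For a nonzero element $q$ of a field $F$, let $\Gamma_i$ be the $q$-shift operator on the field $F(x_1,\dots,x_N)$ of rational functions, $\Gamma_i f(x_1,\dots,x_i,\dots,x_N)=f(x_1,\dots,qx_i,\dots,x_N)$. For $a\in[1,N]$, $k\in\mathbb{Z}$ and $t\in F$, define the $q$-difference operators $$M_{a,k}=\sum_{I\subset[1,N],\,|I|=a}\Big(\prod_{i\in I}x_i\Big)^k\prod_{i\in I,\,j\notin I}\frac{x_i}{x_i-x_j}\prod_{i\in I}\Gamma_i,\qquad D_a=\sum_{I\subset[1,N],\,|I|=a}\ \prod_{i\in I,\,j\notin I}\frac{t x_i-x_j}{x_i-x_j}\prod_{i\in I}\Gamma_i .$$ A partition is $\lambda=\sum_{i}\lambda_i e_i\in\mathbb{Z}^N$ with $\lambda_1\ge\cdots\ge\lambda_N\ge0$; $m_\lambda$ denotes the monomial symmetric polynomial and $\mu\le\lambda$ the dominance order. Let $(\cdot,\cdot)$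 be the standard scalar product, $\omega_a=e_1+\cdots+e_a$ for $1\le a\le N$, and $\alpha_a=e_a-e_{a+1}$ for $1\le a\le N-1$. Let $t$ be an indeterminate. The Macdonald polynomial $P_\lambda=P_\lambda(q,t;x)$ is the symmetric polynomial in $x_1,\dots,x_N$ over $K(t)$ of the form $m_\lambda+\sum_{\mu<\lambda}c_\mu m_\mu$ such that $$D_aP_\lambda=t^{-a(a-1)/2}\,e_a(q^{\lambda_1}t^{N-1},q^{\lambda_2}t^{N-2},\dots,q^{\lambda_N})\,P_\lambda\qquad(1\le a\le N),$$ where $e_a$ is the $a$-th elementary symmetric polynomial, and the dual $q$-Whittaker function is $\Pi_\lambda=\lim_{t\to\infty}P_\lambda(q,t;x)\in K[x_1,\dots,x_N]$, the limit being taken on each coefficient, a rational function of $t$. **Theorem.** For every partition $\lambda$, the Macdonald polynomial $P_\lambda$ exists and is unique, and the limit $\Pi_\lambda$ exists. Moreover $$M_{a,1}\,\Pi_\lambda=q^{(\lambda,\omega_a)}\,\Pi_{\lambda+\omega_a}\qquad(1\le a\le N),$$ $$M_{a,-1}\,\Pi_\lambda=q^{(\lambda,\omega_a)}\big(1-q^{-(\lambda,\alpha_a)}\big)\,\Pi_{\lambda-\omega_a}\qquad(1\le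 a\le N-1),$$ where, if $\lambda-\omega_a$ is not a partition, the scalar factor $1-q^{-(\lambda,\alpha_a)}$ vanishes and the right-hand side of the second formula is read as $0$. -/

import Mathlib

open scoped BigOperators

namespace QWhittaker

noncomputable section

/-- The field `F(x_1, …, x_N)` of rational functions in `N` variables (indexed from `0`). -/
abbrev RatFun (F : Type*) [Field F] (N : ℕ) : Type _ :=
  FractionRing (MvPolynomial (Fin N) F)

/-- A polynomial in `x_1, …, x_N`, regarded as a rational function. -/
abbrev toRat {F : Type*} [Field F] {N : ℕ} (f : MvPolynomial (Fin N) F) : RatFun F N :=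
  algebraMap (MvPolynomial (Fin N) F) (RatFun F N) f

/-- The variable `x_i`, as a rational function. -/
abbrev var (F : Type*) [Field F] {N : ℕ} (i : Fin N) : RatFun F N :=
  toRat (MvPolynomial.X i)

/-- The substitution `x_i ↦ q x_i` for `i ∈ I`, `x_j ↦ x_j` for `j ∉ I`, on polynomials. -/
def polyShiftHom {F : Type*} [Field F] {N : ℕ} (q : Fˣ) (I : Finset (Fin N)) :
    MvPolynomial (Fin N) F →ₐ[F] MvPolynomial (Fin N) F :=
  MvPolynomial.aeval fun i =>
    if i ∈ I then MvPolynomial.C (q : F) * MvPolynomial.X i else MvPolynomial.X i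

theorem polyShiftHom_comp_inv {F : Type*} [Field F] {N : ℕ} (q : Fˣ) (I : Finset (Fin N)) :
    (polyShiftHom q I).comp (polyShiftHom q⁻¹ I) = AlgHom.id F _ := by
  ext1 i
  by_cases h : i ∈ I
  · simp [polyShiftHom, h, MvPolynomial.algebraMap_eq, ← mul_assoc, ← MvPolynomial.C_mul]
  · simp [polyShiftHom, h]

/-- The same substitution as an automorphism of the polynomial ring (`q` is invertible). -/
def polyShift {F : Type*} [Field F] {N : ℕ} (q : Fˣ) (I : Finset (Fin N)) :
    MvPolynomial (Fin N) F ≃ₐ[F] MvPolynomial (Fin N) F :=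
  AlgEquiv.ofAlgHom (polyShiftHom q I) (polyShiftHom q⁻¹ I) (polyShiftHom_comp_inv q I)
    (by simpa using polyShiftHom_comp_inv q⁻¹ I)

/-- The `q`-shift operator `∏_{i ∈ I} Γ_i` on rational functions: it replaces `x_i` by `q x_i`
for every `i ∈ I` and leaves the other variables alone. -/
def qShift {F : Type*} [Field F] {N : ℕ} (q : Fˣ) (I : Finset (Fin N)) :
    RatFun F N ≃ₐ[F] RatFun F N :=
  IsFractionRing.fieldEquivOfAlgEquiv F (RatFun F N) (RatFun F N) (polyShift q I)

/-- The `q`-difference operator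
`M_{a,k} = ∑_{|I| = a} (∏_{i ∈ I} x_i)^k ∏_{i ∈ I, j ∉ I} x_i / (x_i - x_j) ∏_{i ∈ I} Γ_i`. -/
def opM {F : Type*} [Field F] (N : ℕ) (q : Fˣ) (a : ℕ) (k : ℤ) : Module.End F (RatFun F N) :=
  ∑ I ∈ Finset.powersetCard a (Finset.univ : Finset (Fin N)),
    LinearMap.mulLeft F
        ((∏ i ∈ I, var F i) ^ k * ∏ i ∈ I, ∏ j ∈ Iᶜ, var F i / (var F i - var F j)) ∘ₗ
      (qShift q I).toLinearMap

/-- The Macdonald operator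
`D_a = ∑_{|I| = a} ∏_{i ∈ I, j ∉ I} (t x_i - x_j) / (x_i - x_j) ∏_{i ∈ I} Γ_i`. -/
def opD {F : Type*} [Field F] (N : ℕ) (q : Fˣ) (t : F) (a : ℕ) : Module.End F (RatFun F N) :=
  ∑ I ∈ Finset.powersetCard a (Finset.univ : Finset (Fin N)),
    LinearMap.mulLeft F
        (∏ i ∈ I, ∏ j ∈ Iᶜ, (t • var F i - var F j) / (var F i - var F j)) ∘ₗ
      (qShift q I).toLinearMap

/-- `λ_1 ≥ λ_2 ≥ ⋯ ≥ λ_N ≥ 0`. -/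
def IsPartition {N : ℕ} (lam : Fin N → ℤ) : Prop :=
  Antitone lam ∧ ∀ i, 0 ≤ lam i

/-- The fundamental weight `ω_a = e_1 + ⋯ + e_a` of `gl_N`. -/
def fundWeight (N a : ℕ) : Fin N → ℤ := fun i => if i.val < a then 1 else 0

/-- The simple root `α_a = e_a - e_{a+1}` of `sl_N`, for `1 ≤ a ≤ N - 1`. -/
def simpleRoot (N a : ℕ) : Fin N → ℤ :=
  fun i => if i.val + 1 = a then 1 else if i.val = a then -1 else 0

/-- The exponent of the monomial `x^λ = x_1^{λ_1} ⋯ x_N^{λ_N}` (used for `λ_i ≥ 0`). -/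
def expo {N : ℕ} (lam : Fin N → ℤ) : Fin N →₀ ℕ :=
  Finsupp.equivFunOnFinite.symm fun i => (lam i).toNat

/-- The dominance order `μ ≤ λ`: equal sums, and every partial sum of `μ` is at most the
corresponding one of `λ`. -/
def Dominated {N : ℕ} (mu lam : Fin N → ℤ) : Prop :=
  ∑ i, mu i = ∑ i, lam i ∧
    ∀ k : ℕ, ∑ i with i.val < k, mu i ≤ ∑ i with i.val < k, lam i

/-- The eigenvalue `t^{-a(a-1)/2} e_a(q^{λ_1} t^{N-1}, q^{λ_2} t^{N-2}, …, q^{λ_N})`. -/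
def eigenvalueD {F : Type*} [Field F] {N : ℕ} (q : Fˣ) (t : F) (a : ℕ) (lam : Fin N → ℤ) : F :=
  (t ^ (a * (a - 1) / 2))⁻¹ *
    ∑ I ∈ Finset.powersetCard a (Finset.univ : Finset (Fin N)),
      ∏ i ∈ I, (q : F) ^ lam i * t ^ (N - 1 - i.val)

/-- `P` is the Macdonald polynomial `P_λ(q,t;x)` over a field containing `q` and `t`: a symmetric
polynomial of the form `m_λ + ∑_{μ < λ} c_μ m_μ` (for a symmetric polynomial the coefficient of
`m_μ` is the coefficient of `x^μ`, `μ` a partition) which is a common eigenfunction of the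
operators `D_1, …, D_N`, with the eigenvalues `eigenvalueD`. -/
structure IsMacdonald {F : Type*} [Field F] {N : ℕ} (q : Fˣ) (t : F) (lam : Fin N → ℤ)
    (P : MvPolynomial (Fin N) F) : Prop where
  partition : IsPartition lam
  symmetric : P.IsSymmetric
  monic : P.coeff (expo lam) = 1
  triangular : ∀ mu : Fin N → ℤ, IsPartition mu → P.coeff (expo mu) ≠ 0 → Dominated mu lam
  eigen : ∀ a : ℕ, 1 ≤ a → a ≤ N →
    opD N q t a (toRat P) = eigenvalueD q t a lam • toRat P

/-- `q ∈ K`, regarded as a constant of `K(t)`. -/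
def constQ {K : Type*} [Field K] (q : Kˣ) : (RatFunc K)ˣ :=
  Units.map (RatFunc.C : K →+* RatFunc K).toMonoidHom q

open Classical in
/-- The Macdonald polynomial `P_λ(q,t;x)`, with coefficients in the field `K(t)`, `t` being an
indeterminate (and `0` if `λ` is not a partition). -/
def macdonaldP {K : Type*} [Field K] {N : ℕ} (q : Kˣ) (lam : Fin N → ℤ) :
    MvPolynomial (Fin N) (RatFunc K) :=
  if h : ∃ P, IsMacdonald (constQ q) (RatFunc.X : RatFunc K) lam P then h.choose else 0

/-- `lim_{t → ∞} c(t) = l` for a rational function `c ∈ K(t)`: the numerator of `c - l` has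
smaller degree than its denominator (the zero polynomial having degree `⊥`). -/
def LimInfty {K : Type*} [Field K] (c : RatFunc K) (l : K) : Prop :=
  (c - RatFunc.C l).num.degree < (c - RatFunc.C l).denom.degree

/-- Coefficientwise limit for `t → ∞` of a polynomial in `x_1, …, x_N` over `K(t)`. -/
def PolyLimInfty {K : Type*} [Field K] {N : ℕ} (P : MvPolynomial (Fin N) (RatFunc K))
    (L : MvPolynomial (Fin N) K) : Prop :=
  ∀ m : Fin N →₀ ℕ, LimInfty (P.coeff m) (L.coeff m)

open Classical in
/-- The dual `q`-Whittaker function `Π_λ = lim_{t → ∞} P_λ(q,t;x)` (and `0` if `λ` is not a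
partition). -/
def dualWhittaker {K : Type*} [Field K] {N : ℕ} (q : Kˣ) (lam : Fin N → ℤ) :
    MvPolynomial (Fin N) K :=
  if h : ∃ L, PolyLimInfty (macdonaldP q lam) L then h.choose else 0

end

end QWhittaker

/-! Everything is done with one family of operators, `weightedOp`, with weights `(x_i - u x_j)/(x_i
- x_j)`. For `u = 0` it is `M_{a,k}`; for `u = t⁻¹` and `k = 0` it is `D_a` up to a power of `t`.
The limit `t → ∞` is therefore the specialization `u = 0`, and `Π_λ` is a joint eigenfunction of the
`M_{b,0}` with eigenvalues `q^{(λ,ω_b)}`. Since `q` is not a root of unity, these eigenvalues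
determine `λ`, and a symmetric joint eigenfunction is determined by its coefficient at `x^λ`.

Two ingredients carry the proof. The first is algebraic. The `q`-commutator of a rank `a` and a rank
one operator is a sum over sets `S` of size `a + 1` whose coefficients contain an `exchangeSum`, a
residue sum evaluated by Lagrange interpolation at the nodes `x_i` and `q⁻¹ x_i`
(`weightedOp_commutator`, `coeff_eq_exchangeSum`). It shows that the `D_a` commute with `D_1`, that
`M_{a,k}` and `M_{1,l}` `q`-commute for `|l - k| ≤ a`, and that `M_{a+1,k+1}` is a `q`-commutator of
lower operators. Induction on the rank gives `M_{b,0} M_{a,±1} = q^{±min(a,b)} M_{a,±1} M_{b,0}`.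
Hence `M_{a,±1} Π_λ` is a joint eigenfunction with the eigenvalues of `λ ± ω_a`, so it is a multiple
of `Π_{λ±ω_a}`, or zero if `λ ± ω_a` is not a partition.

The second is a leading term calculus. After multiplication by the Vandermonde polynomial, the
operators on symmetric polynomials become sums of alternants `∑_w sgn(w) w(x^δ · …)` with
coefficients polynomial in `u` (`vandermonde_mul_weightedOp`). This shows triangularity, makes sense
over the local ring of `K(t)` at infinity, and reduces to a single alternant at `u = 0`. For
`M_{a,±1}` the exponent `δ` becomes `δ ± ω_a`. The stabilizer of `δ + ω_a` is trivial, which gives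
the factor `q^{(λ,ω_a)}`. That of `δ - ω_a` is generated by one transposition, whose sign produces
`1 - q^{-(λ,α_a)}`.

Existence of `P_λ` is a dimension count for `D_1`, extended to all `D_a` by commutation. Existence
of the limit follows by rescaling `P_λ` to a primitive vector over the local ring at infinity: the
reduction is a nonzero eigenfunction, so its leading exponent is `λ`, and as `P_λ` is monic at `λ`
the rescaling was trivial. -/

namespace QWhittaker

/-! ### Residue identities through Lagrange interpolation -/

section Residues

open Polynomial

variable {E ι : Type*} [Field E] [DecidableEq ι]

/-- The sum over `i ∈ S` of the exchange terms that govern the commutation of a one-index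
`q`-difference operator with an operator of higher rank. -/
def exchangeSum (q u : E) (x : ι → E) (S : Finset ι) (e : ℤ) : E :=
  ∑ i ∈ S, x i ^ e *
    ((∏ j ∈ S.erase i, ((x j - u * x i) / (x j - x i) * ((x i - u * (q * x j)) / (x i - q * x j)))) -
      q ^ e * ∏ j ∈ S.erase i,
        ((x i - u * x j) / (x i - x j) * ((x j - u * (q * x i)) / (x j - q * x i))))

theorem coeff_eq_sum_two_nodes {S : Finset ι} {x y : ι → E} (hx : Set.InjOn x S)
    (hy : Set.InjOn y S) (hxy : ∀ i ∈ S, ∀ j ∈ S, x i ≠ y j) {P : E[X]}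
    (hP : P.degree < ((2 * S.card : ℕ) : WithBot ℕ)) :
    P.coeff (2 * S.card - 1) = ∑ i ∈ S,
      (P.eval (x i) / ((∏ j ∈ S.erase i, (x i - x j)) * ∏ j ∈ S, (x i - y j)) +
        P.eval (y i) / ((∏ j ∈ S, (y i - x j)) * ∏ j ∈ S.erase i, (y i - y j))) := by
  have hinj : Set.InjOn (Sum.elim x y) (S.disjSum S : Finset (ι ⊕ ι)) := by
    rintro (i | i) hi (j | j) hj h <;> simp at hi hj h
    · rw [hx hi hj h]
    · exact absurd h (hxy i hi j hj)
    · exact absurd h.symm (hxy j hj i hi)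
    · rw [hy hi hj h]
  have hcard : (S.disjSum S).card = 2 * S.card := by
    rw [Finset.card_disjSum, two_mul]
  have key := Lagrange.coeff_eq_sum hinj (P := P) (by rw [hcard]; exact hP)
  have hl : ∀ i ∈ S, (S.disjSum S).erase (Sum.inl i) = (S.erase i).disjSum S := by
    intro i _; ext (j | j) <;> simp
  have hr : ∀ i ∈ S, (S.disjSum S).erase (Sum.inr i) = S.disjSum (S.erase i) := by
    intro i _; ext (j | j) <;> simp
  rw [hcard] at key
  rw [key, Finset.sum_disjSum, Finset.sum_add_distrib]
  congr 1
  · refine Finset.sum_congr rfl fun i hi => ?_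
    rw [hl i hi, Finset.prod_disjSum]; rfl
  · refine Finset.sum_congr rfl fun i hi => ?_
    rw [hr i hi, Finset.prod_disjSum]; rfl

/-- The interpolated function is `z^{e-1} ∏_j (z - u x_j)(x_j - u q z)`, and the nodes come in pairs
`x_i`, `q⁻¹ x_i`. The two nodes of a pair yield the two products in the `i`-th exchange term; the
factor `j = i` only contributes a constant and a power of `x_i`. As `e` may be negative, the
function is replaced by a polynomial with the same values at the nodes. -/
theorem coeff_eq_exchangeSum {q u : E} (hq : q ≠ 0) (hq1 : q ≠ 1) {x : ι → E} {S : Finset ι}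
    (hx0 : ∀ i ∈ S, x i ≠ 0) (hx : Set.InjOn x S)
    (hqx : ∀ i ∈ S, ∀ j ∈ S, x i ≠ q * x j) (e : ℤ) {P : E[X]}
    (hP : P.degree < ((2 * S.card : ℕ) : WithBot ℕ))
    (hPx : ∀ i ∈ S, P.eval (x i) =
      x i ^ (e - 1) * ∏ j ∈ S, ((x i - u * x j) * (x j - u * (q * x i))))
    (hPy : ∀ i ∈ S, P.eval (q⁻¹ * x i) =
      (q⁻¹ * x i) ^ (e - 1) * ∏ j ∈ S, ((q⁻¹ * x i - u * x j) * (x j - u * x i))) :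
    P.coeff (2 * S.card - 1) =
      -(q⁻¹ ^ e * ((1 - u) * (1 - u * q) * (-q) ^ (S.card - 1) / (1 - q⁻¹))) *
        exchangeSum q u x S e := by
  have hq2 : 1 - q⁻¹ ≠ 0 := by
    rw [sub_ne_zero]; intro h; apply hq1; rw [← inv_inv q, ← h, inv_one]
  have hq3 : q - 1 ≠ 0 := sub_ne_zero.2 hq1
  have hq4 : 1 - q ≠ 0 := sub_ne_zero.2 hq1.symm
  rw [coeff_eq_sum_two_nodes (y := fun i => q⁻¹ * x i) hx
    (fun i hi j hj h => hx hi hj (mul_left_cancel₀ (inv_ne_zero hq) h))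
    (fun i hi j hj h => hqx j hj i hi (by rw [h, mul_inv_cancel_left₀ hq])) hP]
  rw [exchangeSum, Finset.mul_sum]
  refine Finset.sum_congr rfl fun i hi => ?_
  have hxi := hx0 i hi
  have hcard : (S.erase i).card = S.card - 1 := Finset.card_erase_of_mem hi
  have hne : ∀ j ∈ S.erase i, x i - x j ≠ 0 ∧ x j - x i ≠ 0 ∧ x i - q * x j ≠ 0 ∧
      x j - q * x i ≠ 0 := by
    intro j hj
    have hjS := Finset.mem_of_mem_erase hj
    have hji := Finset.ne_of_mem_erase hj
    exact ⟨sub_ne_zero.2 fun h => hji (hx hjS hi h.symm), sub_ne_zero.2 fun h => hji (hx hjS hi h),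
      sub_ne_zero.2 (hqx i hi j hjS), sub_ne_zero.2 (hqx j hjS i hi)⟩
  rw [hPx i hi, hPy i hi]
  rw [← Finset.mul_prod_erase S (fun j => (x i - u * x j) * (x j - u * (q * x i))) hi,
    ← Finset.mul_prod_erase S (fun j => (q⁻¹ * x i - u * x j) * (x j - u * x i)) hi,
    ← Finset.mul_prod_erase S (fun j => x i - q⁻¹ * x j) hi,
    ← Finset.mul_prod_erase S (fun j => q⁻¹ * x i - x j) hi]
  have h1 : (∏ j ∈ S.erase i, ((x i - u * x j) / (x i - x j) *
        ((x j - u * (q * x i)) / (x j - q * x i)))) * (-q) ^ (S.card - 1) =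
      (∏ j ∈ S.erase i, ((x i - u * x j) * (x j - u * (q * x i)))) /
        ((∏ j ∈ S.erase i, (x i - x j)) * ∏ j ∈ S.erase i, (x i - q⁻¹ * x j)) := by
    rw [← hcard, ← Finset.prod_const, ← Finset.prod_mul_distrib, ← Finset.prod_mul_distrib,
      ← Finset.prod_div_distrib]
    refine Finset.prod_congr rfl fun j hj => ?_
    obtain ⟨a, b, c, d⟩ := hne j hj
    have : x i - q⁻¹ * x j = -q⁻¹ * (x j - q * x i) := by field_simp; ring
    rw [this]; field_simp
  have h2 : (∏ j ∈ S.erase i, ((x j - u * x i) / (x j - x i) *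
        ((x i - u * (q * x j)) / (x i - q * x j)))) * (-q) ^ (S.card - 1) =
      (∏ j ∈ S.erase i, ((q⁻¹ * x i - u * x j) * (x j - u * x i))) /
        ((∏ j ∈ S.erase i, (q⁻¹ * x i - x j)) * ∏ j ∈ S.erase i, (q⁻¹ * x i - q⁻¹ * x j)) := by
    rw [← hcard, ← Finset.prod_const, ← Finset.prod_mul_distrib, ← Finset.prod_mul_distrib,
      ← Finset.prod_div_distrib]
    refine Finset.prod_congr rfl fun j hj => ?_
    obtain ⟨a, b, c, d⟩ := hne j hj
    have e1 : q⁻¹ * x i - x j = q⁻¹ * (x i - q * x j) := by field_simp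
    have e2 : q⁻¹ * x i - u * x j = q⁻¹ * (x i - u * (q * x j)) := by field_simp
    have e3 : q⁻¹ * x i - q⁻¹ * x j = -q⁻¹ * (x j - x i) := by ring
    rw [e1, e2, e3]; field_simp
  set A := ∏ j ∈ S.erase i, ((x i - u * x j) / (x i - x j) *
        ((x j - u * (q * x i)) / (x j - q * x i)))
  set B := ∏ j ∈ S.erase i, ((x j - u * x i) / (x j - x i) *
        ((x i - u * (q * x j)) / (x i - q * x j)))
  have t1 : ∀ (f a n c d z : E), f * (a * n) / (c * (d * z)) = f * a / d * (n / (c * z)) := by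
    intro f a n c d z; rw [← mul_assoc, mul_left_comm c d z, mul_div_mul_comm]
  have t2 : ∀ (f a n c d z : E), f * (a * n) / (d * z * c) = f * a / d * (n / (z * c)) := by
    intro f a n c d z; rw [← mul_assoc, mul_assoc d z c, mul_div_mul_comm]
  rw [t1, t2, ← h1, ← h2]
  have e1 : x i ^ (e - 1) * ((x i - u * x i) * (x i - u * (q * x i))) / (x i - q⁻¹ * x i) =
      x i ^ e * ((1 - u) * (1 - u * q) / (1 - q⁻¹)) := by
    rw [zpow_sub_one₀ hxi]
    have : x i - q⁻¹ * x i = x i * (1 - q⁻¹) := by ring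
    rw [this]; field_simp
  have e2 : (q⁻¹ * x i) ^ (e - 1) * ((q⁻¹ * x i - u * x i) * (x i - u * x i)) /
      (q⁻¹ * x i - x i) = - (q⁻¹ ^ e * x i ^ e * ((1 - u) * (1 - u * q) / (1 - q⁻¹))) := by
    rw [mul_zpow, zpow_sub_one₀ hxi, zpow_sub_one₀ (inv_ne_zero hq)]
    have a1 : q⁻¹ * x i - x i = -(x i * (1 - q⁻¹)) := by ring
    have a2 : q⁻¹ * x i - u * x i = q⁻¹ * x i * (1 - u * q) := by field_simp
    rw [a1, a2]; field_simp
  rw [e1, e2]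
  have hqe : q⁻¹ ^ e * q ^ e = 1 := by rw [← mul_zpow, inv_mul_cancel₀ hq, one_zpow]
  linear_combination (-(x i ^ e * ((1 - u) * (1 - u * q) / (1 - q⁻¹)) * (A * (-q) ^ (S.card - 1)))) * hqe

variable {q : E} {x : ι → E} {S : Finset ι}

/-- At `u = 0` the function to interpolate is the monomial `(∏ x_j) z^{|S|+e-1}`. The sum is thus
zero below the top degree `2|S| - 1` and explicit there. -/
theorem exchangeSum_zero_left (hq : q ≠ 0) (hq1 : q ≠ 1) (hx0 : ∀ i ∈ S, x i ≠ 0)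
    (hx : Set.InjOn x S) (hqx : ∀ i ∈ S, ∀ j ∈ S, x i ≠ q * x j) (e : ℤ) (m : ℕ)
    (hm : (m : ℤ) = S.card + e - 1) (hlt : m < 2 * S.card) :
    (∏ i ∈ S, x i) * (if m = 2 * S.card - 1 then 1 else 0) =
      -(q⁻¹ ^ e * ((-q) ^ (S.card - 1) / (1 - q⁻¹))) * exchangeSum q 0 x S e := by
  have key := coeff_eq_exchangeSum (u := 0) hq hq1 hx0 hx hqx e
    (P := C (∏ i ∈ S, x i) * X ^ m) ((degree_C_mul_X_pow_le m _).trans_lt (by exact_mod_cast hlt))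
    ?_ ?_
  · rw [coeff_C_mul, coeff_X_pow] at key
    simp only [eq_comm (a := m)]
    rw [key]; simp
  · intro i hi
    have hp : ∏ j ∈ S, ((x i - 0 * x j) * (x j - 0 * (q * x i))) =
        x i ^ S.card * ∏ j ∈ S, x j := by
      rw [← Finset.prod_const, ← Finset.prod_mul_distrib]; simp
    rw [hp]
    simp only [eval_mul, eval_C, eval_pow, eval_X]
    rw [← zpow_natCast, ← zpow_natCast, hm, ← mul_assoc, ← zpow_add₀ (hx0 i hi), mul_comm]
    congr 2; ring
  · intro i hi
    have hp : ∏ j ∈ S, ((q⁻¹ * x i - 0 * x j) * (x j - 0 * x i)) =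
        (q⁻¹ * x i) ^ S.card * ∏ j ∈ S, x j := by
      rw [← Finset.prod_const, ← Finset.prod_mul_distrib]; simp
    rw [hp]
    simp only [eval_mul, eval_C, eval_pow, eval_X]
    rw [← zpow_natCast, ← zpow_natCast, hm, ← mul_assoc,
      ← zpow_add₀ (mul_ne_zero (inv_ne_zero hq) (hx0 i hi)), mul_comm]
    congr 2; ring

theorem exchangeSum_eq_zero (hq : q ≠ 0) (hq1 : q ≠ 1) (hx0 : ∀ i ∈ S, x i ≠ 0)
    (hx : Set.InjOn x S) (hqx : ∀ i ∈ S, ∀ j ∈ S, x i ≠ q * x j) (e : ℤ)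
    (h1 : 1 - (S.card : ℤ) ≤ e) (h2 : e < S.card) : exchangeSum q 0 x S e = 0 := by
  have hm : ((S.card + e - 1).toNat : ℤ) = S.card + e - 1 := Int.toNat_of_nonneg (by omega)
  have key := exchangeSum_zero_left hq hq1 hx0 hx hqx e _ hm (by omega)
  rw [if_neg (by omega), mul_zero] at key
  have hq2 : 1 - q⁻¹ ≠ 0 := by
    rw [sub_ne_zero]; intro h; apply hq1; rw [← inv_inv q, ← h, inv_one]
  refine (mul_eq_zero.1 key.symm).resolve_left (neg_ne_zero.2 (mul_ne_zero ?_ ?_))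
  · exact zpow_ne_zero _ (inv_ne_zero hq)
  · exact div_ne_zero (pow_ne_zero _ (neg_ne_zero.2 hq)) hq2

theorem exchangeSum_card (hq : q ≠ 0) (hq1 : q ≠ 1) (hS : S.Nonempty) (hx0 : ∀ i ∈ S, x i ≠ 0)
    (hx : Set.InjOn x S) (hqx : ∀ i ∈ S, ∀ j ∈ S, x i ≠ q * x j) :
    exchangeSum q 0 x S S.card =
      -(q⁻¹ ^ S.card * ((-q) ^ (S.card - 1) / (1 - q⁻¹)))⁻¹ * ∏ i ∈ S, x i := by
  have hc := hS.card_pos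
  have key := exchangeSum_zero_left hq hq1 hx0 hx hqx S.card (2 * S.card - 1) (by omega) (by omega)
  rw [if_pos rfl, mul_one, zpow_natCast] at key
  have hq2 : 1 - q⁻¹ ≠ 0 := by
    rw [sub_ne_zero]; intro h; apply hq1; rw [← inv_inv q, ← h, inv_one]
  have hne : q⁻¹ ^ S.card * ((-q) ^ (S.card - 1) / (1 - q⁻¹)) ≠ 0 :=
    mul_ne_zero (pow_ne_zero _ (inv_ne_zero hq))
      (div_ne_zero (pow_ne_zero _ (neg_ne_zero.2 hq)) hq2)
  rw [key, neg_mul, neg_mul, mul_neg, neg_neg, inv_mul_cancel_left₀ hne]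

/-- For `e = 0` the values are those of `G(z)/z`, not a polynomial. Subtracting `u^{|S|} H` from
`G`, where `H` vanishes at all nodes, changes no value and cancels both the constant and the top
coefficient. The quotient by `z` is then a polynomial of degree less than `2|S| - 1`, so the
coefficient in question is zero. -/
theorem exchangeSum_exponent_zero {u : E} (hq : q ≠ 0) (hq1 : q ≠ 1) (hu : u ≠ 1)
    (huq : u * q ≠ 1) (hS : S.Nonempty) (hx0 : ∀ i ∈ S, x i ≠ 0)
    (hx : Set.InjOn x S) (hqx : ∀ i ∈ S, ∀ j ∈ S, x i ≠ q * x j) :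
    exchangeSum q u x S 0 = 0 := by
  have hc := hS.card_pos
  have hq2 : 1 - q⁻¹ ≠ 0 := by
    rw [sub_ne_zero]; intro h; apply hq1; rw [← inv_inv q, ← h, inv_one]
  set G : E[X] := ∏ j ∈ S, ((X - C (u * x j)) * (C (x j) - C (u * q) * X)) with hG
  set H : E[X] := ∏ j ∈ S, ((X - C (x j)) * (C (x j) - C q * X)) with hH
  have hquad : ∀ a b c : E, (X - C a) * (C b - C c * X) =
      C (-c) * X ^ 2 + C (b + a * c) * X + C (-(a * b)) := by
    intro a b c; simp only [C_neg, C_add, C_mul]; ring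
  have hcoeff2 : ∀ a b c : ι → E,
      (∏ j ∈ S, ((X - C (a j)) * (C (b j) - C (c j) * X))).coeff (2 * S.card) =
        ∏ j ∈ S, -c j := by
    intro a b c
    rw [mul_comm 2, coeff_prod_of_natDegree_le]
    · refine Finset.prod_congr rfl fun j _ => ?_
      rw [hquad]; simp
    · intro j _
      rw [hquad]; exact natDegree_quadratic_le
  have hdeg : ∀ a b c : ι → E,
      (∏ j ∈ S, ((X - C (a j)) * (C (b j) - C (c j) * X))).natDegree ≤ 2 * S.card := by
    intro a b c
    refine (natDegree_prod_le _ _).trans ?_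
    rw [mul_comm 2, ← smul_eq_mul]
    refine Finset.sum_le_card_nsmul _ _ _ fun j _ => ?_
    rw [hquad]; exact natDegree_quadratic_le
  set Q : E[X] := G - C (u ^ S.card) * H with hQ
  have hQ0 : Q.coeff 0 = 0 := by
    rw [hQ, coeff_zero_eq_eval_zero, eval_sub, eval_mul, eval_C, hG, hH, eval_prod, eval_prod,
      ← Finset.prod_const, ← Finset.prod_mul_distrib, sub_eq_zero]
    refine Finset.prod_congr rfl fun j _ => ?_
    simp; ring
  have hQ2 : Q.coeff (2 * S.card) = 0 := by
    rw [hQ, coeff_sub, coeff_C_mul, hG, hH, hcoeff2 (fun j => u * x j) x (fun _ => u * q),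
      hcoeff2 x x (fun _ => q), Finset.prod_const, Finset.prod_const, ← mul_pow, sub_eq_zero]
    congr 1; ring
  have hQd : Q.natDegree ≤ 2 * S.card := by
    rw [hQ]
    exact (natDegree_sub_le _ _).trans (max_le (hdeg _ _ _)
      ((natDegree_C_mul_le _ _).trans (hdeg _ _ _)))
  have hcoef : ∀ m, 2 * S.card ≤ m + 1 → (divX Q).coeff m = 0 := by
    intro m hm
    rw [coeff_divX]
    rcases hm.lt_or_eq with h | h
    · exact coeff_eq_zero_of_natDegree_lt (hQd.trans_lt h)
    · rw [← h, hQ2]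
  have heval : ∀ z : E, z ≠ 0 → (divX Q).eval z = z ^ ((0 : ℤ) - 1) * Q.eval z := by
    intro z hz
    conv_rhs => rw [← divX_mul_X_add Q, hQ0]
    simp only [eval_mul, eval_X, C_0, add_zero, zero_sub, zpow_neg_one]
    field_simp
  have key := coeff_eq_exchangeSum (u := u) hq hq1 hx0 hx hqx 0 (P := divX Q) ?_ ?_ ?_
  · rw [hcoef _ (by omega)] at key
    refine (mul_eq_zero.1 key.symm).resolve_left (neg_ne_zero.2 ?_)
    rw [zpow_zero, one_mul]
    exact div_ne_zero (mul_ne_zero (mul_ne_zero (sub_ne_zero.2 hu.symm) (sub_ne_zero.2 huq.symm))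
      (pow_ne_zero _ (neg_ne_zero.2 hq))) hq2
  · rw [degree_lt_iff_coeff_zero]
    intro m hm; exact hcoef m (by omega)
  · intro i hi
    have h0 : H.eval (x i) = 0 := by
      rw [hH, eval_prod]; exact Finset.prod_eq_zero hi (by simp)
    rw [heval _ (hx0 i hi), hQ, eval_sub, eval_mul, h0, mul_zero, sub_zero, hG, eval_prod]
    congr 1
    refine Finset.prod_congr rfl fun j _ => ?_
    simp [mul_assoc]
  · intro i hi
    have h0 : H.eval (q⁻¹ * x i) = 0 := by
      rw [hH, eval_prod]; exact Finset.prod_eq_zero hi (by simp [hq])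
    rw [heval _ (mul_ne_zero (inv_ne_zero hq) (hx0 i hi)), hQ, eval_sub, eval_mul, h0, mul_zero,
      sub_zero, hG, eval_prod]
    congr 1
    refine Finset.prod_congr rfl fun j _ => ?_
    simp only [eval_mul, eval_sub, eval_X, eval_C]
    congr 2
    field_simp

end Residues

end QWhittaker

namespace QWhittaker

noncomputable section

/-! ### The operators and their commutator -/

section Operators

variable {F : Type*} [Field F] {N : ℕ}

theorem toRat_injective : Function.Injective (toRat : MvPolynomial (Fin N) F → RatFun F N) :=
  IsFractionRing.injective _ _

theorem algebraMap_eq_toRat (c : F) :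
    algebraMap F (RatFun F N) c = toRat (MvPolynomial.C c) := by
  rw [toRat, ← MvPolynomial.algebraMap_eq, ← IsScalarTower.algebraMap_apply]

theorem qShift_toRat (q : Fˣ) (I : Finset (Fin N)) (f : MvPolynomial (Fin N) F) :
    qShift q I (toRat f) = toRat (polyShiftHom q I f) := by
  simp only [qShift, toRat]
  exact IsFractionRing.fieldEquivOfAlgEquiv_algebraMap F _ _ _ f

theorem qShift_var (q : Fˣ) (I : Finset (Fin N)) (i : Fin N) :
    qShift q I (var F i) =
      if i ∈ I then algebraMap F (RatFun F N) q * var F i else var F i := by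
  rw [var, qShift_toRat, polyShiftHom, MvPolynomial.aeval_X, algebraMap_eq_toRat]
  split_ifs
  · exact map_mul _ _ _
  · rfl

theorem algEquiv_ext_of_var {φ ψ : RatFun F N ≃ₐ[F] RatFun F N}
    (h : ∀ i, φ (var F i) = ψ (var F i)) : φ = ψ := by
  have h1 : (φ : RatFun F N →+* RatFun F N) = ψ := by
    apply IsLocalization.ringHom_ext (nonZeroDivisors (MvPolynomial (Fin N) F))
    apply MvPolynomial.ringHom_ext
    · intro c
      have := (algebraMap_eq_toRat (N := N) c).symm
      simp only [toRat] at this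
      simp [this]
    · intro i; exact h i
  ext x
  exact DFunLike.congr_fun h1 x

theorem qShift_qShift_comm (q : Fˣ) (I J : Finset (Fin N)) (f : RatFun F N) :
    qShift q I (qShift q J f) = qShift q J (qShift q I f) := by
  have : (qShift q J).trans (qShift q I) = (qShift q I).trans (qShift q J) := by
    apply algEquiv_ext_of_var
    intro i
    simp only [AlgEquiv.trans_apply, qShift_var]
    split_ifs <;> simp [qShift_var, *]
  exact DFunLike.congr_fun this f

theorem qShift_insert (q : Fˣ) {I : Finset (Fin N)} {i : Fin N} (hi : i ∉ I) (f : RatFun F N) :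
    qShift q I (qShift q {i} f) = qShift q (insert i I) f := by
  have : (qShift q {i}).trans (qShift q I) = qShift q (insert i I) := by
    apply algEquiv_ext_of_var
    intro j
    simp only [AlgEquiv.trans_apply, qShift_var, Finset.mem_singleton, Finset.mem_insert]
    by_cases h : j = i
    · subst h; simp [qShift_var, hi]
    · simp [qShift_var, h]
  exact DFunLike.congr_fun this f

theorem var_ne_zero (i : Fin N) : var F i ≠ 0 := by
  rw [var, toRat, Ne, FaithfulSMul.algebraMap_eq_zero_iff]
  exact MvPolynomial.X_ne_zero i

theorem var_ne_smul_var {i j : Fin N} (hij : i ≠ j) (c : F) :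
    var F i ≠ algebraMap F (RatFun F N) c * var F j := by
  rw [algebraMap_eq_toRat, var, var, toRat, toRat, toRat, ← map_mul]
  intro h
  have h1 := IsFractionRing.injective _ _ h
  have h2 := congrArg (MvPolynomial.coeff (Finsupp.single i 1)) h1
  rw [MvPolynomial.coeff_C_mul, MvPolynomial.coeff_X, MvPolynomial.coeff_X, if_pos rfl,
    if_neg, mul_zero] at h2
  · exact one_ne_zero h2
  · intro h3
    rw [Finsupp.single_left_inj one_ne_zero] at h3
    exact hij h3.symm

theorem var_injective : Function.Injective (var F : Fin N → RatFun F N) := by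
  intro i j h
  by_contra hij
  exact var_ne_smul_var (F := F) hij 1 (by simpa using h)

/-- The weight `(x_i - u x_j) / (x_i - x_j)`. -/
def pairWeight (u : F) (i j : Fin N) : RatFun F N :=
  (var F i - algebraMap F (RatFun F N) u * var F j) / (var F i - var F j)

/-- The coefficient of `∏_{i ∈ I} Γ_i` in `weightedOp`. -/
def opCoeff (u : F) (k : ℤ) (I : Finset (Fin N)) : RatFun F N :=
  (∏ i ∈ I, var F i) ^ k * ∏ i ∈ I, ∏ j ∈ Iᶜ, pairWeight u i j

/-- The common generalization of `opM` (`u = 0`) and, up to scaling, `opD` (`u = t⁻¹`, `k = 0`). -/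
def weightedOp (N : ℕ) (q : Fˣ) (u : F) (a : ℕ) (k : ℤ) : Module.End F (RatFun F N) :=
  ∑ I ∈ Finset.powersetCard a (Finset.univ : Finset (Fin N)),
    LinearMap.mulLeft F (opCoeff u k I) ∘ₗ (qShift q I).toLinearMap

theorem weightedOp_apply (q : Fˣ) (u : F) (a : ℕ) (k : ℤ) (f : RatFun F N) :
    weightedOp N q u a k f =
      ∑ I ∈ Finset.powersetCard a (Finset.univ : Finset (Fin N)),
        opCoeff u k I * qShift q I f := by
  simp [weightedOp]

theorem weightedOp_one_apply (q : Fˣ) (u : F) (k : ℤ) (f : RatFun F N) :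
    weightedOp N q u 1 k f = ∑ i, opCoeff u k {i} * qShift q {i} f := by
  rw [weightedOp_apply, Finset.powersetCard_one, Finset.sum_map]; rfl

theorem opM_eq_weightedOp (q : Fˣ) (a : ℕ) (k : ℤ) : opM N q a k = weightedOp N q 0 a k := by
  simp [opM, weightedOp, opCoeff, pairWeight]

/-- Each of the `a (N - a)` factors is `t x_i - x_j = t (x_i - t⁻¹ x_j)`. -/
theorem opD_eq_weightedOp (q : Fˣ) {t : F} (ht : t ≠ 0) (a : ℕ) :
    opD N q t a = t ^ (a * (N - a)) • weightedOp N q t⁻¹ a 0 := by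
  rw [opD, weightedOp, Finset.smul_sum]
  refine Finset.sum_congr rfl fun I hI => ?_
  have hc : I.card = a := (Finset.mem_powersetCard.1 hI).2
  have hc' : Iᶜ.card = N - a := by rw [Finset.card_compl, hc, Fintype.card_fin]
  have hw : ∀ i ∈ I, ∏ j ∈ Iᶜ, (t • var F i - var F j) / (var F i - var F j) =
      algebraMap F (RatFun F N) t ^ (N - a) * ∏ j ∈ Iᶜ, pairWeight t⁻¹ i j := by
    intro i _
    rw [← hc', ← Finset.prod_const, ← Finset.prod_mul_distrib]
    refine Finset.prod_congr rfl fun j _ => ?_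
    have h1 : algebraMap F (RatFun F N) t * algebraMap F (RatFun F N) t⁻¹ = 1 := by
      rw [← map_mul, mul_inv_cancel₀ ht, map_one]
    rw [pairWeight, Algebra.smul_def, ← mul_div_assoc, mul_sub, ← mul_assoc, h1, one_mul]
  ext f
  simp only [LinearMap.comp_apply, LinearMap.mulLeft_apply, LinearMap.smul_apply, opCoeff,
    zpow_zero, one_mul]
  rw [Finset.prod_congr rfl hw, Finset.prod_mul_distrib, Finset.prod_const, hc, ← pow_mul,
    mul_comm (N - a), Algebra.smul_def, map_pow, mul_assoc]

theorem qShift_pairWeight (q : Fˣ) (u : F) (I : Finset (Fin N)) {i j : Fin N}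
    (h : i ∈ I ↔ j ∈ I) : qShift q I (pairWeight u i j) = pairWeight u i j := by
  simp only [pairWeight, map_div₀, map_sub, map_mul, AlgEquiv.commutes, qShift_var, h]
  split_ifs
  · have hq : algebraMap F (RatFun F N) q ≠ 0 := by simp
    rw [mul_left_comm, ← mul_sub, ← mul_sub, mul_div_mul_left _ _ hq]
  · rfl

/-- Pair weights are homogeneous of degree `0`, so those inside `I` ignore the shift; only the
powers of the variables scale, by `q^l` on one side and `q^k` on the other. These terms therefore
cancel in the `q`-commutator. -/
theorem qShift_opCoeff_of_mem (q : Fˣ) (u : F) (k l : ℤ) {I : Finset (Fin N)} {i : Fin N}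
    (hi : i ∈ I) :
    opCoeff u k I * qShift q I (opCoeff u l {i}) =
      algebraMap F (RatFun F N) q ^ (l - k) *
        (opCoeff u l {i} * qShift q {i} (opCoeff u k I)) := by
  have hq : algebraMap F (RatFun F N) q ≠ 0 := by simp
  have hcompl : ({i} : Finset (Fin N))ᶜ = (I.erase i).disjUnion Iᶜ
      (Finset.disjoint_left.2 fun j hj => by simp [Finset.mem_of_mem_erase hj]) := by
    ext j; simp; by_cases h : j = i
    · simp [h, hi]
    · simp [h]; tauto
  have hA : ∏ j ∈ I.erase i, qShift q I (pairWeight u i j) =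
      ∏ j ∈ I.erase i, pairWeight u i j :=
    Finset.prod_congr rfl fun j hj =>
      qShift_pairWeight q u I (by simp [hi, Finset.mem_of_mem_erase hj])
  have hB : ∏ j ∈ Iᶜ, qShift q {i} (pairWeight u i j) =
      ∏ j ∈ Iᶜ, qShift q I (pairWeight u i j) :=
    Finset.prod_congr rfl fun j hj => by
      have hj' : j ∉ I := by simpa using hj
      have hji : j ≠ i := fun h => hj' (h ▸ hi)
      simp [pairWeight, qShift_var, hi, hj', hji]
  have hC : ∏ i' ∈ I.erase i, ∏ j ∈ Iᶜ, qShift q {i} (pairWeight u i' j) =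
      ∏ i' ∈ I.erase i, ∏ j ∈ Iᶜ, pairWeight u i' j :=
    Finset.prod_congr rfl fun i' hi' => Finset.prod_congr rfl fun j hj => by
      have hj' : j ∉ I := by simpa using hj
      have hji : j ≠ i := fun h => hj' (h ▸ hi)
      exact qShift_pairWeight q u _ (by simp [hji, Finset.ne_of_mem_erase hi'])
  have hX : ∏ i' ∈ I, qShift q {i} (var F i') =
      algebraMap F (RatFun F N) q * ∏ i' ∈ I, var F i' := by
    rw [← Finset.mul_prod_erase I _ hi, ← Finset.mul_prod_erase I _ hi, qShift_var]
    rw [Finset.prod_congr rfl fun i' hi' => by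
      rw [qShift_var, if_neg (by simpa using Finset.ne_of_mem_erase hi')]]
    simp [mul_assoc]
  simp only [opCoeff, map_mul, map_zpow₀, map_prod, Finset.prod_singleton, hcompl,
    Finset.prod_disjUnion]
  rw [hX, qShift_var, if_pos hi, hA]
  simp only [← Finset.mul_prod_erase I _ hi, hB, hC, mul_zpow, zpow_sub₀ hq]
  have hqk : algebraMap F (RatFun F N) q ^ k ≠ 0 := zpow_ne_zero _ hq
  field_simp

/-- Both orders of composition shift `I ∪ {i}`. Interactions with the complement of this set are
common to both, and what distinguishes them are the pairs between `i` and `I`: exactly the factors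
of `exchangeSum`. -/
theorem opCoeff_insert (q : Fˣ) (u : F) (k l : ℤ) {I : Finset (Fin N)} {i : Fin N}
    (hi : i ∉ I) :
    opCoeff u k I * qShift q I (opCoeff u l {i}) =
      opCoeff u k (insert i I) * (var F i ^ (l - k) *
        ∏ j ∈ I, (pairWeight u j i *
          ((var F i - algebraMap F (RatFun F N) u * (algebraMap F (RatFun F N) q * var F j)) /
            (var F i - algebraMap F (RatFun F N) q * var F j)))) ∧
    opCoeff u l {i} * qShift q {i} (opCoeff u k I) =
      opCoeff u k (insert i I) * (var F i ^ (l - k) *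
        ∏ j ∈ I, (pairWeight u i j *
          ((var F j - algebraMap F (RatFun F N) u * (algebraMap F (RatFun F N) q * var F i)) /
            (var F j - algebraMap F (RatFun F N) q * var F i)))) := by
  have hcompl : ({i} : Finset (Fin N))ᶜ = I.disjUnion (insert i I)ᶜ
      (Finset.disjoint_left.2 fun j hj => by simp [hj]) := by
    ext j; simp; by_cases h : j = i
    · simp [h, hi]
    · simp [h]; tauto
  have hcompl' : Iᶜ = insert i (insert i I)ᶜ := by
    ext j; simp; by_cases h : j = i
    · simp [h, hi]
    · simp [h]
  have hni : i ∉ (insert i I)ᶜ := by simp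
  have hx := var_ne_zero (F := F) i
  have hX : ∏ i' ∈ I, qShift q {i} (var F i') = ∏ i' ∈ I, var F i' := by
    refine Finset.prod_congr rfl fun i' hi' => ?_
    rw [qShift_var, if_neg]
    simp only [Finset.mem_singleton]
    rintro rfl; exact hi hi'
  have hout : ∀ j ∈ (insert i I)ᶜ, j ≠ i ∧ j ∉ I := by intro j hj; simpa using hj
  have hA : ∏ j ∈ (insert i I)ᶜ, qShift q I (pairWeight u i j) =
      ∏ j ∈ (insert i I)ᶜ, pairWeight u i j :=
    Finset.prod_congr rfl fun j hj => qShift_pairWeight q u I (by simp [hi, hout j hj])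
  have hB : ∏ i' ∈ I, ∏ j ∈ (insert i I)ᶜ, qShift q {i} (pairWeight u i' j) =
      ∏ i' ∈ I, ∏ j ∈ (insert i I)ᶜ, pairWeight u i' j :=
    Finset.prod_congr rfl fun i' hi' => Finset.prod_congr rfl fun j hj =>
      qShift_pairWeight q u _ (by
        have : i' ≠ i := fun h => hi (h ▸ hi')
        simp [this, hout j hj])
  have hC : ∏ j ∈ I, qShift q I (pairWeight u i j) = ∏ j ∈ I,
      ((var F i - algebraMap F (RatFun F N) u * (algebraMap F (RatFun F N) q * var F j)) /
            (var F i - algebraMap F (RatFun F N) q * var F j)) :=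
    Finset.prod_congr rfl fun j hj => by
      simp [pairWeight, qShift_var, hi, hj]
  have hD : ∏ j ∈ I, qShift q {i} (pairWeight u j i) = ∏ j ∈ I,
      ((var F j - algebraMap F (RatFun F N) u * (algebraMap F (RatFun F N) q * var F i)) /
            (var F j - algebraMap F (RatFun F N) q * var F i)) :=
    Finset.prod_congr rfl fun j hj => by
      have : j ≠ i := fun h => hi (h ▸ hj)
      simp [pairWeight, qShift_var, this]
  constructor
  · simp only [opCoeff, map_mul, map_zpow₀, map_prod, Finset.prod_singleton, hcompl,
      Finset.prod_disjUnion, hA, hC]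
    simp only [hcompl', Finset.prod_insert hni, Finset.prod_insert hi, Finset.prod_mul_distrib,
      mul_zpow, zpow_sub₀ hx]
    rw [qShift_var, if_neg hi]
    have hxk := zpow_ne_zero k hx
    generalize var F i ^ k = y at *
    field_simp
  · simp only [opCoeff, map_mul, map_zpow₀, map_prod, Finset.prod_singleton, hcompl,
      Finset.prod_disjUnion]
    rw [hX]
    simp only [hcompl', Finset.prod_insert hni, Finset.prod_insert hi, Finset.prod_mul_distrib,
      mul_zpow, zpow_sub₀ hx, hB, hD]
    have hxk := zpow_ne_zero k hx
    generalize var F i ^ k = y at *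
    field_simp

theorem weightedOp_commutator (q : Fˣ) (u : F) (a : ℕ) (k l : ℤ) (f : RatFun F N) :
    weightedOp N q u a k (weightedOp N q u 1 l f) -
        algebraMap F (RatFun F N) q ^ (l - k) * weightedOp N q u 1 l (weightedOp N q u a k f) =
      ∑ S ∈ Finset.powersetCard (a + 1) (Finset.univ : Finset (Fin N)),
        opCoeff u k S * exchangeSum (algebraMap F (RatFun F N) q) (algebraMap F (RatFun F N) u)
          (var F) S (l - k) * qShift q S f := by
  set Q := algebraMap F (RatFun F N) q
  set U := algebraMap F (RatFun F N) u
  let G : Finset (Fin N) → Fin N → RatFun F N := fun S i =>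
    opCoeff u k S * (var F i ^ (l - k) *
      ((∏ j ∈ S.erase i, ((var F j - U * var F i) / (var F j - var F i) *
        ((var F i - U * (Q * var F j)) / (var F i - Q * var F j)))) -
      Q ^ (l - k) * ∏ j ∈ S.erase i, ((var F i - U * var F j) / (var F i - var F j) *
        ((var F j - U * (Q * var F i)) / (var F j - Q * var F i))))) * qShift q S f
  have hterm : ∀ I i, opCoeff u k I * qShift q I (opCoeff u l {i} * qShift q {i} f) -
      Q ^ (l - k) * (opCoeff u l {i} * qShift q {i} (opCoeff u k I * qShift q I f)) =
      if i ∈ I then 0 else G (insert i I) i := by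
    intro I i
    rw [map_mul, map_mul, qShift_qShift_comm q {i} I]
    split_ifs with hi
    · rw [← mul_assoc, qShift_opCoeff_of_mem q u k l hi]; ring
    · obtain ⟨h1, h2⟩ := opCoeff_insert q u k l hi
      rw [← mul_assoc, h1, ← mul_assoc (opCoeff u l {i}), h2, qShift_insert q hi]
      simp only [G, Finset.erase_insert hi, pairWeight]
      ring
  have hL : weightedOp N q u a k (weightedOp N q u 1 l f) -
        Q ^ (l - k) * weightedOp N q u 1 l (weightedOp N q u a k f) =
      ∑ I ∈ Finset.powersetCard a (Finset.univ : Finset (Fin N)), ∑ i,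
        if i ∈ I then 0 else G (insert i I) i := by
    rw [weightedOp_one_apply, weightedOp_one_apply, weightedOp_apply, weightedOp_apply]
    simp only [map_sum, Finset.mul_sum, ← hterm, Finset.sum_sub_distrib]
    congr 1
    rw [Finset.sum_comm]
  have hR : ∀ S, opCoeff u k S * exchangeSum Q U (var F) S (l - k) * qShift q S f =
      ∑ i ∈ S, G S i := by
    intro S
    rw [exchangeSum, Finset.mul_sum, Finset.sum_mul]
  rw [hL, Finset.sum_congr rfl fun S _ => hR S]
  have hif : ∀ I : Finset (Fin N), (∑ i, if i ∈ I then 0 else G (insert i I) i) =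
      ∑ i ∈ Iᶜ, G (insert i I) i := by
    intro I
    rw [← Finset.sum_filter_add_sum_filter_not Finset.univ (· ∈ I)]
    rw [Finset.sum_eq_zero fun i hi => if_pos (Finset.mem_filter.1 hi).2, zero_add]
    refine Finset.sum_congr (by ext; simp) fun i hi => ?_
    rw [if_neg (by simpa using hi)]
  simp only [hif]
  rw [Finset.sum_sigma', Finset.sum_sigma']
  -- Pairs `(I, i)` with `i ∉ I` correspond to pairs `(S, i)` with `i ∈ S`, through `S = I ∪ {i}`.
  refine Finset.sum_bij' (fun p _ => ⟨insert p.2 p.1, p.2⟩) (fun p _ => ⟨p.1.erase p.2, p.2⟩)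
    ?_ ?_ ?_ ?_ ?_
  · rintro ⟨I, i⟩ h
    simp only [Finset.mem_sigma, Finset.mem_powersetCard, Finset.mem_compl] at h ⊢
    exact ⟨⟨Finset.subset_univ _, by rw [Finset.card_insert_of_notMem h.2, h.1.2]⟩,
      Finset.mem_insert_self _ _⟩
  · rintro ⟨S, i⟩ h
    simp only [Finset.mem_sigma, Finset.mem_powersetCard, Finset.mem_compl] at h ⊢
    exact ⟨⟨Finset.subset_univ _, by rw [Finset.card_erase_of_mem h.2, h.1.2]; rfl⟩,
      Finset.notMem_erase _ _⟩
  · rintro ⟨I, i⟩ h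
    simp only [Finset.mem_sigma, Finset.mem_compl] at h
    simp [Finset.erase_insert h.2]
  · rintro ⟨S, i⟩ h
    simp only [Finset.mem_sigma] at h
    simp [Finset.insert_erase h.2]
  · rintro ⟨I, i⟩ h; rfl

end Operators

/-! ### Commutation relations -/

section Commutation

variable {F : Type*} [Field F] {N : ℕ}

theorem algebraMap_unit_ne_one {q : Fˣ} (hq : (q : F) ≠ 1) : algebraMap F (RatFun F N) q ≠ 1 := by
  rw [← map_one (algebraMap F (RatFun F N))]
  exact fun h => hq ((algebraMap F (RatFun F N)).injective h)

theorem var_ne_mul_var {q : Fˣ} (hq : (q : F) ≠ 1) (i j : Fin N) :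
    var F i ≠ algebraMap F (RatFun F N) q * var F j := by
  by_cases hij : i = j
  · subst hij
    intro h
    have := mul_right_cancel₀ (var_ne_zero i) ((one_mul (var F i)).trans h)
    exact algebraMap_unit_ne_one hq this.symm
  · exact var_ne_smul_var hij _

/-- A rank one operator commutes with the operators of the same degree `k`. -/
theorem weightedOp_comm_one {q : Fˣ} {u : F} (hq : (q : F) ≠ 1) (hu : u ≠ 1) (huq : u * q ≠ 1)
    (a : ℕ) (k : ℤ) (f : RatFun F N) :
    weightedOp N q u a k (weightedOp N q u 1 k f) =
      weightedOp N q u 1 k (weightedOp N q u a k f) := by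
  have h := weightedOp_commutator q u a k k f
  rw [sub_self, zpow_zero, one_mul, Finset.sum_eq_zero, sub_eq_zero] at h
  · exact h
  · intro S hS
    have hc := (Finset.mem_powersetCard.1 hS).2
    have inj := (algebraMap F (RatFun F N)).injective
    rw [exchangeSum_exponent_zero (by simp) (algebraMap_unit_ne_one hq) (fun h => hu (inj (by simpa using h)))
      (fun h => huq (inj (by simpa using h))) (Finset.card_pos.1 (by omega))
      (fun i _ => var_ne_zero i) (var_injective.injOn) (fun i _ j _ => var_ne_mul_var hq i j)]
    simp

/-- The sets `S` have `a + 1` elements, so the vanishing range of `exchangeSum` is precisely `-a ≤ l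
- k ≤ a`. -/
theorem opM_opM_one {q : Fˣ} (hq : (q : F) ≠ 1) {a : ℕ} {k l : ℤ} (h1 : -(a : ℤ) ≤ l - k)
    (h2 : l - k ≤ a) (f : RatFun F N) :
    opM N q a k (opM N q 1 l f) = (q : F) ^ (l - k) • opM N q 1 l (opM N q a k f) := by
  simp only [opM_eq_weightedOp]
  have h := weightedOp_commutator q 0 a k l f
  rw [Finset.sum_eq_zero, sub_eq_zero] at h
  · rw [h, Algebra.smul_def, map_zpow₀]
  · intro S hS
    have hc := (Finset.mem_powersetCard.1 hS).2
    rw [map_zero, exchangeSum_eq_zero (by simp) (algebraMap_unit_ne_one hq)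
      (fun i _ => var_ne_zero i) (var_injective.injOn) (fun i _ j _ => var_ne_mul_var hq i j) _
      (by omega) (by omega)]
    simp

/-- Just beyond the vanishing range, at `l - k = a + 1`, the exchange sum is a constant times `∏_{i
∈ S} x_i`, which raises the exponent `k` to `k + 1`. This expresses higher rank operators through
rank one operators. -/
theorem opM_succ {q : Fˣ} (hq : (q : F) ≠ 1) (a : ℕ) : ∃ c : F, ∀ (k : ℤ) (f : RatFun F N),
    opM N q (a + 1) (k + 1) f =
      c • (opM N q a k (opM N q 1 (k + (a + 1)) f) -
        (q : F) ^ (a + 1) • opM N q 1 (k + (a + 1)) (opM N q a k f)) := by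
  have hq2 : 1 - (q : F)⁻¹ ≠ 0 := by
    rw [sub_ne_zero]; intro h; apply hq; rw [← inv_inv (q : F), ← h, inv_one]
  have hc : -((q : F)⁻¹ ^ (a + 1) * ((-(q : F)) ^ a / (1 - (q : F)⁻¹))) ≠ 0 := by
    refine neg_ne_zero.2 (mul_ne_zero (by simp) (div_ne_zero (by simp) hq2))
  refine ⟨-((q : F)⁻¹ ^ (a + 1) * ((-(q : F)) ^ a / (1 - (q : F)⁻¹))), fun k f => ?_⟩
  have h := weightedOp_commutator q 0 a k (k + (a + 1)) f
  have e1 : k + ((a : ℤ) + 1) - k = ((a + 1 : ℕ) : ℤ) := by push_cast; ring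
  rw [e1] at h
  have hq' : (q : F) ^ (a + 1) • weightedOp N q 0 1 (k + (a + 1)) (weightedOp N q 0 a k f) =
      algebraMap F (RatFun F N) q ^ ((a + 1 : ℕ) : ℤ) *
        weightedOp N q 0 1 (k + (a + 1)) (weightedOp N q 0 a k f) := by
    rw [Algebra.smul_def, zpow_natCast, map_pow]
  simp only [opM_eq_weightedOp]
  rw [hq', h, weightedOp_apply, Finset.smul_sum]
  refine Finset.sum_congr rfl fun S hS => ?_
  have hcS := (Finset.mem_powersetCard.1 hS).2
  have hE := exchangeSum_card (q := algebraMap F (RatFun F N) q) (by simp)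
    (algebraMap_unit_ne_one hq) (Finset.card_pos.1 (by omega : 0 < S.card))
      (fun i _ => var_ne_zero i) (var_injective.injOn) (fun i _ j _ => var_ne_mul_var hq i j)
  rw [hcS, Nat.add_sub_cancel] at hE
  rw [map_zero, hE]
  have hcast : (algebraMap F (RatFun F N) q)⁻¹ ^ (a + 1) *
      ((-algebraMap F (RatFun F N) q) ^ a / (1 - (algebraMap F (RatFun F N) q)⁻¹)) =
      algebraMap F (RatFun F N) ((q : F)⁻¹ ^ (a + 1) * ((-(q : F)) ^ a / (1 - (q : F)⁻¹))) := by
    simp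
  have hX : ∏ i ∈ S, var F i ≠ 0 := Finset.prod_ne_zero_iff.2 fun i _ => var_ne_zero i
  have hc' := (map_ne_zero (algebraMap F (RatFun F N))).2 (neg_ne_zero.1 hc)
  rw [hcast, Algebra.smul_def, map_neg, opCoeff, opCoeff, zpow_add_one₀ hX]
  generalize algebraMap F (RatFun F N)
    ((q : F)⁻¹ ^ (a + 1) * ((-(q : F)) ^ a / (1 - (q : F)⁻¹))) = D at hc' ⊢
  field_simp

/-- The `q`-commutation relations of the quantum `Q`-system. -/
theorem opM_opM_of_le {q : Fˣ} (hq : (q : F) ≠ 1) {a b : ℕ} (hb : 1 ≤ b) (hba : b ≤ a) (k : ℤ)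
    {l : ℤ} (h : |l - k| ≤ (a : ℤ) - b + 1) (f : RatFun F N) :
    opM N q a k (opM N q b l f) = (q : F) ^ (b * (l - k)) • opM N q b l (opM N q a k f) := by
  have hq0 : (q : F) ≠ 0 := q.ne_zero
  induction b, hb using Nat.le_induction generalizing l f with
  | base =>
    rw [abs_le] at h
    rw [opM_opM_one hq (by push_cast at h; omega) (by push_cast at h; omega), Nat.cast_one, one_mul]
  | succ b hb ih =>
    rw [abs_le] at h
    push_cast at h
    -- `M_{b+1,l}` is a `q`-commutator of `M_{b,l-1}` and `M_{1,l+b}`. Both `q`-commute with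
    -- `M_{a,k}` in the given range, and their scalars multiply.
    obtain ⟨c, hc⟩ := opM_succ (N := N) hq b
    have hl : l = (l - 1) + 1 := by ring
    have ih' : ∀ f, opM N q a k (opM N q b (l - 1) f) =
        (q : F) ^ (b * (l - 1 - k)) • opM N q b (l - 1) (opM N q a k f) := fun f =>
      ih (by omega) (by rw [abs_le]; constructor <;> omega) f
    have h1 : ∀ f, opM N q a k (opM N q 1 (l - 1 + (b + 1)) f) =
        (q : F) ^ (l - 1 + (b + 1) - k) • opM N q 1 (l - 1 + (b + 1)) (opM N q a k f) := fun f =>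
      opM_opM_one hq (by omega) (by omega) f
    rw [hl, hc, hc, map_smul, map_sub, map_smul, ih', h1, h1, ih']
    simp only [map_smul, smul_sub, smul_smul]
    have he : (q : F) ^ ((b : ℤ) * (l - 1 - k)) * (q : F) ^ (l - 1 + (b + 1) - k) =
        (q : F) ^ (((b + 1 : ℕ) : ℤ) * (l - 1 + 1 - k)) := by
      rw [← zpow_add₀ hq0]; congr 1; push_cast; ring
    rw [← he]
    congr 2 <;> ring

/-- The allowed range is `|k| ≤ |a - b| + 1`, so `|k| ≤ 1` suffices for all ranks. The exponent is
`k (ω_a, ω_b)`, which is what moves the eigenvalues by `k ω_a`. -/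
theorem opM_zero_opM_one {q : Fˣ} (hq : (q : F) ≠ 1) {a b : ℕ} (ha : 1 ≤ a) (hb : 1 ≤ b) {k : ℤ}
    (hk : |k| ≤ 1) (f : RatFun F N) :
    opM N q b 0 (opM N q a k f) =
      (q : F) ^ ((min a b : ℕ) * k) • opM N q a k (opM N q b 0 f) := by
  have hq0 : (q : F) ≠ 0 := q.ne_zero
  rcases le_total a b with hab | hab
  · rw [opM_opM_of_le hq ha hab 0 (by rw [sub_zero]; omega), sub_zero, min_eq_left hab]
  · rw [opM_opM_of_le hq hb hab k (by rw [zero_sub, abs_neg]; omega), min_eq_right hab, smul_smul,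
      ← zpow_add₀ hq0]
    simp

end Commutation

/-! ### Inversions of subsets -/

section PairCounting

variable {N : ℕ}

/-- The number of pairs `i < j` with `i ∉ J` and `j ∈ J`. -/
def inversions (J : Finset (Fin N)) : ℕ := ∑ i ∈ Jᶜ, (J ∩ Finset.Ioi i).card

theorem sum_card_inter_Ioi (K : Finset (Fin N)) :
    ∑ i ∈ K, (K ∩ Finset.Ioi i).card = K.card.choose 2 := by
  induction K using Finset.induction_on_min with
  | empty => simp
  | insert m K hm ih =>
    have hmK : m ∉ K := fun h => lt_irrefl _ (hm m h)
    rw [Finset.sum_insert hmK, Finset.card_insert_of_notMem hmK, Nat.choose_succ_succ' _ 1,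
      Nat.choose_one_right, ← ih]
    congr 1
    · congr 1; ext j; simp only [Finset.mem_inter, Finset.mem_insert, Finset.mem_Ioi]
      constructor
      · rintro ⟨rfl | h, h'⟩
        · exact absurd h' (lt_irrefl _)
        · exact h
      · exact fun h => ⟨Or.inr h, hm j h⟩
    · refine Finset.sum_congr rfl fun i hi => ?_
      congr 1; ext j; simp only [Finset.mem_inter, Finset.mem_insert, Finset.mem_Ioi]
      constructor
      · rintro ⟨rfl | h, h'⟩
        · exact absurd h' (hm i hi).not_gt
        · exact ⟨h, h'⟩
      · exact fun h => ⟨Or.inr h.1, h.2⟩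

/-- `i.rev` counts the indices above `i`; they are split into those in `J` and those outside. -/
theorem sum_rev_compl (J : Finset (Fin N)) :
    ∑ i ∈ Jᶜ, (i.rev : ℕ) = Jᶜ.card.choose 2 + inversions J := by
  rw [← sum_card_inter_Ioi, inversions, ← Finset.sum_add_distrib]
  refine Finset.sum_congr rfl fun i _ => ?_
  have : (i.rev : ℕ) = (Finset.Ioi i).card := by
    rw [Fin.card_Ioi, Fin.val_rev]; omega
  rw [this, ← Finset.card_union_of_disjoint]
  · congr 1; ext j; simp; tauto
  · rw [Finset.disjoint_left]; intro j; simp; tauto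

theorem sum_rev_add_inversions (J : Finset (Fin N)) :
    ∑ i ∈ J, (i.rev : ℕ) + inversions J = J.card.choose 2 + J.card * (N - J.card) := by
  have h1 : ∀ K : Finset (Fin N), ∑ i ∈ K, (i.rev : ℕ) =
      K.card.choose 2 + ∑ i ∈ K, (Kᶜ ∩ Finset.Ioi i).card := by
    intro K
    have := sum_rev_compl Kᶜ
    rwa [compl_compl, inversions, compl_compl] at this
  have h2 : ∑ i ∈ J, (Jᶜ ∩ Finset.Ioi i).card + inversions J = J.card * (N - J.card) := by
    have e1 : ∀ i, (Jᶜ ∩ Finset.Ioi i).card = ∑ j ∈ Jᶜ, if i < j then 1 else 0 := by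
      intro i; rw [Finset.card_eq_sum_ones, ← Finset.sum_filter]
      congr 1; ext j; simp
    have e2 : ∀ i, (J ∩ Finset.Ioi i).card = ∑ j ∈ J, if i < j then 1 else 0 := by
      intro i; rw [Finset.card_eq_sum_ones, ← Finset.sum_filter]
      congr 1; ext j; simp
    simp only [inversions, e1, e2]
    rw [Finset.sum_comm (s := Jᶜ), ← Finset.sum_add_distrib]
    simp only [← Finset.sum_add_distrib]
    have e3 : ∀ i ∈ J, ∀ j ∈ Jᶜ, ((if i < j then 1 else 0) + if j < i then 1 else 0) = 1 := by
      intro i hi j hj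
      have hij : i ≠ j := fun h => (Finset.mem_compl.1 hj) (h ▸ hi)
      rcases lt_or_gt_of_ne hij with h | h
      · rw [if_pos h, if_neg h.not_gt]
      · rw [if_neg h.not_gt, if_pos h]
    rw [Finset.sum_congr rfl fun i hi => Finset.sum_congr rfl fun j hj => e3 i hi j hj]
    rw [Finset.sum_const, Finset.sum_const, Finset.card_compl, Fintype.card_fin, smul_eq_mul,
      smul_eq_mul, mul_one]
  rw [h1]; omega

/-- The initial segment `{1, …, a}` of `{1, …, N}`. -/
def initialSegment (N a : ℕ) : Finset (Fin N) := Finset.univ.filter fun i => i.val < a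

theorem mem_initialSegment {a : ℕ} {i : Fin N} : i ∈ initialSegment N a ↔ i.val < a := by
  simp [initialSegment]

theorem card_initialSegment {a : ℕ} (ha : a ≤ N) : (initialSegment N a).card = a := by
  rw [initialSegment, Fin.card_filter_val_lt, min_eq_right ha]

theorem inversions_initialSegment (a : ℕ) : inversions (initialSegment N a) = 0 := by
  rw [inversions, Finset.sum_eq_zero]
  intro i hi
  rw [Finset.card_eq_zero, Finset.eq_empty_iff_forall_notMem]
  intro j
  simp only [Finset.mem_compl, mem_initialSegment, not_lt, Finset.mem_inter,
    Finset.mem_Ioi, not_and] at hi ⊢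
  intro h
  rw [Fin.le_def]
  omega

/-- A set without inversions is downward closed. This is why a single subset survives when `u = 0`.
-/
theorem eq_initialSegment_of_inversions_eq_zero {J : Finset (Fin N)} (h : inversions J = 0) :
    J = initialSegment N J.card := by
  have hlow : ∀ i j, i < j → j ∈ J → i ∈ J := by
    intro i j hij hj
    by_contra hi
    rw [inversions, Finset.sum_eq_zero_iff] at h
    have := h i (Finset.mem_compl.2 hi)
    rw [Finset.card_eq_zero, Finset.eq_empty_iff_forall_notMem] at this
    exact this j (Finset.mem_inter.2 ⟨hj, Finset.mem_Ioi.2 hij⟩)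
  have hle : J.card ≤ N := by simpa using Finset.card_le_univ J
  symm
  apply Finset.eq_of_subset_of_card_le
  · intro i hi
    rw [mem_initialSegment] at hi
    by_contra hiJ
    have hsub : J ⊆ Finset.Iio i := by
      intro j hj
      rw [Finset.mem_Iio]
      rcases lt_trichotomy j i with h' | h' | h'
      · exact h'
      · exact absurd (h' ▸ hj) hiJ
      · exact absurd (hlow i j h' hj) hiJ
    have := Finset.card_le_card hsub
    rw [Fin.card_Iio] at this
    omega
  · rw [card_initialSegment hle]

end PairCounting

/-! ### Expansion of the weights against the Vandermonde product -/

section Alternants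

open MvPolynomial

/-- The exponent `δ = (N - 1, N - 2, …, 0)`. -/
def staircase (N : ℕ) : Fin N →₀ ℕ := Finsupp.equivFunOnFinite.symm fun i => (i.rev : ℕ)

@[simp] theorem staircase_apply {N : ℕ} (i : Fin N) : staircase N i = (i.rev : ℕ) := rfl

theorem prod_sub_eq_sum_perm {A : Type*} [CommRing A] {N : ℕ} (y : Fin N → A) :
    ∏ i : Fin N, ∏ j ∈ Finset.Ioi i, (y i - y j) =
      ∑ w : Equiv.Perm (Fin N), ((Equiv.Perm.sign w : ℤ) : A) * ∏ i, y (w i) ^ (i.rev : ℕ) := by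
  have h := Matrix.det_projVandermonde 1 y
  simp only [Pi.one_apply, one_mul] at h
  rw [← h, Matrix.det_apply']
  simp [Matrix.projVandermonde_apply]

theorem prod_Ioi_eq_prod_split {A : Type*} [CommMonoid A] {N : ℕ} (I : Finset (Fin N))
    (g : Fin N → Fin N → A) :
    ∏ i : Fin N, ∏ j ∈ Finset.Ioi i, g i j =
      (∏ i ∈ I, ∏ j ∈ I ∩ Finset.Ioi i, g i j) * (∏ i ∈ Iᶜ, ∏ j ∈ Iᶜ ∩ Finset.Ioi i, g i j) *
        ∏ i ∈ I, ∏ j ∈ Iᶜ, if i < j then g i j else g j i := by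
  have e : ∀ (K : Finset (Fin N)) i, ∏ j ∈ K ∩ Finset.Ioi i, g i j =
      ∏ j ∈ K, if i < j then g i j else 1 := by
    intro K i; rw [← Finset.prod_filter]
    congr 1; ext j; simp
  have e' : ∀ i, ∏ j ∈ Finset.Ioi i, g i j = (∏ j ∈ I ∩ Finset.Ioi i, g i j) *
      ∏ j ∈ Iᶜ ∩ Finset.Ioi i, g i j := by
    intro i
    rw [← Finset.prod_union]
    · congr 1; ext j; simp; tauto
    · rw [Finset.disjoint_left]; intro j; simp; tauto
  have e3 : ∏ i ∈ I, ∏ j ∈ Iᶜ, (if i < j then g i j else g j i) =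
      (∏ i ∈ I, ∏ j ∈ Iᶜ ∩ Finset.Ioi i, g i j) * ∏ i ∈ Iᶜ, ∏ j ∈ I ∩ Finset.Ioi i, g i j := by
    simp only [e]
    rw [Finset.prod_comm (s := Iᶜ), ← Finset.prod_mul_distrib]
    simp only [← Finset.prod_mul_distrib]
    refine Finset.prod_congr rfl fun i hi => Finset.prod_congr rfl fun j hj => ?_
    have hij : i ≠ j := fun h => (Finset.mem_compl.1 hj) (h ▸ hi)
    rcases lt_or_gt_of_ne hij with h | h
    · rw [if_pos h, if_neg h.not_gt, if_pos h, mul_one]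
    · rw [if_neg h.not_gt, if_pos h, if_neg h.not_gt, one_mul]
  rw [e3, ← Finset.prod_mul_prod_compl I]
  simp only [e', Finset.prod_mul_distrib]
  ac_rfl

/-- The product of the mixed factors `x_i - u x_j`, `i ∈ I`, `j ∉ I`, with the Vandermonde
product, expanded over permutations. -/
theorem prod_mul_vandermonde_expand {A : Type*} [CommRing A] {N : ℕ} (y : Fin N → A) (u : A)
    (I : Finset (Fin N)) :
    (∏ i ∈ I, ∏ j ∈ Iᶜ, (y i - u * y j)) * ∏ i : Fin N, ∏ j ∈ Finset.Ioi i, (y i - y j) =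
      (∏ i ∈ I, ∏ j ∈ Iᶜ, (y i - y j)) *
        ∑ w : Equiv.Perm (Fin N), ((Equiv.Perm.sign w : ℤ) : A) *
          (u ^ inversions (I.map w⁻¹.toEmbedding) * ∏ i, y (w i) ^ (i.rev : ℕ)) := by
  -- With an indeterminate in place of `u`, powers of it can be cancelled; `u` is substituted at the
  -- end.
  have main : (∏ i ∈ I, ∏ j ∈ Iᶜ, (Polynomial.C (y i) - Polynomial.X * Polynomial.C (y j))) *
      ∏ i : Fin N, ∏ j ∈ Finset.Ioi i, (Polynomial.C (y i) - Polynomial.C (y j)) =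
      (∏ i ∈ I, ∏ j ∈ Iᶜ, (Polynomial.C (y i) - Polynomial.C (y j))) *
        ∑ w : Equiv.Perm (Fin N), ((Equiv.Perm.sign w : ℤ) : Polynomial A) *
          (Polynomial.X ^ inversions (I.map w⁻¹.toEmbedding) *
            ∏ i, Polynomial.C (y (w i)) ^ (i.rev : ℕ)) := by
    set z : Fin N → Polynomial A := fun i => Polynomial.C (y i) with hz
    set X : Polynomial A := Polynomial.X with hX
    have hcancel : ∀ P Q : Polynomial A, X ^ (Iᶜ.card.choose 2) * P = X ^ (Iᶜ.card.choose 2) * Q →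
        P = Q := by
      intro P Q h
      exact (Polynomial.isRegular_X_pow _).left h
    apply hcancel
    -- In the Vandermonde product, scale the variables outside `I` by `X`. Mixed pairs become `±
    -- (z_i - X z_j)`, pairs outside `I` give the superfluous power of `X`, and in the expansion the
    -- remaining power of `X` counts inversions.
    have hscaled := prod_sub_eq_sum_perm (fun i => (if i ∈ I then 1 else X) * z i)
    have hsum : ∀ w : Equiv.Perm (Fin N),
        ∏ i, ((if w i ∈ I then 1 else X) * z (w i)) ^ (i.rev : ℕ) =
        X ^ (Iᶜ.card.choose 2) * (X ^ inversions (I.map w⁻¹.toEmbedding) *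
          ∏ i, z (w i) ^ (i.rev : ℕ)) := by
      intro w
      simp only [mul_pow, Finset.prod_mul_distrib]
      rw [← mul_assoc, ← pow_add]
      congr 1
      have hcard : Iᶜ.card = (I.map w⁻¹.toEmbedding)ᶜ.card := by
        rw [Finset.card_compl, Finset.card_compl, Finset.card_map]
      rw [hcard, ← sum_rev_compl, ← Finset.prod_pow_eq_pow_sum]
      rw [← Finset.prod_mul_prod_compl (I.map w⁻¹.toEmbedding), Finset.prod_eq_one, one_mul]
      · refine Finset.prod_congr rfl fun i hi => ?_
        rw [if_neg]
        intro h
        exact (Finset.mem_compl.1 hi) (Finset.mem_map.2 ⟨w i, h, by simp⟩)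
      · intro i hi
        obtain ⟨j, hj, rfl⟩ := Finset.mem_map.1 hi
        simp [hj]
    simp only [hsum] at hscaled
    have hprod : (∏ i ∈ I, ∏ j ∈ Iᶜ, (z i - z j)) * ∏ i : Fin N, ∏ j ∈ Finset.Ioi i,
        ((if i ∈ I then 1 else X) * z i - (if j ∈ I then 1 else X) * z j) =
        X ^ (Iᶜ.card.choose 2) * ((∏ i ∈ I, ∏ j ∈ Iᶜ, (z i - X * z j)) *
          ∏ i : Fin N, ∏ j ∈ Finset.Ioi i, (z i - z j)) := by
      rw [prod_Ioi_eq_prod_split I, prod_Ioi_eq_prod_split I]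
      have h1 : ∏ i ∈ I, ∏ j ∈ I ∩ Finset.Ioi i,
          ((if i ∈ I then 1 else X) * z i - (if j ∈ I then 1 else X) * z j) =
          ∏ i ∈ I, ∏ j ∈ I ∩ Finset.Ioi i, (z i - z j) :=
        Finset.prod_congr rfl fun i hi => Finset.prod_congr rfl fun j hj => by
          rw [if_pos hi, if_pos (Finset.mem_inter.1 hj).1, one_mul, one_mul]
      have h2 : ∏ i ∈ Iᶜ, ∏ j ∈ Iᶜ ∩ Finset.Ioi i,
          ((if i ∈ I then 1 else X) * z i - (if j ∈ I then 1 else X) * z j) =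
          X ^ (Iᶜ.card.choose 2) * ∏ i ∈ Iᶜ, ∏ j ∈ Iᶜ ∩ Finset.Ioi i, (z i - z j) := by
        rw [← sum_card_inter_Ioi, ← Finset.prod_pow_eq_pow_sum, ← Finset.prod_mul_distrib]
        refine Finset.prod_congr rfl fun i hi => ?_
        rw [← Finset.prod_const, ← Finset.prod_mul_distrib]
        refine Finset.prod_congr rfl fun j hj => ?_
        rw [if_neg (Finset.mem_compl.1 hi), if_neg (Finset.mem_compl.1 (Finset.mem_inter.1 hj).1),
          mul_sub]
      have h3 : (∏ i ∈ I, ∏ j ∈ Iᶜ, (z i - z j)) * ∏ i ∈ I, ∏ j ∈ Iᶜ,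
          (if i < j then (if i ∈ I then 1 else X) * z i - (if j ∈ I then 1 else X) * z j
            else (if j ∈ I then 1 else X) * z j - (if i ∈ I then 1 else X) * z i) =
          (∏ i ∈ I, ∏ j ∈ Iᶜ, (z i - X * z j)) *
            ∏ i ∈ I, ∏ j ∈ Iᶜ, if i < j then z i - z j else z j - z i := by
        simp only [← Finset.prod_mul_distrib]
        refine Finset.prod_congr rfl fun i hi => Finset.prod_congr rfl fun j hj => ?_
        rw [if_pos hi, if_neg (Finset.mem_compl.1 hj)]
        split_ifs <;> ring
      rw [h1, h2, mul_left_comm, h3]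
      ac_rfl
    rw [← hprod, hscaled]
    simp only [Finset.mul_sum]
    refine Finset.sum_congr rfl fun w _ => ?_
    ring
  have := congrArg (Polynomial.eval u) main
  simpa [Polynomial.eval_prod, Polynomial.eval_finsetSum, mul_comm u] using this

end Alternants

/-! ### Antisymmetrization over a commutative ring -/

section AlternatingSums

open MvPolynomial

variable {R : Type*} [CommRing R] {N : ℕ}

/-- The antisymmetrization `∑_w sgn(w) w(f)`. -/
def alternant : MvPolynomial (Fin N) R →ₗ[R] MvPolynomial (Fin N) R where
  toFun f := ∑ w : Equiv.Perm (Fin N),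
    ((Equiv.Perm.sign w : ℤ) : MvPolynomial (Fin N) R) * rename w f
  map_add' f g := by simp only [map_add, mul_add, Finset.sum_add_distrib]
  map_smul' c f := by simp only [map_smul, mul_smul_comm, Finset.smul_sum, RingHom.id_apply]

theorem alternant_apply (f : MvPolynomial (Fin N) R) :
    alternant f = ∑ w : Equiv.Perm (Fin N),
      ((Equiv.Perm.sign w : ℤ) : MvPolynomial (Fin N) R) * rename w f := rfl

theorem rename_alternant (v : Equiv.Perm (Fin N)) (f : MvPolynomial (Fin N) R) :
    rename v (alternant f) =
      ((Equiv.Perm.sign v : ℤ) : MvPolynomial (Fin N) R) * alternant f := by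
  rw [alternant_apply, map_sum, Finset.mul_sum]
  refine Fintype.sum_equiv (Equiv.mulLeft v) _ _ fun w => ?_
  rw [map_mul, map_intCast, rename_rename, Equiv.coe_mulLeft, map_mul, ← mul_assoc]
  have : ((Equiv.Perm.sign v : ℤ) : MvPolynomial (Fin N) R) *
      (((Equiv.Perm.sign v * Equiv.Perm.sign w : ℤˣ) : ℤ) : MvPolynomial (Fin N) R) =
      ((Equiv.Perm.sign w : ℤ) : MvPolynomial (Fin N) R) := by
    rw [← Int.cast_mul, ← Units.val_mul, ← mul_assoc, Int.units_mul_self, one_mul]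
  rw [this]; rfl

theorem alternant_mul_symmetric (g : MvPolynomial (Fin N) R) {f : MvPolynomial (Fin N) R}
    (hf : f.IsSymmetric) : alternant (g * f) = alternant g * f := by
  rw [alternant_apply, alternant_apply, Finset.sum_mul]
  refine Finset.sum_congr rfl fun w _ => ?_
  rw [map_mul, hf w, mul_assoc]

/-- The Vandermonde polynomial `∑_w sgn(w) w(x^δ)`. -/
def vandermondePoly (R : Type*) [CommRing R] (N : ℕ) : MvPolynomial (Fin N) R :=
  alternant (monomial (staircase N) 1)

theorem rename_monomial_staircase (w : Equiv.Perm (Fin N)) :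
    rename w (monomial (staircase N) (1 : R)) = ∏ i, X (w i) ^ (i.rev : ℕ) := by
  rw [monomial_eq, C_1, one_mul, Finsupp.prod_fintype _ _ (by simp), map_prod]
  simp

theorem vandermondePoly_eq_prod :
    vandermondePoly R N = ∏ i : Fin N, ∏ j ∈ Finset.Ioi i, (X i - X j) := by
  rw [vandermondePoly, alternant_apply, prod_sub_eq_sum_perm]
  simp only [rename_monomial_staircase]

theorem X_sub_X_ne_zero [Nontrivial R] {i j : Fin N} (h : i ≠ j) :
    (X i - X j : MvPolynomial (Fin N) R) ≠ 0 :=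
  sub_ne_zero.2 fun h' => h (X_injective h')

theorem vandermondePoly_ne_zero [IsDomain R] : vandermondePoly R N ≠ 0 := by
  rw [vandermondePoly_eq_prod]
  exact Finset.prod_ne_zero_iff.2 fun i _ => Finset.prod_ne_zero_iff.2 fun j hj =>
    X_sub_X_ne_zero (Finset.mem_Ioi.1 hj).ne

/-- The substitution `x_i ↦ q x_i` for `i ∈ I` over an arbitrary commutative ring. -/
def scaleVars (q : R) (I : Finset (Fin N)) : MvPolynomial (Fin N) R →ₐ[R] MvPolynomial (Fin N) R :=
  aeval fun i => if i ∈ I then C q * X i else X i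

theorem scaleVars_monomial (q : R) (I : Finset (Fin N)) (m : Fin N →₀ ℕ) (r : R) :
    scaleVars q I (monomial m r) = monomial m (q ^ (∑ i ∈ I, m i) * r) := by
  rw [scaleVars, aeval_monomial, Finsupp.prod_fintype _ _ (by simp), monomial_eq,
    Finsupp.prod_fintype _ _ (by simp), algebraMap_eq]
  have : ∀ i : Fin N, (if i ∈ I then C q * X i else X i : MvPolynomial (Fin N) R) ^ m i =
      C (if i ∈ I then q ^ m i else 1) * X i ^ m i := by
    intro i; split_ifs <;> simp [mul_pow]
  simp only [this, Finset.prod_mul_distrib]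
  rw [← map_prod, Finset.prod_ite_mem, Finset.univ_inter, Finset.prod_pow_eq_pow_sum, ← mul_assoc,
    ← C_mul, mul_comm r]

theorem coeff_scaleVars (q : R) (I : Finset (Fin N)) (f : MvPolynomial (Fin N) R)
    (m : Fin N →₀ ℕ) : coeff m (scaleVars q I f) = q ^ (∑ i ∈ I, m i) * coeff m f := by
  induction f using MvPolynomial.induction_on' with
  | monomial n r =>
    rw [scaleVars_monomial, coeff_monomial, coeff_monomial]
    split_ifs with h
    · rw [h]
    · rw [mul_zero]
  | add f g hf hg => rw [map_add, coeff_add, hf, hg, coeff_add, mul_add]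

theorem rename_scaleVars (q : R) (I : Finset (Fin N)) (w : Equiv.Perm (Fin N))
    (f : MvPolynomial (Fin N) R) :
    rename w (scaleVars q I f) = scaleVars q (I.map w.toEmbedding) (rename w f) := by
  have : (rename w).comp (scaleVars q I) = (scaleVars q (I.map w.toEmbedding)).comp
      (rename w : MvPolynomial (Fin N) R →ₐ[R] _) := by
    ext1 i
    simp only [scaleVars, AlgHom.comp_apply, aeval_X, rename_X, Finset.mem_map_equiv,
      Equiv.symm_apply_apply]
    split_ifs <;> simp
  exact DFunLike.congr_fun this f

theorem map_scaleVars {S : Type*} [CommRing S] (φ : R →+* S) (q : R) (I : Finset (Fin N))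
    (f : MvPolynomial (Fin N) R) :
    map φ (scaleVars q I f) = scaleVars (φ q) I (map φ f) := by
  ext m
  simp only [coeff_map, coeff_scaleVars, map_mul, map_pow]

theorem map_alternant {S : Type*} [CommRing S] (φ : R →+* S) (f : MvPolynomial (Fin N) R) :
    map φ (alternant f) = alternant (map φ f) := by
  simp only [alternant_apply, map_sum, map_mul, map_intCast, map_rename]

theorem map_vandermondePoly {S : Type*} [CommRing S] (φ : R →+* S) :
    map φ (vandermondePoly R N) = vandermondePoly S N := by
  rw [vandermondePoly, map_alternant, map_monomial, map_one]; rfl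

/-- The operator `weightedOp` (for `k = 0`) times the Vandermonde polynomial, as an operator on
symmetric polynomials over an arbitrary ring. -/
def altOp (q u : R) (a : ℕ) (f : MvPolynomial (Fin N) R) : MvPolynomial (Fin N) R :=
  ∑ J ∈ Finset.powersetCard a (Finset.univ : Finset (Fin N)),
    u ^ inversions J • alternant (monomial (staircase N) 1 * scaleVars q J f)

theorem map_altOp {S : Type*} [CommRing S] (φ : R →+* S) (q u : R) (a : ℕ)
    (f : MvPolynomial (Fin N) R) :
    map φ (altOp q u a f) = altOp (φ q) (φ u) a (map φ f) := by
  simp only [altOp, map_sum, smul_eq_C_mul, map_mul, map_alternant, map_scaleVars, map_C,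
    map_pow, map_monomial, map_one]

end AlternatingSums

/-! ### The operators as sums of alternants -/

section Bridge

open MvPolynomial

variable {F : Type*} [Field F] {N : ℕ}

theorem prod_var_sub_ne_zero (I : Finset (Fin N)) :
    ∏ i ∈ I, ∏ j ∈ Iᶜ, (var F i - var F j) ≠ 0 :=
  Finset.prod_ne_zero_iff.2 fun _ hi => Finset.prod_ne_zero_iff.2 fun _ hj =>
    sub_ne_zero.2 fun h => Finset.mem_compl.1 hj (var_injective h ▸ hi)

theorem toRat_vandermondePoly :
    toRat (vandermondePoly F N) = ∏ i : Fin N, ∏ j ∈ Finset.Ioi i, (var F i - var F j) := by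
  rw [vandermondePoly_eq_prod]
  simp only [toRat, var, map_prod, map_sub]

theorem opCoeff_mul_vandermonde (u : F) (k : ℤ) (I : Finset (Fin N)) :
    opCoeff u k I * toRat (vandermondePoly F N) =
      (∏ i ∈ I, var F i) ^ k * ∑ w : Equiv.Perm (Fin N), ((Equiv.Perm.sign w : ℤ) : RatFun F N) *
        (algebraMap F (RatFun F N) u ^ inversions (I.map w⁻¹.toEmbedding) *
          toRat (rename w (monomial (staircase N) 1))) := by
  have h := prod_mul_vandermonde_expand (var F) (algebraMap F (RatFun F N) u) I
  have hne := prod_var_sub_ne_zero (F := F) I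
  have hw : ∀ w : Equiv.Perm (Fin N), toRat (rename w (monomial (staircase N) (1 : F))) =
      ∏ i, var F (w i) ^ (i.rev : ℕ) := by
    intro w
    rw [rename_monomial_staircase]
    simp only [toRat, var, map_prod, map_pow]
  simp only [hw]
  rw [toRat_vandermondePoly, opCoeff, mul_assoc]
  congr 1
  simp only [pairWeight, Finset.prod_div_distrib]
  rw [div_mul_eq_mul_div, h, mul_div_cancel_left₀ _ hne]

/-- Reindex by `J = w⁻¹ I`. Since `f` is symmetric, the shift by `I` is the `w`-translate of the
shift by `J`, so each permutation acts on a whole monomial times shifted function. -/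
theorem vandermonde_mul_weightedOp (q : Fˣ) (u : F) (a : ℕ) (k : ℤ) {f : MvPolynomial (Fin N) F}
    (hf : f.IsSymmetric) :
    toRat (vandermondePoly F N) * weightedOp N q u a k (toRat f) =
      ∑ J ∈ Finset.powersetCard a (Finset.univ : Finset (Fin N)),
        algebraMap F (RatFun F N) u ^ inversions J * ∑ w : Equiv.Perm (Fin N),
          ((Equiv.Perm.sign w : ℤ) : RatFun F N) * ((∏ i ∈ J, var F (w i)) ^ k *
            toRat (rename w (monomial (staircase N) 1 * scaleVars (q : F) J f))) := by
  rw [weightedOp_apply, Finset.mul_sum]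
  have hterm : ∀ I, toRat (vandermondePoly F N) * (opCoeff u k I * qShift q I (toRat f)) =
      ∑ w : Equiv.Perm (Fin N), (fun (J : Finset (Fin N)) =>
        algebraMap F (RatFun F N) u ^ inversions J * (
          ((Equiv.Perm.sign w : ℤ) : RatFun F N) * ((∏ i ∈ J, var F (w i)) ^ k *
            toRat (rename w (monomial (staircase N) 1 * scaleVars (q : F) J f)))))
          (I.map w⁻¹.toEmbedding) := by
    intro I
    rw [← mul_assoc, mul_comm (toRat _), opCoeff_mul_vandermonde, Finset.mul_sum, Finset.sum_mul]
    refine Finset.sum_congr rfl fun w _ => ?_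
    have hI : (I.map w⁻¹.toEmbedding).map w.toEmbedding = I := by
      rw [Finset.map_map]; convert Finset.map_refl; ext; simp
    have h1 : rename w (scaleVars (q : F) (I.map w⁻¹.toEmbedding) f) = polyShiftHom q I f := by
      rw [rename_scaleVars, hI, hf w]; rfl
    have h2 : ∏ i ∈ I.map w⁻¹.toEmbedding, var F (w i) = ∏ i ∈ I, var F i := by
      rw [Finset.prod_map]; simp
    simp only []
    rw [h2, map_mul, h1, qShift_toRat, toRat, toRat, toRat, map_mul]
    ring
  simp only [hterm, Finset.mul_sum]
  rw [Finset.sum_comm, Finset.sum_comm (s := Finset.powersetCard a _)]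
  refine Finset.sum_congr rfl fun w _ => ?_
  refine Finset.sum_bij' (fun I _ => I.map w⁻¹.toEmbedding) (fun J _ => J.map w.toEmbedding)
    ?_ ?_ ?_ ?_ ?_
  · intro I hI; simpa [Finset.mem_powersetCard] using hI
  · intro I hI; simpa [Finset.mem_powersetCard] using hI
  · intro I _; rw [Finset.map_map]; convert Finset.map_refl; ext; simp
  · intro I _; rw [Finset.map_map]; convert Finset.map_refl; ext; simp
  · intro I _; rfl

theorem toRat_alternant (g : MvPolynomial (Fin N) F) :
    toRat (alternant g) = ∑ w : Equiv.Perm (Fin N),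
      ((Equiv.Perm.sign w : ℤ) : RatFun F N) * toRat (rename w g) := by
  simp only [toRat, alternant_apply, map_sum, map_mul, map_intCast]

theorem vandermonde_mul_weightedOp_zero (q : Fˣ) (u : F) (a : ℕ) {f : MvPolynomial (Fin N) F}
    (hf : f.IsSymmetric) :
    toRat (vandermondePoly F N) * weightedOp N q u a 0 (toRat f) =
      toRat (altOp (q : F) u a f) := by
  rw [vandermonde_mul_weightedOp q u a 0 hf, altOp, toRat, map_sum]
  refine Finset.sum_congr rfl fun J _ => ?_
  rw [smul_eq_C_mul, map_mul, ← toRat, ← toRat, toRat_alternant, ← algebraMap_eq_toRat, map_pow]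
  simp only [zpow_zero, one_mul]

/-- At `u = 0` only the subset without inversions contributes. The hypothesis on `θ` says `θ = δ +
(k₁ - k₂) ω_a` without negative exponents. -/
theorem vandermonde_mul_opM (q : Fˣ) {a : ℕ} (ha : a ≤ N) {k₁ k₂ : ℕ} {θ : Fin N →₀ ℕ}
    (hθ : (∏ i ∈ initialSegment N a, X i) ^ k₁ * monomial (staircase N) (1 : F) =
      (∏ i ∈ initialSegment N a, X i) ^ k₂ * monomial θ 1) {f : MvPolynomial (Fin N) F}
    (hf : f.IsSymmetric) :
    toRat (vandermondePoly F N) * opM N q a ((k₁ : ℤ) - k₂) (toRat f) =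
      toRat (alternant (monomial θ 1 * scaleVars (q : F) (initialSegment N a) f)) := by
  rw [opM_eq_weightedOp, vandermonde_mul_weightedOp q 0 a _ hf,
    Finset.sum_eq_single_of_mem (initialSegment N a), inversions_initialSegment, pow_zero, one_mul,
    toRat_alternant]
  · refine Finset.sum_congr rfl fun w _ => ?_
    congr 1
    have hx : ∏ i ∈ initialSegment N a, var F (w i) ≠ 0 :=
      Finset.prod_ne_zero_iff.2 fun i _ => var_ne_zero _
    have h := congrArg (fun p => toRat (rename w p)) hθ
    simp only [toRat, map_mul, map_pow, map_prod, rename_X] at h ⊢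
    rw [← mul_assoc, zpow_sub₀ hx, zpow_natCast, zpow_natCast]
    congr 1
    rw [div_mul_eq_mul_div, div_eq_iff (pow_ne_zero _ hx), mul_comm _ (_ ^ k₂)]
    exact h
  · rw [Finset.mem_powersetCard]
    exact ⟨Finset.subset_univ _, card_initialSegment ha⟩
  · intro J hJ hne
    have hc := (Finset.mem_powersetCard.1 hJ).2
    rw [map_zero, zero_pow, zero_mul]
    intro h
    exact hne (hc ▸ eq_initialSegment_of_inversions_eq_zero h)

end Bridge

/-! ### Divisibility of alternants by the Vandermonde polynomial -/

section Divisibility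

open MvPolynomial

variable {F : Type*} [Field F] {N : ℕ}

theorem X_sub_X_dvd_sub_aeval (i j : Fin N) (f : MvPolynomial (Fin N) F) :
    (X i - X j) ∣ f - aeval (fun l => if l = j then X i else X l) f := by
  rw [← Ideal.mem_span_singleton, ← Ideal.Quotient.mk_eq_mk_iff_sub_mem]
  have : (Ideal.Quotient.mkₐ F (Ideal.span {(X i - X j : MvPolynomial (Fin N) F)})) =
      (Ideal.Quotient.mkₐ F _).comp (aeval fun l => if l = j then X i else X l) := by
    ext1 l
    simp only [AlgHom.comp_apply, aeval_X]
    split_ifs with h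
    · subst h
      rw [Ideal.Quotient.mkₐ_eq_mk, Ideal.Quotient.mk_eq_mk_iff_sub_mem,
        Ideal.mem_span_singleton, ← neg_sub, neg_dvd]
    · rfl
  exact DFunLike.congr_fun this f

/-- The substitution `x_j = x_i` is unaffected by a preceding swap of the two variables, whereas an
alternant changes sign; its value is then its own negative. -/
theorem X_sub_X_dvd_alternant [CharZero F] {i j : Fin N} (hij : i ≠ j)
    (g : MvPolynomial (Fin N) F) : (X i - X j) ∣ alternant g := by
  set φ : MvPolynomial (Fin N) F →ₐ[F] MvPolynomial (Fin N) F :=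
    aeval (fun l => if l = j then X i else X l) with hφ
  have hswap : φ.comp (rename (Equiv.swap i j)) = φ := by
    ext1 l
    simp only [hφ, AlgHom.comp_apply, rename_X, aeval_X]
    rcases eq_or_ne l i with rfl | hi
    · simp [hij]
    · rcases eq_or_ne l j with rfl | hj
      · simp
      · rw [Equiv.swap_apply_of_ne_of_ne hi hj]
  have h0 : φ (alternant g) = 0 := by
    have h := DFunLike.congr_fun hswap (alternant g)
    rw [AlgHom.comp_apply, rename_alternant, Equiv.Perm.sign_swap hij] at h
    simp only [Units.val_neg, Units.val_one, Int.cast_neg, Int.cast_one, neg_mul, one_mul,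
      map_neg] at h
    exact self_eq_neg.1 h.symm
  have := X_sub_X_dvd_sub_aeval i j (alternant g)
  rwa [← hφ, h0, sub_zero] at this

theorem irreducible_X_sub_X {i j : Fin N} (hij : i ≠ j) :
    Irreducible (X i - X j : MvPolynomial (Fin N) F) := by
  apply irreducible_of_totalDegree_eq_one
  · apply le_antisymm
    · exact (totalDegree_sub _ _).trans (by simp)
    · have : Finsupp.single i 1 ∈ (X i - X j : MvPolynomial (Fin N) F).support := by
        rw [mem_support_iff, coeff_sub, coeff_X, coeff_X, if_pos rfl, if_neg]
        · simp
        · rw [Finsupp.single_left_inj one_ne_zero]; exact hij.symm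
      simpa using le_totalDegree this
  · intro x hx
    have h := hx (Finsupp.single i 1)
    rw [coeff_sub, coeff_X, coeff_X, if_pos rfl, if_neg] at h
    · rw [sub_zero] at h; exact isUnit_of_dvd_one h
    · rw [Finsupp.single_left_inj one_ne_zero]; exact hij.symm

theorem vandermondePoly_dvd_alternant [CharZero F] (g : MvPolynomial (Fin N) F) :
    vandermondePoly F N ∣ alternant g := by
  rw [vandermondePoly_eq_prod, Finset.prod_sigma']
  apply Finset.prod_dvd_of_isRelPrime
  · rintro ⟨i, j⟩ h ⟨k, l⟩ h' hne
    simp only [Finset.coe_sigma, Finset.coe_univ, Finset.coe_Ioi, Set.mem_sigma_iff, Set.mem_univ,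
      Set.mem_Ioi, true_and] at h h'
    rw [Function.onFun, (irreducible_X_sub_X h.ne).isRelPrime_iff_not_dvd]
    rintro ⟨p, hp⟩
    -- Setting `x_j = x_i` kills the divisor, so `x_k - x_l` must vanish too; with `i < j` and `k <
    -- l` the two pairs coincide.
    have h2 := congrArg (aeval (fun m => if m = j then X i else X m :
      Fin N → MvPolynomial (Fin N) F)) hp
    simp only [map_sub, map_mul, aeval_X, if_true, if_neg h.ne, sub_self, zero_mul,
      sub_eq_zero] at h2
    apply hne
    split_ifs at h2 with h3 h4 h4
    · exact absurd (h3.trans h4.symm) h'.ne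
    · have := X_injective h2; subst h3; subst this; exact absurd h' h.not_gt
    · have := X_injective h2; subst h4; subst this; rfl
    · exact absurd (X_injective h2) h'.ne
  · rintro ⟨i, j⟩ h
    simp only [Finset.mem_sigma, Finset.mem_univ, Finset.mem_Ioi, true_and] at h
    exact X_sub_X_dvd_alternant h.ne g

theorem exists_symmetric_quotient [CharZero F] (g : MvPolynomial (Fin N) F) :
    ∃ h : MvPolynomial (Fin N) F, h.IsSymmetric ∧ vandermondePoly F N * h = alternant g := by
  obtain ⟨h, hh⟩ := vandermondePoly_dvd_alternant g
  refine ⟨h, fun w => ?_, hh.symm⟩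
  have h1 := congrArg (rename w) hh
  rw [map_mul, rename_alternant, vandermondePoly, rename_alternant, hh, mul_assoc,
    ← vandermondePoly] at h1
  have hs : ((Equiv.Perm.sign w : ℤ) : MvPolynomial (Fin N) F) ≠ 0 := by simp
  exact (mul_left_cancel₀ vandermondePoly_ne_zero (mul_left_cancel₀ hs h1)).symm

end Divisibility

/-! ### Linear weights and rearrangement -/

section Weights

variable {N : ℕ}

/-- The weight `∑ v_i m_i` of an exponent. -/
def weight (v : Fin N → ℤ) (m : Fin N →₀ ℕ) : ℤ := ∑ i, v i * (m i : ℤ)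

theorem weight_add (v : Fin N → ℤ) (m n : Fin N →₀ ℕ) :
    weight v (m + n) = weight v m + weight v n := by
  simp only [weight, Finsupp.add_apply, Nat.cast_add, mul_add, Finset.sum_add_distrib]

theorem weight_equivMapDomain (v : Fin N → ℤ) (m : Fin N →₀ ℕ) (w : Equiv.Perm (Fin N)) :
    weight v (m.equivMapDomain w) = ∑ i, v i * (m (w.symm i) : ℤ) := rfl

theorem monovary_of_antitone {v : Fin N → ℤ} {m : Fin N →₀ ℕ} (hv : Antitone v)
    (hm : Antitone m) : Monovary v (fun i => (m i : ℤ)) := by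
  intro i j hij
  have h : j ≤ i := by
    by_contra h
    exact (Nat.cast_lt.1 hij).not_ge (hm (not_le.1 h).le)
  exact hv h

theorem weight_equivMapDomain_le {v : Fin N → ℤ} {m : Fin N →₀ ℕ} (hv : Antitone v)
    (hm : Antitone m) (w : Equiv.Perm (Fin N)) :
    weight v (m.equivMapDomain w) ≤ weight v m :=
  (monovary_of_antitone hv hm).sum_mul_comp_perm_le_sum_mul (σ := w.symm)

theorem antitone_of_weight_le {v : Fin N → ℤ} {m : Fin N →₀ ℕ} (hv : StrictAnti v)
    (h : ∀ w : Equiv.Perm (Fin N), weight v (m.equivMapDomain w) ≤ weight v m) : Antitone m := by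
  intro i j hij
  rcases hij.eq_or_lt with rfl | hij
  · exact le_rfl
  by_contra hlt
  rw [not_le] at hlt
  have hw := h (Equiv.swap i j)
  have key : weight v (m.equivMapDomain (Equiv.swap i j)) - weight v m =
      (v i - v j) * ((m j : ℤ) - m i) := by
    rw [weight_equivMapDomain, weight, ← Finset.sum_sub_distrib,
      Fintype.sum_eq_add i j hij.ne]
    · simp; ring
    · intro k hk
      rw [Equiv.symm_swap, Equiv.swap_apply_of_ne_of_ne hk.1 hk.2, sub_self]
  have h1 := hv hij
  have h2 : (m i : ℤ) < m j := by exact_mod_cast hlt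
  nlinarith

/-- Equality case of the rearrangement inequality: a rearrangement of maximal weight is again
decreasing, and the decreasing arrangement of the entries is unique. -/
theorem equivMapDomain_eq_of_weight_eq {v : Fin N → ℤ} {m : Fin N →₀ ℕ} (hv : StrictAnti v)
    (hm : Antitone m) {w : Equiv.Perm (Fin N)}
    (h : weight v m ≤ weight v (m.equivMapDomain w)) : m.equivMapDomain w = m := by
  have hanti : Antitone (m.equivMapDomain w) := by
    apply antitone_of_weight_le hv
    intro w'
    have : (m.equivMapDomain w).equivMapDomain w' = m.equivMapDomain (w.trans w') :=
      (Finsupp.equivMapDomain_trans _ _ _).symm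
    rw [this]
    exact (weight_equivMapDomain_le hv.antitone hm _).trans h
  have hmono : Monotone (m ∘ Fin.rev) := fun i j hij => hm (Fin.rev_le_rev.2 hij)
  have h1 := Tuple.unique_monotone (f := m) (σ := Fin.revPerm) (τ := Fin.revPerm.trans w.symm)
    hmono (fun i j hij => hanti (Fin.rev_le_rev.2 hij))
  ext i
  have := congrFun h1 i.rev
  simp only [Function.comp_apply, Fin.revPerm_apply, Fin.rev_rev, Equiv.trans_apply] at this
  exact this.symm

end Weights

/-! ### Leading coefficients of alternants and triangularity -/

section LeadingTerms

open MvPolynomial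

variable {R : Type*} [CommRing R] {N : ℕ}

theorem coeff_rename_perm (w : Equiv.Perm (Fin N)) (f : MvPolynomial (Fin N) R)
    (m : Fin N →₀ ℕ) : coeff m (rename w f) = coeff (m.equivMapDomain w.symm) f := by
  have h := coeff_rename_mapDomain w w.injective f (m.equivMapDomain w.symm)
  rw [← Finsupp.equivMapDomain_eq_mapDomain, ← Finsupp.equivMapDomain_trans] at h
  simpa using h

theorem coeff_equivMapDomain_of_symmetric {f : MvPolynomial (Fin N) R} (hf : f.IsSymmetric)
    (w : Equiv.Perm (Fin N)) (m : Fin N →₀ ℕ) : coeff (m.equivMapDomain w) f = coeff m f := by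
  have := coeff_rename_perm w.symm f m
  rwa [hf, Equiv.symm_symm, eq_comm] at this

theorem coeff_alternant (f : MvPolynomial (Fin N) R) (m : Fin N →₀ ℕ) :
    coeff m (alternant f) = ∑ w : Equiv.Perm (Fin N),
      ((Equiv.Perm.sign w : ℤ) : R) * coeff (m.equivMapDomain w.symm) f := by
  rw [alternant_apply, coeff_sum]
  refine Finset.sum_congr rfl fun w _ => ?_
  rw [← map_intCast (C : R →+* MvPolynomial (Fin N) R), coeff_C_mul, coeff_rename_perm]

theorem exists_of_coeff_alternant_ne_zero {θ m : Fin N →₀ ℕ} {g : MvPolynomial (Fin N) R}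
    (h : coeff m (alternant (monomial θ 1 * g)) ≠ 0) :
    ∃ w : Equiv.Perm (Fin N), ∃ ν, coeff ν g ≠ 0 ∧
      m = ν.equivMapDomain w + θ.equivMapDomain w := by
  rw [coeff_alternant] at h
  obtain ⟨w, -, hw⟩ := Finset.exists_ne_zero_of_sum_ne_zero h
  have h1 := right_ne_zero_of_mul hw
  rw [coeff_monomial_mul'] at h1
  split_ifs at h1 with hle
  · rw [one_mul] at h1
    refine ⟨w, _, h1, ?_⟩
    ext i
    have := hle (w.symm i)
    simp only [Finsupp.add_apply, Finsupp.equivMapDomain_apply, Finsupp.coe_tsub, Pi.sub_apply,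
      Equiv.symm_symm, Equiv.apply_symm_apply] at this ⊢
    omega
  · exact absurd rfl h1

/-- The leading coefficient of an alternant, for a strictly decreasing weight `v`. -/
theorem coeff_add_alternant {v : Fin N → ℤ} (hv : StrictAnti v) {θ μ : Fin N →₀ ℕ}
    (hθ : Antitone θ) {g : MvPolynomial (Fin N) R}
    (hg : ∀ ν, coeff ν g ≠ 0 → ∀ w : Equiv.Perm (Fin N),
      weight v (ν.equivMapDomain w) ≤ weight v μ) :
    coeff (μ + θ) (alternant (monomial θ 1 * g)) =
      ∑ w : Equiv.Perm (Fin N) with θ.equivMapDomain w = θ,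
        ((Equiv.Perm.sign w : ℤ) : R) * coeff (μ.equivMapDomain w.symm) g := by
  rw [coeff_alternant, Finset.sum_filter]
  refine Finset.sum_congr rfl fun w _ => ?_
  split_ifs with hw
  · congr 1
    have : (μ + θ).equivMapDomain w.symm = θ + μ.equivMapDomain w.symm := by
      ext i
      have := DFunLike.congr_fun hw (w i)
      simp only [Finsupp.equivMapDomain_apply, Equiv.symm_apply_apply] at this
      simp [← this, add_comm]
    rw [this, coeff_monomial_mul, one_mul]
  · rw [coeff_monomial_mul']
    split_ifs with hle
    · rw [one_mul]
      -- A contributing `w` has `ν`-part of weight at most that of `μ`, so it cannot lower the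
      -- weight of `θ`; by the equality case it fixes `θ`.
      by_contra hne
      apply hw
      apply equivMapDomain_eq_of_weight_eq hv hθ
      have hν := hg _ (right_ne_zero_of_mul hne) w
      have hsum : ((μ + θ).equivMapDomain w.symm - θ).equivMapDomain w + θ.equivMapDomain w =
          μ + θ := by
        ext i
        have := hle (w.symm i)
        simp only [Finsupp.add_apply, Finsupp.equivMapDomain_apply, Finsupp.coe_tsub,
          Pi.sub_apply, Equiv.symm_symm, Equiv.apply_symm_apply] at this ⊢
        omega
      have h2 := congrArg (weight v) hsum
      rw [weight_add, weight_add] at h2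
      linarith
    · rw [mul_zero]

theorem coeff_add_alternant_of_strictAnti {v : Fin N → ℤ} (hv : StrictAnti v) {θ μ : Fin N →₀ ℕ}
    (hθ : StrictAnti θ) {g : MvPolynomial (Fin N) R}
    (hg : ∀ ν, coeff ν g ≠ 0 → ∀ w : Equiv.Perm (Fin N),
      weight v (ν.equivMapDomain w) ≤ weight v μ) :
    coeff (μ + θ) (alternant (monomial θ 1 * g)) = coeff μ g := by
  rw [coeff_add_alternant hv hθ.antitone hg, Finset.sum_eq_single 1]
  · have : μ.equivMapDomain (Equiv.symm 1) = μ := by ext i; rfl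
    rw [this]; simp
  · intro w hw hne
    exfalso
    apply hne
    ext i
    have h := DFunLike.congr_fun (Finset.mem_filter.1 hw).2 (w i)
    rw [Finsupp.equivMapDomain_apply, Equiv.symm_apply_apply] at h
    rw [← hθ.injective h]; rfl
  · intro h
    exact absurd (Finset.mem_filter.2 ⟨Finset.mem_univ _, by ext i; rfl⟩) h

theorem staircase_strictAnti : StrictAnti (staircase N) := fun i j h => by
  simp only [staircase_apply]
  exact Fin.lt_def.1 (Fin.rev_lt_rev.2 h)

/-- All monomials of a symmetric polynomial are bounded by `μ` for the weight `v`. -/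
theorem weight_equivMapDomain_le_of_symmetric {v : Fin N → ℤ} {μ : Fin N →₀ ℕ}
    {f : MvPolynomial (Fin N) R} (hf : f.IsSymmetric)
    (hμ : ∀ ν, coeff ν f ≠ 0 → weight v ν ≤ weight v μ) (ν : Fin N →₀ ℕ) (h : coeff ν f ≠ 0)
    (w : Equiv.Perm (Fin N)) : weight v (ν.equivMapDomain w) ≤ weight v μ :=
  hμ _ (by rwa [coeff_equivMapDomain_of_symmetric hf])

theorem vandermondePoly_mul (R : Type*) [CommRing R] {N : ℕ} {f : MvPolynomial (Fin N) R}
    (hf : f.IsSymmetric) :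
    vandermondePoly R N * f = alternant (monomial (staircase N) 1 * f) :=
  (alternant_mul_symmetric _ hf).symm

theorem coeff_add_vandermondePoly_mul {v : Fin N → ℤ} (hv : StrictAnti v) {μ : Fin N →₀ ℕ}
    {f : MvPolynomial (Fin N) R} (hf : f.IsSymmetric)
    (hμ : ∀ ν, coeff ν f ≠ 0 → weight v ν ≤ weight v μ) :
    coeff (μ + staircase N) (vandermondePoly R N * f) = coeff μ f := by
  rw [vandermondePoly_mul R hf]
  exact coeff_add_alternant_of_strictAnti hv staircase_strictAnti
    (weight_equivMapDomain_le_of_symmetric hf hμ)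

/-- The eigenvalue of `altOp q u a` on a function with leading exponent `μ`. -/
def leadEigenvalue (q u : R) (a : ℕ) (μ : Fin N →₀ ℕ) : R :=
  ∑ J ∈ Finset.powersetCard a (Finset.univ : Finset (Fin N)),
    u ^ inversions J * q ^ ∑ i ∈ J, μ i

theorem coeff_add_altOp {v : Fin N → ℤ} (hv : StrictAnti v) (q u : R) (a : ℕ) {μ : Fin N →₀ ℕ}
    {f : MvPolynomial (Fin N) R} (hf : f.IsSymmetric)
    (hμ : ∀ ν, coeff ν f ≠ 0 → weight v ν ≤ weight v μ) :
    coeff (μ + staircase N) (altOp q u a f) = leadEigenvalue q u a μ * coeff μ f := by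
  rw [altOp, coeff_sum, leadEigenvalue, Finset.sum_mul]
  refine Finset.sum_congr rfl fun J _ => ?_
  rw [coeff_smul, coeff_add_alternant_of_strictAnti hv staircase_strictAnti, coeff_scaleVars,
    smul_eq_mul, mul_assoc]
  intro ν hν
  rw [coeff_scaleVars] at hν
  exact weight_equivMapDomain_le_of_symmetric hf hμ ν (right_ne_zero_of_mul hν)

theorem exists_maximal_weight (v : Fin N → ℤ) {f : MvPolynomial (Fin N) R} (hf : f ≠ 0) :
    ∃ μ, coeff μ f ≠ 0 ∧ ∀ ν, coeff ν f ≠ 0 → weight v ν ≤ weight v μ := by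
  obtain ⟨μ, hμ, h⟩ := Finset.exists_max_image f.support (weight v) (support_nonempty.2 hf)
  exact ⟨μ, mem_support_iff.1 hμ, fun ν hν => h ν (mem_support_iff.2 hν)⟩

/-- The leading exponent of a nonzero common eigenfunction is dominant and determines the
eigenvalues. -/
theorem leadEigenvalue_eq_of_eigen [IsDomain R] {v : Fin N → ℤ} (hv : StrictAnti v)
    {μ : Fin N →₀ ℕ} {f : MvPolynomial (Fin N) R} (hf : f.IsSymmetric) (hμf : coeff μ f ≠ 0)
    (hμ : ∀ ν, coeff ν f ≠ 0 → weight v ν ≤ weight v μ) {q u E : R} {a : ℕ}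
    (h : altOp q u a f = E • (vandermondePoly R N * f)) : leadEigenvalue q u a μ = E := by
  have h1 := congrArg (coeff (μ + staircase N)) h
  rw [coeff_add_altOp hv q u a hf hμ, coeff_smul, coeff_add_vandermondePoly_mul hv hf hμ,
    smul_eq_mul] at h1
  exact mul_right_cancel₀ hμf h1

/-- By symmetry all rearrangements of the exponent occur too, so none has larger weight. -/
theorem antitone_of_maximal {v : Fin N → ℤ} (hv : StrictAnti v)
    {μ : Fin N →₀ ℕ} {f : MvPolynomial (Fin N) R} (hf : f.IsSymmetric) (hμf : coeff μ f ≠ 0)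
    (hμ : ∀ ν, coeff ν f ≠ 0 → weight v ν ≤ weight v μ) : Antitone μ :=
  antitone_of_weight_le hv fun w => weight_equivMapDomain_le_of_symmetric hf hμ μ hμf w

/-- Weight bounds survive division by the Vandermonde polynomial, because the leading monomial of
`h` remains visible in the product. This needs a strictly decreasing weight, so `p` is perturbed to
one. -/
theorem weight_le_of_vandermondePoly_mul {p : Fin N → ℤ} (hp : Antitone p) {c : ℤ}
    {h : MvPolynomial (Fin N) R} (hs : h.IsSymmetric)
    (hc : ∀ m, coeff m (vandermondePoly R N * h) ≠ 0 → weight p m ≤ c + weight p (staircase N))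
    (m : Fin N →₀ ℕ) (hm : coeff m h ≠ 0) : weight p m ≤ c := by
  have hh : h ≠ 0 := by rintro rfl; simp at hm
  set l : Fin N → ℤ := fun i => (i.rev : ℕ) with hl
  have hl0 : ∀ n, 0 ≤ weight l n := fun n => Finset.sum_nonneg fun i _ => by positivity
  -- `B` exceeds the `l`-weight of every monomial of `h`, so `B p + l` compares by `p` first and
  -- uses `l` only to break ties.
  set B : ℤ := 1 + ∑ n ∈ h.support, weight l n with hB
  have hB0 : 0 < B := by
    have : 0 ≤ ∑ n ∈ h.support, weight l n := Finset.sum_nonneg fun n _ => hl0 n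
    linarith
  set v : Fin N → ℤ := fun i => B * p i + l i with hvdef
  have hv : StrictAnti v := by
    intro i j hij
    have h1 : l j < l i := by
      simp only [hl]; exact_mod_cast Fin.lt_def.1 (Fin.rev_lt_rev.2 hij)
    have h2 := mul_le_mul_of_nonneg_left (hp hij.le) hB0.le
    simp only [hvdef]
    linarith
  have hwv : ∀ n, weight v n = B * weight p n + weight l n := by
    intro n
    simp only [weight, hvdef, Finset.mul_sum, ← Finset.sum_add_distrib]
    exact Finset.sum_congr rfl fun i _ => by ring
  obtain ⟨μ, hμ, hmax⟩ := exists_maximal_weight v hh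
  have h1 : weight p μ ≤ c := by
    have := hc (μ + staircase N) (by rwa [coeff_add_vandermondePoly_mul hv hs hmax])
    rw [weight_add] at this
    linarith
  by_contra hlt
  rw [not_le] at hlt
  have h2 := hmax m hm
  rw [hwv, hwv] at h2
  have h3 : weight l μ < B := by
    have := Finset.single_le_sum (f := weight l) (fun n _ => hl0 n) (mem_support_iff.2 hμ)
    linarith
  have h4 : weight p μ + 1 ≤ weight p m := by omega
  have h5 := mul_le_mul_of_nonneg_left h4 hB0.le
  have h6 := hl0 m
  linarith

theorem weight_le_of_alternant {p : Fin N → ℤ} (hp : Antitone p) {c : ℤ} {θ : Fin N →₀ ℕ}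
    (hθ : Antitone θ) {g : MvPolynomial (Fin N) R}
    (hg : ∀ ν, coeff ν g ≠ 0 → ∀ w : Equiv.Perm (Fin N), weight p (ν.equivMapDomain w) ≤ c)
    (m : Fin N →₀ ℕ) (hm : coeff m (alternant (monomial θ 1 * g)) ≠ 0) :
    weight p m ≤ c + weight p θ := by
  obtain ⟨w, ν, hν, rfl⟩ := exists_of_coeff_alternant_ne_zero hm
  rw [weight_add]
  exact add_le_add (hg ν hν w) (weight_equivMapDomain_le hp hθ w)

theorem weight_le_of_altOp {p : Fin N → ℤ} (hp : Antitone p) {c : ℤ} (q u : R) (a : ℕ)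
    {f : MvPolynomial (Fin N) R} (hf : f.IsSymmetric)
    (hc : ∀ ν, coeff ν f ≠ 0 → weight p ν ≤ c)
    (m : Fin N →₀ ℕ) (hm : coeff m (altOp q u a f) ≠ 0) :
    weight p m ≤ c + weight p (staircase N) := by
  rw [altOp, coeff_sum] at hm
  obtain ⟨J, -, hJ⟩ := Finset.exists_ne_zero_of_sum_ne_zero hm
  rw [coeff_smul, smul_eq_mul] at hJ
  refine weight_le_of_alternant hp staircase_strictAnti.antitone ?_ m (right_ne_zero_of_mul hJ)
  intro ν hν w
  rw [coeff_scaleVars] at hν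
  exact hc _ (by
    rw [coeff_equivMapDomain_of_symmetric hf]; exact right_ne_zero_of_mul hν)

end LeadingTerms

/-! ### Joint eigenfunctions -/

section Existence

open MvPolynomial

variable {F : Type*} [Field F] {N : ℕ}

/-- The strictly decreasing weight `(N - 1, …, 0)`. -/
def revWeight (N : ℕ) : Fin N → ℤ := fun i => ((i.rev : ℕ) : ℤ)

theorem revWeight_strictAnti : StrictAnti (revWeight N) := fun i j h => by
  simp only [revWeight]
  exact_mod_cast Fin.lt_def.1 (Fin.rev_lt_rev.2 h)

/-- The symmetric polynomials all of whose monomials are dominated by `x^μ`, dominance being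
tested against all decreasing weights. -/
def dominatedSubmodule (F : Type*) [Field F] {N : ℕ} (μ : Fin N →₀ ℕ) :
    Submodule F (MvPolynomial (Fin N) F) where
  carrier := {f | f.IsSymmetric ∧ ∀ m, coeff m f ≠ 0 → ∀ p : Fin N → ℤ, Antitone p →
    weight p m ≤ weight p μ}
  add_mem' := by
    rintro f g ⟨hf, hf'⟩ ⟨hg, hg'⟩
    refine ⟨hf.add hg, fun m hm p hp => ?_⟩
    rw [coeff_add] at hm
    by_cases h : coeff m f = 0
    · exact hg' m (fun h' => hm (by rw [h, h', add_zero])) p hp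
    · exact hf' m h p hp
  zero_mem' := ⟨IsSymmetric.zero, fun m hm => absurd (coeff_zero m) hm⟩
  smul_mem' := by
    rintro c f ⟨hf, hf'⟩
    refine ⟨hf.smul c, fun m hm p hp => hf' m (fun h => hm ?_) p hp⟩
    rw [coeff_smul, h, smul_zero]

theorem dominatedSubmodule_finite (μ : Fin N →₀ ℕ) :
    Module.Finite F (dominatedSubmodule F μ) := by
  have hle : dominatedSubmodule F μ ≤ restrictTotalDegree (Fin N) F (∑ i, μ i) := by
    rintro f ⟨-, hf⟩
    rw [mem_restrictTotalDegree]
    refine Finset.sup_le fun m hm => ?_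
    have h := hf m (mem_support_iff.1 hm) (fun _ => 1) (fun _ _ _ => le_rfl)
    simp only [weight, one_mul] at h
    rw [Finsupp.sum_fintype _ _ (by simp)]
    exact_mod_cast h
  exact Submodule.finiteDimensional_of_le hle

theorem exists_mem_dominatedSubmodule [CharZero F] {μ : Fin N →₀ ℕ} (hμ : Antitone μ) :
    ∃ f ∈ dominatedSubmodule F μ, coeff μ f ≠ 0 := by
  have hcoeff : ∀ m, coeff m (∑ w : Equiv.Perm (Fin N), rename w (monomial μ (1 : F))) =
      ((Finset.univ.filter fun w : Equiv.Perm (Fin N) => μ.equivMapDomain w = m).card : F) := by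
    intro m
    rw [coeff_sum, Finset.card_filter, Nat.cast_sum]
    refine Finset.sum_congr rfl fun w _ => ?_
    rw [rename_monomial, coeff_monomial, ← Finsupp.equivMapDomain_eq_mapDomain]
    push_cast; rfl
  refine ⟨∑ w : Equiv.Perm (Fin N), rename w (monomial μ 1), ⟨?_, ?_⟩, ?_⟩
  · intro v
    rw [map_sum]
    refine Fintype.sum_equiv (Equiv.mulLeft v) _ _ fun w => ?_
    rw [rename_rename]; rfl
  · intro m hm p hp
    rw [hcoeff, Nat.cast_ne_zero, ← Nat.pos_iff_ne_zero, Finset.card_pos] at hm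
    obtain ⟨w, hw⟩ := hm
    rw [← (Finset.mem_filter.1 hw).2]
    exact weight_equivMapDomain_le hp hμ w
  · rw [hcoeff, Nat.cast_ne_zero, ← Nat.pos_iff_ne_zero, Finset.card_pos]
    exact ⟨1, Finset.mem_filter.2 ⟨Finset.mem_univ _, by ext i; rfl⟩⟩

/-- `altOp` as a linear map. -/
def altOpLinear (q u : F) (a : ℕ) : MvPolynomial (Fin N) F →ₗ[F] MvPolynomial (Fin N) F :=
  ∑ J ∈ Finset.powersetCard a (Finset.univ : Finset (Fin N)),
    u ^ inversions J • (alternant ∘ₗ LinearMap.mulLeft F (monomial (staircase N) 1) ∘ₗ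
      (scaleVars q J).toLinearMap)

theorem altOpLinear_apply (q u : F) (a : ℕ) (f : MvPolynomial (Fin N) F) :
    altOpLinear q u a f = altOp q u a f := by
  simp [altOpLinear, altOp]

theorem exists_symmetric_quotient_altOp [CharZero F] (q u : F) (a : ℕ)
    (f : MvPolynomial (Fin N) F) :
    ∃ h : MvPolynomial (Fin N) F, h.IsSymmetric ∧ vandermondePoly F N * h = altOp q u a f := by
  obtain ⟨h, hs, hh⟩ := exists_symmetric_quotient
    (∑ J ∈ Finset.powersetCard a (Finset.univ : Finset (Fin N)),
      u ^ inversions J • (monomial (staircase N) 1 * scaleVars q J f))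
  refine ⟨h, hs, ?_⟩
  rw [hh, map_sum, altOp]
  simp only [map_smul]

/-- The operator minus its leading eigenvalue, multiplied by the Vandermonde polynomial `Δ`, maps
the finite-dimensional `W` into `Δ · W₀`, where `W₀ ⊂ W` consists of the elements without `x^μ`. As
`W₀ ≠ W`, the dimension drops and the kernel is nonzero. -/
theorem exists_eigenvector [CharZero F] (q u : F) (a : ℕ) {μ : Fin N →₀ ℕ} (hμ : Antitone μ) :
    ∃ f ∈ dominatedSubmodule F μ, f ≠ 0 ∧
      altOp q u a f = leadEigenvalue q u a μ • (vandermondePoly F N * f) := by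
  set W := dominatedSubmodule F μ
  set E := leadEigenvalue q u a μ
  set W₀ : Submodule F (MvPolynomial (Fin N) F) := W ⊓ LinearMap.ker (lcoeff F μ) with hW₀
  have hfin : Module.Finite F W := dominatedSubmodule_finite μ
  have hlt : W₀ < W := by
    refine lt_of_le_of_ne inf_le_left fun h => ?_
    obtain ⟨f, hf, hf0⟩ := exists_mem_dominatedSubmodule (F := F) hμ
    have hf' : f ∈ W₀ := h ▸ hf
    exact hf0 hf'.2
  set V := W₀.map (LinearMap.mulLeft F (vandermondePoly F N)) with hV
  have hfin₀ : Module.Finite F W₀ := Submodule.finiteDimensional_of_le hlt.le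
  set A : MvPolynomial (Fin N) F →ₗ[F] MvPolynomial (Fin N) F :=
    altOpLinear q u a - E • LinearMap.mulLeft F (vandermondePoly F N) with hA
  have hAapp : ∀ f, A f = altOp q u a f - E • (vandermondePoly F N * f) := by
    intro f; simp [hA, altOpLinear_apply]
  have hmap : ∀ f ∈ W, A f ∈ V := by
    intro f hf
    obtain ⟨h, hs, hh⟩ := exists_symmetric_quotient_altOp q u a f
    have hbound : ∀ p : Fin N → ℤ, Antitone p → ∀ m, coeff m h ≠ 0 → weight p m ≤ weight p μ := by
      intro p hp
      refine weight_le_of_vandermondePoly_mul hp hs fun m hm => ?_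
      rw [hh] at hm
      exact weight_le_of_altOp hp q u a hf.1 (fun ν hν => hf.2 ν hν p hp) m hm
    have hhW : h - E • f ∈ W := W.sub_mem ⟨hs, fun m hm p hp => hbound p hp m hm⟩ (W.smul_mem E hf)
    have hval : vandermondePoly F N * (h - E • f) = A f := by
      rw [hAapp, mul_sub, hh, mul_smul_comm]
    refine ⟨h - E • f, ⟨hhW, ?_⟩, hval⟩
    have hv := revWeight_strictAnti (N := N)
    show coeff μ (h - E • f) = 0
    rw [← coeff_add_vandermondePoly_mul hv hhW.1 (fun ν hν => hhW.2 ν hν _ hv.antitone), hval,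
      hAapp, coeff_sub, coeff_add_altOp hv q u a hf.1 (fun ν hν => hf.2 ν hν _ hv.antitone),
      coeff_smul,
      coeff_add_vandermondePoly_mul hv hf.1 (fun ν hν => hf.2 ν hν _ hv.antitone), smul_eq_mul,
      sub_self]
  have hrank : Module.finrank F V < Module.finrank F W :=
    (Submodule.finrank_map_le _ _).trans_lt (Submodule.finrank_lt_finrank_of_lt hlt)
  have hker := LinearMap.ker_ne_bot_of_finrank_lt (f := A.restrict hmap) hrank
  obtain ⟨⟨f, hf⟩, hfk, hf0⟩ := Submodule.exists_mem_ne_zero_of_ne_bot hker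
  refine ⟨f, hf, fun h => hf0 (Subtype.ext h), ?_⟩
  have := congrArg Subtype.val (LinearMap.mem_ker.1 hfk)
  rw [LinearMap.coe_restrict_apply, hAapp] at this
  exact sub_eq_zero.1 this

theorem toRat_smul (c : F) (f : MvPolynomial (Fin N) F) : toRat (c • f) = c • toRat f := by
  rw [smul_eq_C_mul, toRat, map_mul, ← toRat, ← toRat, ← algebraMap_eq_toRat, Algebra.smul_def]

theorem toRat_vandermondePoly_ne_zero : toRat (vandermondePoly F N) ≠ 0 := fun h =>
  vandermondePoly_ne_zero (toRat_injective (h.trans (map_zero _).symm))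

theorem vandermonde_mul_eq_altOp_iff (q : Fˣ) (u : F) (a : ℕ) {g h : MvPolynomial (Fin N) F}
    (hg : g.IsSymmetric) : vandermondePoly F N * h = altOp (q : F) u a g ↔
      weightedOp N q u a 0 (toRat g) = toRat h := by
  constructor
  · intro H
    apply mul_left_cancel₀ toRat_vandermondePoly_ne_zero
    rw [vandermonde_mul_weightedOp_zero q u a hg, ← H, toRat, map_mul]
  · intro H
    apply toRat_injective
    rw [← vandermonde_mul_weightedOp_zero q u a hg, H, toRat, map_mul]

theorem altOp_eq_smul_iff (q : Fˣ) (u : F) (a : ℕ) (E : F) {g : MvPolynomial (Fin N) F}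
    (hg : g.IsSymmetric) : altOp (q : F) u a g = E • (vandermondePoly F N * g) ↔
      weightedOp N q u a 0 (toRat g) = E • toRat g := by
  rw [← toRat_smul, ← vandermonde_mul_eq_altOp_iff q u a hg, mul_smul_comm, eq_comm]

/-- A joint eigenfunction, monic at `μ`, of all the operators `altOp q u a`, obtained from an
eigenfunction of the first one. -/
theorem exists_joint_eigenvector [CharZero F] {q : Fˣ} {u : F} (hq : (q : F) ≠ 1) (hu : u ≠ 1)
    (huq : u * q ≠ 1) {μ : Fin N →₀ ℕ} (hμ : Antitone μ)
    (hsep : ∀ ν : Fin N →₀ ℕ,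
      leadEigenvalue (q : F) u 1 ν = leadEigenvalue (q : F) u 1 μ → ν = μ) :
    ∃ f ∈ dominatedSubmodule F μ, coeff μ f = 1 ∧
      ∀ a, altOp (q : F) u a f = leadEigenvalue (q : F) u a μ • (vandermondePoly F N * f) := by
  have hv := revWeight_strictAnti (N := N)
  -- Because the first eigenvalue separates exponents, a nonzero eigenfunction with this eigenvalue
  -- must have leading exponent `μ`.
  have hlead : ∀ g : MvPolynomial (Fin N) F, g.IsSymmetric → g ≠ 0 →
      altOp (q : F) u 1 g = leadEigenvalue (q : F) u 1 μ • (vandermondePoly F N * g) →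
      coeff μ g ≠ 0 ∧ ∀ ν, coeff ν g ≠ 0 → weight (revWeight N) ν ≤ weight (revWeight N) μ := by
    intro g hg hg0 h
    obtain ⟨ν, hν, hmax⟩ := exists_maximal_weight (revWeight N) hg0
    have := hsep ν (leadEigenvalue_eq_of_eigen hv hg hν hmax h)
    subst this
    exact ⟨hν, hmax⟩
  obtain ⟨f₀, hf₀, hne, heig₀⟩ := exists_eigenvector (q : F) u 1 hμ
  obtain ⟨hc, -⟩ := hlead f₀ hf₀.1 hne heig₀
  obtain ⟨f, hf, hfc, heig⟩ : ∃ f ∈ dominatedSubmodule F μ, coeff μ f = 1 ∧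
      altOp (q : F) u 1 f = leadEigenvalue (q : F) u 1 μ • (vandermondePoly F N * f) := by
    refine ⟨(coeff μ f₀)⁻¹ • f₀, Submodule.smul_mem _ _ hf₀, ?_, ?_⟩
    · rw [coeff_smul, smul_eq_mul, inv_mul_cancel₀ hc]
    · rw [← altOpLinear_apply, map_smul, altOpLinear_apply, heig₀, mul_smul_comm, smul_comm]
  refine ⟨f, hf, hfc, fun a => ?_⟩
  obtain ⟨h, hs, hh⟩ := exists_symmetric_quotient_altOp (q : F) u a f
  set E₁ := leadEigenvalue (q : F) u 1 μ
  set E := leadEigenvalue (q : F) u a μ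
  have h1 : weightedOp N q u 1 0 (toRat f) = E₁ • toRat f := (altOp_eq_smul_iff q u 1 E₁ hf.1).1 heig
  have h2 : weightedOp N q u a 0 (toRat f) = toRat h :=
    (vandermonde_mul_eq_altOp_iff q u a hf.1).1 hh
  -- By commutation, `h - E • f` belongs to the same eigenspace of the first operator; its
  -- coefficient at `μ` is zero, so it vanishes.
  have hsym : (h - E • f).IsSymmetric := hs.sub (hf.1.smul E)
  have h4 : altOp (q : F) u 1 (h - E • f) = E₁ • (vandermondePoly F N * (h - E • f)) := by
    have hsub : toRat (h - E • f) = toRat h - E • toRat f := by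
      rw [← toRat_smul, toRat, map_sub]
    rw [altOp_eq_smul_iff q u 1 E₁ hsym, hsub, ← h2, map_sub, ← weightedOp_comm_one hq hu huq,
      map_smul, h1, map_smul, smul_sub, smul_comm E]
  have h5 : h - E • f = 0 := by
    by_contra hne'
    obtain ⟨hc', hmax⟩ := hlead _ hsym hne' h4
    apply hc'
    rw [← coeff_add_vandermondePoly_mul hv hsym hmax, mul_sub, hh, coeff_sub,
      coeff_add_altOp hv _ u a hf.1 (fun ν hν => hf.2 ν hν _ hv.antitone), mul_smul_comm, coeff_smul,
      coeff_add_vandermondePoly_mul hv hf.1 (fun ν hν => hf.2 ν hν _ hv.antitone), smul_eq_mul,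
      sub_self]
  rw [← hh, sub_eq_zero.1 h5, mul_smul_comm]

end Existence

/-! ### The local ring of `K(t)` at infinity -/

section Infinity

open WithZero

variable {K : Type*} [Field K]

open Classical in
/-- The valuation of `K(t)` at `t = ∞`. -/
def valInfty (K : Type*) [Field K] : Valuation (RatFunc K) (WithZero (Multiplicative ℤ)) :=
  RatFunc.inftyValuation K

theorem valInfty_of_ne_zero {c : RatFunc K} (hc : c ≠ 0) : valInfty K c = exp c.intDegree := by
  classical
  rw [valInfty, RatFunc.inftyValuation_apply, RatFunc.inftyValuation_of_nonzero _ hc]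

theorem valInfty_polynomial {p : Polynomial K} (hp : p ≠ 0) :
    valInfty K (algebraMap (Polynomial K) (RatFunc K) p) = exp (p.natDegree : ℤ) := by
  rw [valInfty_of_ne_zero (by simpa using hp), RatFunc.intDegree_polynomial]

theorem valInfty_C {l : K} (hl : l ≠ 0) : valInfty K (RatFunc.C l) = 1 := by
  rw [valInfty_of_ne_zero (by simpa using hl), RatFunc.intDegree_C, exp_zero]

theorem valInfty_C_le (l : K) : valInfty K (RatFunc.C l) ≤ 1 := by
  by_cases hl : l = 0
  · simp [hl]
  · exact (valInfty_C hl).le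

theorem valInfty_lt_one_iff (c : RatFunc K) :
    valInfty K c < 1 ↔ c.num.degree < c.denom.degree := by
  by_cases hc : c = 0
  · simp [hc]
  · have hn : c.num ≠ 0 := RatFunc.num_ne_zero hc
    rw [valInfty_of_ne_zero hc, ← exp_zero, exp_lt_exp, RatFunc.intDegree,
      Polynomial.degree_eq_natDegree hn, Polynomial.degree_eq_natDegree c.denom_ne_zero,
      Nat.cast_lt]
    omega

theorem limInfty_iff (c : RatFunc K) (l : K) :
    LimInfty c l ↔ valInfty K (c - RatFunc.C l) < 1 := (valInfty_lt_one_iff _).symm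

theorem LimInfty.unique {c : RatFunc K} {l m : K} (hl : LimInfty c l) (hm : LimInfty c m) :
    l = m := by
  rw [limInfty_iff] at hl hm
  by_contra hne
  have h1 : valInfty K (RatFunc.C (m - l)) < 1 := by
    have := (valInfty K).map_sub_lt hl hm
    rwa [sub_sub_sub_cancel_left, ← map_sub] at this
  rw [valInfty_C (sub_ne_zero.2 (Ne.symm hne))] at h1
  exact lt_irrefl _ h1

theorem exists_limInfty {c : RatFunc K} (hc : valInfty K c ≤ 1) : ∃ l, LimInfty c l := by
  -- The denominator is monic, so this is the ratio of leading coefficients when the degrees agree,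
  -- and `0` when the numerator has smaller degree.
  refine ⟨c.num.coeff c.denom.natDegree, ?_⟩
  rw [limInfty_iff]
  set l := c.num.coeff c.denom.natDegree
  have hd0 := c.denom_ne_zero
  have hda : algebraMap (Polynomial K) (RatFunc K) c.denom ≠ 0 := by simpa using hd0
  have hdeg : c.num.natDegree ≤ c.denom.natDegree := by
    by_cases h0 : c = 0
    · simp [h0]
    · rw [valInfty_of_ne_zero h0, ← exp_zero, exp_le_exp, RatFunc.intDegree] at hc
      omega
  have hsplit : c - RatFunc.C l =
      algebraMap (Polynomial K) (RatFunc K) (c.num - Polynomial.C l * c.denom) /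
        algebraMap (Polynomial K) (RatFunc K) c.denom := by
    rw [map_sub, map_mul, RatFunc.algebraMap_C, sub_div, mul_div_cancel_right₀ _ hda,
      RatFunc.num_div_denom]
  by_cases hp : c.num - Polynomial.C l * c.denom = 0
  · rw [hsplit, hp]; simp
  · rw [hsplit, map_div₀, valInfty_polynomial hp, valInfty_polynomial hd0, ← exp_sub, ← exp_zero,
      exp_lt_exp, sub_neg, Nat.cast_lt]
    rw [Polynomial.natDegree_lt_iff_degree_lt hp, ← Polynomial.degree_eq_natDegree hd0,
      Polynomial.degree_eq_natDegree hd0, Polynomial.degree_lt_iff_coeff_zero]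
    intro m hm
    rw [Polynomial.coeff_sub, Polynomial.coeff_C_mul]
    have hm' : c.denom.natDegree ≤ m := by exact_mod_cast hm
    rcases hm'.eq_or_lt with h | hm
    · rw [← h]
      have : c.denom.coeff c.denom.natDegree = 1 := c.monic_denom
      rw [this, mul_one, sub_self]
    · rw [Polynomial.coeff_eq_zero_of_natDegree_lt (hdeg.trans_lt hm),
        Polynomial.coeff_eq_zero_of_natDegree_lt hm, mul_zero, sub_zero]

/-- The local ring of `K(t)` at `t = ∞`. -/
abbrev regularAtInfty (K : Type*) [Field K] : Subring (RatFunc K) := (valInfty K).integer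

theorem mem_regularAtInfty {c : RatFunc K} : c ∈ regularAtInfty K ↔ valInfty K c ≤ 1 := Iff.rfl

/-- The value at `t = ∞` of a regular function. -/
def evalInfty (K : Type*) [Field K] : regularAtInfty K →+* K where
  toFun c := (exists_limInfty c.2).choose
  map_one' := by
    refine (exists_limInfty (1 : regularAtInfty K).2).choose_spec.unique ?_
    rw [limInfty_iff]; simp
  map_zero' := by
    refine (exists_limInfty (0 : regularAtInfty K).2).choose_spec.unique ?_
    rw [limInfty_iff]; simp
  map_add' c d := by
    refine (exists_limInfty (c + d).2).choose_spec.unique ?_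
    have hc := (limInfty_iff _ _).1 (exists_limInfty c.2).choose_spec
    have hd := (limInfty_iff _ _).1 (exists_limInfty d.2).choose_spec
    rw [limInfty_iff, Subring.coe_add, map_add, add_sub_add_comm]
    exact (valInfty K).map_add_lt hc hd
  map_mul' c d := by
    refine (exists_limInfty (c * d).2).choose_spec.unique ?_
    have hc := (limInfty_iff _ _).1 (exists_limInfty c.2).choose_spec
    have hd := (limInfty_iff _ _).1 (exists_limInfty d.2).choose_spec
    set l := (exists_limInfty c.2).choose
    set m := (exists_limInfty d.2).choose
    have hsplit : ((c * d : regularAtInfty K) : RatFunc K) - RatFunc.C (l * m) =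
        (c : RatFunc K) * (d - RatFunc.C m) + (c - RatFunc.C l) * RatFunc.C m := by
      rw [Subring.coe_mul, map_mul]; ring
    rw [limInfty_iff, hsplit]
    refine (valInfty K).map_add_lt ?_ ?_
    · rw [map_mul]
      exact mul_lt_one_of_nonneg_of_lt_one_right c.2 zero_le hd
    · rw [map_mul]
      exact mul_lt_one_of_nonneg_of_lt_one_left zero_le hc (valInfty_C_le m)

theorem limInfty_evalInfty (c : regularAtInfty K) : LimInfty (c : RatFunc K) (evalInfty K c) :=
  (exists_limInfty c.2).choose_spec

theorem evalInfty_eq {c : regularAtInfty K} {l : K} (h : LimInfty (c : RatFunc K) l) :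
    evalInfty K c = l := (limInfty_evalInfty c).unique h

theorem evalInfty_eq_zero_iff {c : regularAtInfty K} :
    evalInfty K c = 0 ↔ valInfty K (c : RatFunc K) < 1 := by
  constructor
  · intro h
    have := limInfty_evalInfty c
    rwa [h, limInfty_iff, map_zero, sub_zero] at this
  · intro h
    apply evalInfty_eq
    rwa [limInfty_iff, map_zero, sub_zero]

end Infinity

/-! ### Eigenvalues and their separation -/

section Eigenvalues

variable {N : ℕ}

theorem map_leadEigenvalue {R S : Type*} [CommRing R] [CommRing S] (φ : R →+* S) (q u : R) (a : ℕ)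
    (μ : Fin N →₀ ℕ) : φ (leadEigenvalue q u a μ) = leadEigenvalue (φ q) (φ u) a μ := by
  simp only [leadEigenvalue, map_sum, map_mul, map_pow]

theorem leadEigenvalue_zero {R : Type*} [CommRing R] (q : R) {a : ℕ} (ha : a ≤ N)
    (μ : Fin N →₀ ℕ) : leadEigenvalue q 0 a μ = q ^ ∑ i ∈ initialSegment N a, μ i := by
  rw [leadEigenvalue, Finset.sum_eq_single_of_mem (initialSegment N a),
    inversions_initialSegment, pow_zero, one_mul]
  · exact Finset.mem_powersetCard.2 ⟨Finset.subset_univ _, card_initialSegment ha⟩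
  · intro J hJ hne
    rw [zero_pow, zero_mul]
    intro h
    exact hne ((Finset.mem_powersetCard.1 hJ).2 ▸ eq_initialSegment_of_inversions_eq_zero h)

theorem inversions_singleton (i : Fin N) : inversions {i} = i := by
  have h := sum_rev_add_inversions {i}
  rw [Finset.sum_singleton, Finset.card_singleton, Fin.val_rev] at h
  have h2 : Nat.choose 1 2 = 0 := rfl
  have := i.isLt
  omega

theorem leadEigenvalue_one {R : Type*} [CommRing R] (q u : R) (μ : Fin N →₀ ℕ) :
    leadEigenvalue q u 1 μ = ∑ i : Fin N, u ^ (i : ℕ) * q ^ μ i := by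
  rw [leadEigenvalue, Finset.powersetCard_one, Finset.sum_map]
  refine Finset.sum_congr rfl fun i _ => ?_
  simp [inversions_singleton]

theorem sum_initialSegment_succ {M : Type*} [AddCommMonoid M] (f : Fin N → M) (i : Fin N) :
    ∑ j ∈ initialSegment N (i + 1), f j = f i + ∑ j ∈ initialSegment N i, f j := by
  have : initialSegment N (i + 1) = insert i (initialSegment N i) := by
    ext j
    simp only [mem_initialSegment, Finset.mem_insert, Fin.ext_iff]
    omega
  rw [this, Finset.sum_insert (by simp [mem_initialSegment])]

variable {K : Type*} [Field K] {q : Kˣ}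

theorem zpow_injective_of_not_root (hq : ∀ n : ℕ, 0 < n → q ^ n ≠ 1) :
    Function.Injective fun n : ℤ => (q : K) ^ n := by
  have h1 : Function.Injective fun n : ℤ => q ^ n := by
    rw [injective_zpow_iff_not_isOfFinOrder, isOfFinOrder_iff_pow_eq_one]
    rintro ⟨n, hn, h⟩
    exact hq n hn h
  intro m n h
  apply h1
  ext
  simpa using h

theorem eq_of_initial_zpow_eq (hq : ∀ n : ℕ, 0 < n → q ^ n ≠ 1) {μ : Fin N →₀ ℕ}
    {lam : Fin N → ℤ} (h : ∀ a, 1 ≤ a → a ≤ N →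
      (q : K) ^ (∑ i ∈ initialSegment N a, μ i) = (q : K) ^ (∑ i ∈ initialSegment N a, lam i))
    (i : Fin N) : (μ i : ℤ) = lam i := by
  have key : ∀ a, a ≤ N →
      ∑ i ∈ initialSegment N a, (μ i : ℤ) = ∑ i ∈ initialSegment N a, lam i := by
    intro a ha
    rcases Nat.eq_zero_or_pos a with rfl | ha0
    · simp [initialSegment]
    · apply zpow_injective_of_not_root hq
      have := h a ha0 ha
      simp only []
      rw [← this, ← Nat.cast_sum, zpow_natCast]
  have h1 := key (i + 1) i.isLt
  have h2 := key i i.isLt.le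
  rw [sum_initialSegment_succ, sum_initialSegment_succ, h2] at h1
  exact add_right_cancel h1

theorem constQ_val (q : Kˣ) : ((constQ q : (RatFunc K)ˣ) : RatFunc K) = RatFunc.C (q : K) := rfl

/-- The eigenvalue is `∑_i t^{-i} q^{μ_i}` with `i` from `0`. Comparing powers of the indeterminate
`t` recovers every `q^{μ_i}`, hence `μ_i`. No ordering of the entries is needed. -/
theorem leadEigenvalue_one_injective (hq : ∀ n : ℕ, 0 < n → q ^ n ≠ 1) {μ ν : Fin N →₀ ℕ}
    (h : leadEigenvalue ((constQ q : (RatFunc K)ˣ) : RatFunc K) RatFunc.X⁻¹ 1 ν =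
      leadEigenvalue ((constQ q : (RatFunc K)ˣ) : RatFunc K) RatFunc.X⁻¹ 1 μ) : ν = μ := by
  have hX : (RatFunc.X : RatFunc K) ≠ 0 := RatFunc.X_ne_zero
  have hpoly : ∀ κ : Fin N →₀ ℕ, RatFunc.X ^ N *
      leadEigenvalue ((constQ q : (RatFunc K)ˣ) : RatFunc K) RatFunc.X⁻¹ 1 κ =
      algebraMap (Polynomial K) (RatFunc K)
        (∑ i : Fin N, Polynomial.monomial (N - i) ((q : K) ^ κ i)) := by
    intro κ
    rw [leadEigenvalue_one, Finset.mul_sum, map_sum]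
    refine Finset.sum_congr rfl fun i _ => ?_
    rw [← Polynomial.C_mul_X_pow_eq_monomial]
    simp only [map_mul, map_pow, RatFunc.algebraMap_C, RatFunc.algebraMap_X, constQ_val]
    rw [inv_pow, pow_sub₀ _ hX i.isLt.le]
    ring
  have h1 := congrArg (fun z => RatFunc.X ^ N * z) h
  simp only [hpoly] at h1
  have h2 := RatFunc.algebraMap_injective K h1
  have hcoeff : ∀ (κ : Fin N →₀ ℕ) (i : Fin N),
      (∑ j : Fin N, Polynomial.monomial (N - j) ((q : K) ^ κ j)).coeff (N - i) = (q : K) ^ κ i := by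
    intro κ i
    rw [Polynomial.finsetSum_coeff, Finset.sum_eq_single i]
    · simp
    · intro j _ hj
      rw [Polynomial.coeff_monomial, if_neg]
      intro h
      apply hj
      ext
      have := i.isLt
      have := j.isLt
      omega
    · simp
  ext i
  have h3 := congrArg (fun p => Polynomial.coeff p (N - i)) h2
  simp only [hcoeff] at h3
  have h4 := zpow_injective_of_not_root hq (a₁ := (ν i : ℤ)) (a₂ := (μ i : ℤ))
    (by simpa only [zpow_natCast] using h3)
  exact_mod_cast h4

theorem coe_expo {lam : Fin N → ℤ} (h : IsPartition lam) (i : Fin N) :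
    ((expo lam i : ℕ) : ℤ) = lam i := Int.toNat_of_nonneg (h.2 i)

theorem expo_antitone {lam : Fin N → ℤ} (h : IsPartition lam) : Antitone (expo lam) :=
  fun _ _ hij => Int.toNat_le_toNat (h.1 hij)

/-- The powers of `t` match by the pair count `∑_{i ∈ J} (N - 1 - i) + inv(J) = a(a-1)/2 + a(N-a)`.
-/
theorem eigenvalueD_eq {F : Type*} [Field F] (q : Fˣ) {t : F} (ht : t ≠ 0) (a : ℕ)
    {lam : Fin N → ℤ} (h : IsPartition lam) :
    eigenvalueD q t a lam = t ^ (a * (N - a)) * leadEigenvalue (q : F) t⁻¹ a (expo lam) := by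
  rw [eigenvalueD, leadEigenvalue, Finset.mul_sum, Finset.mul_sum]
  refine Finset.sum_congr rfl fun J hJ => ?_
  have hc := (Finset.mem_powersetCard.1 hJ).2
  have h1 := sum_rev_add_inversions J
  rw [hc, Nat.choose_two_right] at h1
  have hq : ∏ i ∈ J, (q : F) ^ lam i = (q : F) ^ ∑ i ∈ J, expo lam i := by
    rw [← Finset.prod_pow_eq_pow_sum]
    refine Finset.prod_congr rfl fun i _ => ?_
    rw [← coe_expo h, zpow_natCast]
  have ht' : ∏ i ∈ J, t ^ (N - 1 - i.val) = t ^ ∑ i ∈ J, (i.rev : ℕ) := by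
    rw [← Finset.prod_pow_eq_pow_sum]
    refine Finset.prod_congr rfl fun i _ => ?_
    rw [Fin.val_rev]; congr 1; omega
  rw [Finset.prod_mul_distrib, hq, ht', inv_pow]
  have hp1 := pow_ne_zero (a * (a - 1) / 2) ht
  have hp2 := pow_ne_zero (inversions J) ht
  have h2 : t ^ (∑ i ∈ J, (i.rev : ℕ)) * t ^ inversions J =
      t ^ (a * (a - 1) / 2) * t ^ (a * (N - a)) := by
    rw [← pow_add, ← pow_add, h1]
  field_simp
  linear_combination h2

theorem opD_eigen_iff {F : Type*} [Field F] (q : Fˣ) {t : F} (ht : t ≠ 0) (a : ℕ)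
    {lam : Fin N → ℤ} (h : IsPartition lam) {P : MvPolynomial (Fin N) F} (hP : P.IsSymmetric) :
    opD N q t a (toRat P) = eigenvalueD q t a lam • toRat P ↔
      altOp (q : F) t⁻¹ a P =
        leadEigenvalue (q : F) t⁻¹ a (expo lam) • (vandermondePoly F N * P) := by
  rw [opD_eq_weightedOp q ht, eigenvalueD_eq q ht a h, mul_smul, LinearMap.smul_apply,
    altOp_eq_smul_iff q _ a _ hP]
  constructor
  · intro H; exact smul_right_injective _ (pow_ne_zero _ ht) H
  · intro H; rw [H]

theorem coe_ne_one (hq : ∀ n : ℕ, 0 < n → q ^ n ≠ 1) : (q : K) ≠ 1 := by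
  intro h
  apply hq 1 one_pos
  ext
  simpa using h

theorem constQ_ne_one (hq : ∀ n : ℕ, 0 < n → q ^ n ≠ 1) :
    ((constQ q : (RatFunc K)ˣ) : RatFunc K) ≠ 1 := by
  rw [constQ_val, ← map_one RatFunc.C]
  exact fun h => coe_ne_one hq (RatFunc.C_injective h)

theorem X_ne_C (c : K) : (RatFunc.X : RatFunc K) ≠ RatFunc.C c := by
  intro h
  have := congrArg RatFunc.intDegree h
  rw [RatFunc.intDegree_X, RatFunc.intDegree_C] at this
  exact one_ne_zero this

end Eigenvalues

/-! ### Macdonald polynomials and their limit -/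

section Macdonald

open MvPolynomial

variable {K : Type*} [Field K] {q : Kˣ} {N : ℕ}

/-- The `D_1`-eigenvalue forces a nonzero difference to have leading exponent `λ`, where the
coefficients `1` cancel. -/
theorem isMacdonald_unique (hq : ∀ n : ℕ, 0 < n → q ^ n ≠ 1) {lam : Fin N → ℤ}
    {P Q : MvPolynomial (Fin N) (RatFunc K)} (hP : IsMacdonald (constQ q) RatFunc.X lam P)
    (hQ : IsMacdonald (constQ q) RatFunc.X lam Q) : P = Q := by
  -- Without variables there is no operator `D_1` to use, but also only one exponent.
  by_cases hN : N = 0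
  · subst hN
    ext m
    have hm : m = expo lam := Subsingleton.elim _ _
    rw [hm, hP.monic, hQ.monic]
  by_contra hne
  have hsub : (P - Q).IsSymmetric := hP.symmetric.sub hQ.symmetric
  obtain ⟨ν, hν, hmax⟩ := exists_maximal_weight (revWeight N) (sub_ne_zero.2 hne)
  have hX := RatFunc.X_ne_zero (K := K)
  have hlam := hP.partition
  have h1 := hP.eigen 1 le_rfl (by omega)
  have h2 := hQ.eigen 1 le_rfl (by omega)
  have h3 : altOp ((constQ q : (RatFunc K)ˣ) : RatFunc K) RatFunc.X⁻¹ 1 (P - Q) =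
      leadEigenvalue ((constQ q : (RatFunc K)ˣ) : RatFunc K) RatFunc.X⁻¹ 1 (expo lam) •
        (vandermondePoly (RatFunc K) N * (P - Q)) := by
    rw [← opD_eigen_iff (constQ q) hX 1 hlam hsub, toRat, map_sub, map_sub, h1, h2, smul_sub]
  have h4 := leadEigenvalue_one_injective hq
    (leadEigenvalue_eq_of_eigen revWeight_strictAnti hsub hν hmax h3)
  apply hν
  rw [h4, coeff_sub, hP.monic, hQ.monic, sub_self]

/-- The constant weights `±1` give equality of the sums, and the indicators of initial segments give
the partial sums. -/
theorem dominated_of_weight_le {lam mu : Fin N → ℤ} (hlam : IsPartition lam) (hmu : IsPartition mu)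
    (h : ∀ p : Fin N → ℤ, Antitone p → weight p (expo mu) ≤ weight p (expo lam)) :
    Dominated mu lam := by
  simp only [weight, coe_expo hlam, coe_expo hmu] at h
  constructor
  · apply le_antisymm
    · simpa using h (fun _ => 1) (fun _ _ _ => le_rfl)
    · simpa using h (fun _ => -1) (fun _ _ _ => le_rfl)
  · intro k
    have := h (fun i => if i.val < k then 1 else 0) (fun i j hij => by
      have := Fin.le_def.1 hij
      simp only []
      split_ifs <;> omega)
    simpa [Finset.sum_filter] using this

variable [CharZero K]

instance : CharZero (RatFunc K) :=
  charZero_of_injective_algebraMap (algebraMap K (RatFunc K)).injective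

theorem exists_isMacdonald (hq : ∀ n : ℕ, 0 < n → q ^ n ≠ 1) {lam : Fin N → ℤ}
    (hlam : IsPartition lam) : ∃ P, IsMacdonald (constQ q) (RatFunc.X : RatFunc K) lam P := by
  have hX := RatFunc.X_ne_zero (K := K)
  obtain ⟨P, hP, hc, heig⟩ := exists_joint_eigenvector (q := constQ q)
    (u := (RatFunc.X : RatFunc K)⁻¹) (constQ_ne_one hq)
    (fun h => X_ne_C (1 : K) (by rw [map_one]; exact inv_eq_one.1 h))
    (fun h => X_ne_C (q : K) (by
      rw [← constQ_val, ← mul_one RatFunc.X, ← h, mul_inv_cancel_left₀ hX]))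
    (expo_antitone hlam) (fun ν h => leadEigenvalue_one_injective hq h)
  refine ⟨P, hlam, hP.1, hc, fun mu hmu hne => ?_, fun a _ _ => ?_⟩
  · exact dominated_of_weight_le hlam hmu (hP.2 _ hne)
  · exact (opD_eigen_iff (constQ q) hX a hlam hP.1).2 (heig a)

theorem isMacdonald_macdonaldP (hq : ∀ n : ℕ, 0 < n → q ^ n ≠ 1) {lam : Fin N → ℤ}
    (hlam : IsPartition lam) : IsMacdonald (constQ q) RatFunc.X lam (macdonaldP q lam) := by
  have h := exists_isMacdonald (K := K) hq hlam
  rw [macdonaldP, dif_pos h]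
  exact h.choose_spec

theorem exists_map_of_coeff_mem {A : Type*} [CommRing A] (S : Subring A)
    {P : MvPolynomial (Fin N) A} (h : ∀ m, coeff m P ∈ S) :
    ∃ Q : MvPolynomial (Fin N) S, map S.subtype Q = P := by
  have : P ∈ Set.range (map S.subtype : MvPolynomial (Fin N) S →+* _) := by
    rw [mem_range_map_iff_coeffs_subset]
    intro c hc
    obtain ⟨m, -, rfl⟩ := mem_coeffs_iff.1 hc
    exact ⟨⟨_, h m⟩, rfl⟩
  exact this

theorem exists_limit (hq : ∀ n : ℕ, 0 < n → q ^ n ≠ 1) {lam : Fin N → ℤ}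
    {P : MvPolynomial (Fin N) (RatFunc K)} (hP : IsMacdonald (constQ q) RatFunc.X lam P) :
    ∃ L : MvPolynomial (Fin N) K, PolyLimInfty P L ∧ L.IsSymmetric ∧ coeff (expo lam) L = 1 ∧
      ∀ a, 1 ≤ a → a ≤ N → altOp (q : K) 0 a L =
        (q : K) ^ (∑ i ∈ initialSegment N a, lam i) • (vandermondePoly K N * L) := by
  have hX := RatFunc.X_ne_zero (K := K)
  have hlam := hP.partition
  have hP0 : P ≠ 0 := by
    rintro rfl
    have := hP.monic
    rw [coeff_zero] at this
    exact zero_ne_one this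
  -- Scale by the power of `t` that makes the coefficient with the worst pole a unit. All
  -- coefficients become regular at infinity and the reduction is nonzero.
  obtain ⟨m₀, hm₀, hmax⟩ := Finset.exists_max_image P.support
    (fun m => valInfty K (coeff m P)) (support_nonempty.2 hP0)
  have hm₀' := mem_support_iff.1 hm₀
  set s : RatFunc K := RatFunc.X ^ (-(coeff m₀ P).intDegree) with hs
  have hs0 : s ≠ 0 := zpow_ne_zero _ hX
  have hvX : valInfty K RatFunc.X = WithZero.exp 1 := by
    rw [valInfty_of_ne_zero hX, RatFunc.intDegree_X]
  have hvs : valInfty K (s * coeff m₀ P) = 1 := by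
    rw [map_mul, hs, map_zpow₀, hvX, valInfty_of_ne_zero hm₀', ← WithZero.exp_zsmul,
      ← WithZero.exp_add, ← WithZero.exp_zero]
    simp
  have hmem : ∀ m, coeff m (s • P) ∈ regularAtInfty K := by
    intro m
    rw [mem_regularAtInfty, coeff_smul, smul_eq_mul]
    by_cases hm : coeff m P = 0
    · rw [hm, mul_zero, map_zero]; exact zero_le
    · rw [← hvs, map_mul, map_mul]
      gcongr
      exact hmax m (mem_support_iff.2 hm)
  obtain ⟨Q, hQ⟩ := exists_map_of_coeff_mem (regularAtInfty K) hmem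
  have hsub_inj : Function.Injective (map (regularAtInfty K).subtype :
      MvPolynomial (Fin N) (regularAtInfty K) → _) :=
    map_injective _ Subtype.val_injective
  have hQc : ∀ m, ((coeff m Q : regularAtInfty K) : RatFunc K) = s * coeff m P := by
    intro m
    have := congrArg (coeff m) hQ
    rwa [coeff_map, coeff_smul, smul_eq_mul] at this
  have hQs : Q.IsSymmetric := by
    intro w
    apply hsub_inj
    rw [map_rename, hQ, map_smul, hP.symmetric w]
  set L := map (evalInfty K) Q with hL
  have hLs : L.IsSymmetric := by
    intro w
    rw [hL, ← map_rename, hQs w]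
  have hLc : ∀ m, coeff m L = evalInfty K (coeff m Q) := fun m => by rw [hL, coeff_map]
  -- The parameters `q` and `u = t⁻¹` are regular at infinity with values `q` and `0`, so the
  -- eigenvalue equations can be reduced.
  let qO : regularAtInfty K := ⟨RatFunc.C (q : K), valInfty_C_le _⟩
  let uO : regularAtInfty K := ⟨RatFunc.X⁻¹, by
    rw [mem_regularAtInfty, map_inv₀, hvX, ← WithZero.exp_neg, ← WithZero.exp_zero,
      WithZero.exp_le_exp]
    norm_num⟩
  have hqO : evalInfty K qO = q := evalInfty_eq (by rw [limInfty_iff]; simp [qO])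
  have huO : evalInfty K uO = 0 := by
    rw [evalInfty_eq_zero_iff]
    show valInfty K RatFunc.X⁻¹ < 1
    rw [map_inv₀, hvX, ← WithZero.exp_neg, ← WithZero.exp_zero, WithZero.exp_lt_exp]
    norm_num
  have hQeig : ∀ a, 1 ≤ a → a ≤ N → altOp qO uO a Q =
      leadEigenvalue qO uO a (expo lam) • (vandermondePoly _ N * Q) := by
    intro a ha haN
    apply hsub_inj
    have h := (opD_eigen_iff (constQ q) hX a hlam hP.symmetric).1 (hP.eigen a ha haN)
    rw [map_altOp, hQ, ← altOpLinear_apply, map_smul, altOpLinear_apply, smul_eq_C_mul _ (leadEigenvalue _ _ _ _),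
      map_mul, map_mul, map_C, map_leadEigenvalue, map_vandermondePoly, hQ]
    show s • altOp ((constQ q : (RatFunc K)ˣ) : RatFunc K) RatFunc.X⁻¹ a P = _
    rw [h, ← smul_eq_C_mul, mul_smul_comm, smul_comm]
    rfl
  have hLeig : ∀ a, 1 ≤ a → a ≤ N → altOp (q : K) 0 a L =
      (q : K) ^ (∑ i ∈ initialSegment N a, lam i) • (vandermondePoly K N * L) := by
    intro a ha haN
    have h := congrArg (map (evalInfty K)) (hQeig a ha haN)
    rw [map_altOp, hqO, huO, smul_eq_C_mul, map_mul, map_mul, map_C, map_leadEigenvalue, hqO, huO,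
      map_vandermondePoly, leadEigenvalue_zero _ haN, ← smul_eq_C_mul] at h
    rw [h]
    congr 1
    rw [← zpow_natCast, Nat.cast_sum]
    congr 1
    exact Finset.sum_congr rfl fun i _ => coe_expo hlam i
  have hL0 : L ≠ 0 := by
    intro h
    have h1 := hLc m₀
    rw [h, coeff_zero, eq_comm, evalInfty_eq_zero_iff, hQc, hvs] at h1
    exact lt_irrefl _ h1
  obtain ⟨ν, hν, hνmax⟩ := exists_maximal_weight (revWeight N) hL0
  have hνlam : ν = expo lam := by
    ext i
    have := eq_of_initial_zpow_eq hq (μ := ν) (lam := lam) (fun a ha haN => by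
      rw [← leadEigenvalue_zero _ haN]
      exact leadEigenvalue_eq_of_eigen revWeight_strictAnti hLs hν hνmax (hLeig a ha haN)) i
    rw [← coe_expo hlam] at this
    exact_mod_cast this
  -- The coefficient of `L` at `λ` is the value of `s · 1` at infinity and is nonzero, so `s` has
  -- degree at least `0`; by the choice of `m₀` its degree is at most `0`.
  have hs1 : s = 1 := by
    have h1 := hν
    rw [hLc, Ne, evalInfty_eq_zero_iff, hQc, hνlam, hP.monic, mul_one, not_lt, hs, map_zpow₀,
      hvX, ← WithZero.exp_zsmul, ← WithZero.exp_zero, WithZero.exp_le_exp] at h1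
    have h2 : valInfty K (coeff (expo lam) P) ≤ valInfty K (coeff m₀ P) :=
      hmax (expo lam) (mem_support_iff.2 (by rw [hP.monic]; exact one_ne_zero))
    rw [hP.monic, map_one, valInfty_of_ne_zero hm₀', ← WithZero.exp_zero,
      WithZero.exp_le_exp] at h2
    have h3 : (coeff m₀ P).intDegree = 0 := by
      simp at h1
      omega
    rw [hs, h3, neg_zero, zpow_zero]
  have hlim : PolyLimInfty P L := by
    intro m
    have := limInfty_evalInfty (coeff m Q)
    rwa [hQc, hs1, one_mul, ← hLc] at this
  refine ⟨L, hlim, hLs, ?_, hLeig⟩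
  have h1 := hlim (expo lam)
  rw [hP.monic] at h1
  refine h1.unique ?_
  rw [limInfty_iff]; simp

end Macdonald

open MvPolynomial

/-! ### The exponents `δ ± ω_a` and their stabilizers -/

section Weights

variable {N : ℕ}

theorem sum_initialSegment_eq_sum_ite {M : Type*} [AddCommMonoid M] (f : Fin N → M) (a : ℕ) :
    ∑ i ∈ initialSegment N a, f i = ∑ i : Fin N, if i.val < a then f i else 0 := by
  rw [initialSegment, Finset.sum_filter]

theorem dotProduct_fundWeight (lam : Fin N → ℤ) (a : ℕ) :
    lam ⬝ᵥ fundWeight N a = ∑ i ∈ initialSegment N a, lam i := by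
  rw [sum_initialSegment_eq_sum_ite]
  refine Finset.sum_congr rfl fun i _ => ?_
  simp [fundWeight]

theorem dotProduct_simpleRoot (lam : Fin N → ℤ) {p p' : Fin N} (h : (p' : ℕ) = p + 1) :
    lam ⬝ᵥ simpleRoot N (p + 1) = lam p - lam p' := by
  have : simpleRoot N (p + 1) = Pi.single p 1 - Pi.single p' 1 := by
    ext i
    simp only [simpleRoot, Pi.sub_apply, Pi.single_apply, Fin.ext_iff]
    split_ifs <;> omega
  rw [this, dotProduct_sub, dotProduct_single, dotProduct_single, mul_one, mul_one]

theorem sum_fundWeight {a b : ℕ} (ha : a ≤ N) (hb : b ≤ N) :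
    ∑ i ∈ initialSegment N b, fundWeight N a i = (min a b : ℕ) := by
  have h : (initialSegment N b).filter (fun i : Fin N => i.val < a) =
      initialSegment N (min a b) := by
    ext i
    simp only [Finset.mem_filter, mem_initialSegment]
    omega
  simp only [fundWeight]
  rw [← Finset.sum_filter, h, Finset.sum_const, card_initialSegment (by omega)]
  simp

/-- The exponent of the monomial `x_1 ⋯ x_a`. -/
def fundExpo (N a : ℕ) : Fin N →₀ ℕ := ∑ i ∈ initialSegment N a, Finsupp.single i 1

theorem fundExpo_apply (a : ℕ) (i : Fin N) : fundExpo N a i = if i.val < a then 1 else 0 := by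
  rw [fundExpo, Finsupp.finsetSum_apply, sum_initialSegment_eq_sum_ite, Finset.sum_eq_single i]
  · simp
  · intro j _ hj
    simp [hj]
  · simp

theorem prod_X_initialSegment (F : Type*) [Field F] (a : ℕ) :
    ∏ i ∈ initialSegment N a, (X i : MvPolynomial (Fin N) F) = monomial (fundExpo N a) 1 := by
  rw [fundExpo, monomial_sum_one]
  rfl

/-- The exponent `staircase N - fundExpo N a`. -/
def loweredStaircase (N a : ℕ) : Fin N →₀ ℕ :=
  Finsupp.equivFunOnFinite.symm fun i => (i.rev : ℕ) - if i.val < a then 1 else 0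

theorem loweredStaircase_apply (a : ℕ) (i : Fin N) :
    loweredStaircase N a i = (i.rev : ℕ) - if i.val < a then 1 else 0 := rfl

/-- For `i < a < N` the entry `N - 1 - i` is positive, so the truncated subtraction is exact; this
fails for `a = N`. -/
theorem fundExpo_add_loweredStaircase {a : ℕ} (ha : a < N) :
    fundExpo N a + loweredStaircase N a = staircase N := by
  ext i
  rw [Finsupp.add_apply, fundExpo_apply, loweredStaircase_apply, staircase_apply, Fin.val_rev]
  split_ifs <;> omega

theorem staircase_add_fundExpo_strictAnti (a : ℕ) :
    StrictAnti (staircase N + fundExpo N a : Fin N →₀ ℕ) := by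
  intro i j hij
  have h := Fin.lt_def.1 hij
  have := j.isLt
  simp only [Finsupp.add_apply, staircase_apply, fundExpo_apply, Fin.val_rev]
  split_ifs <;> omega

theorem loweredStaircase_antitone (a : ℕ) : Antitone (loweredStaircase N a) := by
  intro i j hij
  have h := Fin.le_def.1 hij
  have := j.isLt
  rcases h.eq_or_lt with h | h
  · rw [Fin.ext h]
  simp only [loweredStaircase_apply, Fin.val_rev]
  split_ifs <;> omega

theorem stabilizer_loweredStaircase {p p' : Fin N} (h : (p' : ℕ) = p + 1) :
    (Finset.univ.filter fun w : Equiv.Perm (Fin N) =>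
      Finsupp.equivMapDomain w (loweredStaircase N (p + 1)) = loweredStaircase N (p + 1)) =
    {1, Equiv.swap p p'} := by
  have hne : p ≠ p' := fun e => by rw [e] at h; omega
  have hp' := p'.isLt
  -- Lowering the first `p + 1` entries of the staircase makes the entries at `p` and `p'` equal,
  -- both `N - 2 - p`, and creates no other coincidence.
  have hval : ∀ i j : Fin N, loweredStaircase N (p + 1) i = loweredStaircase N (p + 1) j ↔
      i = j ∨ (i = p ∧ j = p') ∨ (i = p' ∧ j = p) := by
    intro i j
    have := i.isLt
    have := j.isLt
    simp only [loweredStaircase_apply, Fin.val_rev, Fin.ext_iff]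
    split_ifs <;> omega
  ext w
  simp only [Finset.mem_filter, Finset.mem_univ, true_and, Finset.mem_insert,
    Finset.mem_singleton, DFunLike.ext_iff, Finsupp.equivMapDomain_apply, hval]
  constructor
  · intro H
    have hfix : ∀ i, i ≠ p → i ≠ p' → w.symm i = i := by
      intro i hi hi'
      rcases H i with H | ⟨-, H⟩ | ⟨-, H⟩
      exacts [H, absurd H hi', absurd H hi]
    have hinj : w.symm p = w.symm p' → False := fun e => hne (w.symm.injective e)
    rcases H p with H1 | ⟨H1, H2⟩ | ⟨H1, -⟩
    · left
      rcases H p' with H3 | ⟨H3, -⟩ | ⟨-, H3⟩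
      · intro i
        rw [Equiv.Perm.one_apply, ← Equiv.eq_symm_apply]
        by_cases hi : i = p
        · rw [hi, H1]
        by_cases hi' : i = p'
        · rw [hi', H3]
        · exact (hfix i hi hi').symm
      · exact (hinj (H1.trans H3.symm)).elim
      · exact absurd H3.symm hne
    · exact absurd H2 hne
    · right
      rcases H p' with H3 | ⟨H3, -⟩ | ⟨-, H3⟩
      · exact (hinj (H1.trans H3.symm)).elim
      · intro i
        by_cases hi : i = p
        · rw [hi, Equiv.swap_apply_left, ← Equiv.eq_symm_apply, H3]
        by_cases hi' : i = p'
        · rw [hi', Equiv.swap_apply_right, ← Equiv.eq_symm_apply, H1]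
        · rw [Equiv.swap_apply_of_ne_of_ne hi hi', ← Equiv.eq_symm_apply, hfix i hi hi']
      · exact absurd H3.symm hne
  · rintro (H | H)
    · obtain rfl : w = 1 := Equiv.ext H
      intro i
      exact Or.inl rfl
    · obtain rfl : w = Equiv.swap p p' := Equiv.ext H
      intro i
      rw [Equiv.symm_swap]
      by_cases hi : i = p
      · rw [hi, Equiv.swap_apply_left]; exact Or.inr (Or.inr ⟨rfl, rfl⟩)
      by_cases hi' : i = p'
      · rw [hi', Equiv.swap_apply_right]; exact Or.inr (Or.inl ⟨rfl, rfl⟩)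
      · exact Or.inl (Equiv.swap_apply_of_ne_of_ne hi hi')

theorem sum_swap_initialSegment {M : Type*} [AddCommMonoid M] (f : Fin N → M) {p p' : Fin N}
    (h : (p' : ℕ) = p + 1) :
    ∑ i ∈ initialSegment N (p + 1), f (Equiv.swap p p' i) =
      f p' + ∑ i ∈ initialSegment N p, f i := by
  rw [sum_initialSegment_succ, Equiv.swap_apply_left]
  congr 1
  refine Finset.sum_congr rfl fun i hi => ?_
  rw [mem_initialSegment] at hi
  rw [Equiv.swap_apply_of_ne_of_ne] <;> rintro rfl <;> omega

theorem IsPartition.add_fundWeight {lam : Fin N → ℤ} (h : IsPartition lam) (a : ℕ) :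
    IsPartition (lam + fundWeight N a) := by
  refine ⟨fun i j hij => ?_, fun i => ?_⟩
  · have h1 := h.1 hij
    have h2 := Fin.le_def.1 hij
    simp only [Pi.add_apply, fundWeight]
    split_ifs <;> omega
  · have := h.2 i
    simp only [Pi.add_apply, fundWeight]
    split_ifs <;> omega

theorem IsPartition.sub_fundWeight {lam : Fin N → ℤ} (h : IsPartition lam) {p p' : Fin N}
    (hp : (p' : ℕ) = p + 1) (hlt : lam p' < lam p) :
    IsPartition (lam - fundWeight N (p + 1)) := by
  refine ⟨fun i j hij => ?_, fun i => ?_⟩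
  · have h1 := h.1 hij
    have h2 := Fin.le_def.1 hij
    simp only [Pi.sub_apply, fundWeight]
    split_ifs with hj hi
    · omega
    · omega
    · have h3 : lam p ≤ lam i := h.1 (Fin.le_def.2 (by omega))
      have h4 : lam j ≤ lam p' := h.1 (Fin.le_def.2 (by omega))
      omega
    · omega
  · have h1 := h.2 i
    have h2 := h.2 p'
    simp only [Pi.sub_apply, fundWeight]
    split_ifs with hi
    · have h3 : lam p ≤ lam i := h.1 (Fin.le_def.2 (by omega))
      omega
    · omega

theorem expo_add_fundWeight {lam : Fin N → ℤ} (h : IsPartition lam) (a : ℕ) :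
    expo (lam + fundWeight N a) = expo lam + fundExpo N a := by
  ext i
  have h1 := coe_expo (h.add_fundWeight a) i
  have h2 := coe_expo h i
  rw [Finsupp.add_apply, fundExpo_apply]
  simp only [Pi.add_apply, fundWeight] at h1
  split_ifs at h1 ⊢ <;> omega

end Weights

/-! ### Eigenfunctions at `u = 0` and the action of `M_{a,±1}` -/

section Eigenfunctions

variable {K : Type*} [Field K] {q : Kˣ} {N : ℕ}

/-- A symmetric polynomial which is a common eigenfunction of `M_{1,0}, …, M_{N,0}`, with the
eigenvalues `q ^ (κ, ω_b)`. -/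
structure IsWhittakerEigen (q : Kˣ) (κ : Fin N → ℤ) (g : MvPolynomial (Fin N) K) : Prop where
  symmetric : g.IsSymmetric
  eigen : ∀ b, 1 ≤ b → b ≤ N →
    opM N q b 0 (toRat g) = (q : K) ^ (∑ i ∈ initialSegment N b, κ i) • toRat g

namespace IsWhittakerEigen

variable {κ : Fin N → ℤ} {g h : MvPolynomial (Fin N) K}

theorem sub (hg : IsWhittakerEigen q κ g) (hh : IsWhittakerEigen q κ h) :
    IsWhittakerEigen q κ (g - h) where
  symmetric := hg.symmetric.sub hh.symmetric
  eigen b hb hbN := by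
    rw [toRat, map_sub, map_sub, hg.eigen b hb hbN, hh.eigen b hb hbN, smul_sub]

theorem smul (hg : IsWhittakerEigen q κ g) (c : K) : IsWhittakerEigen q κ (c • g) where
  symmetric := hg.symmetric.smul c
  eigen b hb hbN := by
    rw [toRat_smul, map_smul, hg.eigen b hb hbN, smul_comm]

/-- The eigenvalues `q^{κ_1 + ⋯ + κ_b}` equal those computed from the leading exponent, and
successive partial sums recover each entry. An integer vector `κ` that is not a partition thus
admits no nonzero eigenfunction. -/
theorem of_maximal (hq : ∀ n : ℕ, 0 < n → q ^ n ≠ 1) (hg : IsWhittakerEigen q κ g)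
    {μ : Fin N →₀ ℕ} (hμ : coeff μ g ≠ 0)
    (hmax : ∀ ν, coeff ν g ≠ 0 → weight (revWeight N) ν ≤ weight (revWeight N) μ) :
    IsPartition κ ∧ μ = expo κ := by
  have h1 : ∀ i, (μ i : ℤ) = κ i := eq_of_initial_zpow_eq hq fun b hb hbN => by
    have h2 := hg.eigen b hb hbN
    rw [opM_eq_weightedOp, ← altOp_eq_smul_iff q 0 b _ hg.symmetric] at h2
    rw [← leadEigenvalue_zero _ hbN]
    exact leadEigenvalue_eq_of_eigen revWeight_strictAnti hg.symmetric hμ hmax h2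
  have h3 := antitone_of_maximal revWeight_strictAnti hg.symmetric hμ hmax
  have hpart : IsPartition κ := by
    refine ⟨fun i j hij => ?_, fun i => ?_⟩
    · rw [← h1, ← h1]; exact_mod_cast h3 hij
    · rw [← h1]; positivity
  refine ⟨hpart, ?_⟩
  ext i
  have := (h1 i).trans (coe_expo hpart i).symm
  exact_mod_cast this

theorem eq_zero_of_not_isPartition (hq : ∀ n : ℕ, 0 < n → q ^ n ≠ 1)
    (hg : IsWhittakerEigen q κ g) (hκ : ¬ IsPartition κ) : g = 0 := by
  by_contra h0
  obtain ⟨μ, hμ, hmax⟩ := exists_maximal_weight (revWeight N) h0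
  exact hκ (hg.of_maximal hq hμ hmax).1

theorem eq_zero_of_coeff_eq_zero (hq : ∀ n : ℕ, 0 < n → q ^ n ≠ 1)
    (hg : IsWhittakerEigen q κ g) (hc : coeff (expo κ) g = 0) : g = 0 := by
  by_contra h0
  obtain ⟨μ, hμ, hmax⟩ := exists_maximal_weight (revWeight N) h0
  rw [(hg.of_maximal hq hμ hmax).2] at hμ
  exact hμ hc

theorem weight_le (hq : ∀ n : ℕ, 0 < n → q ^ n ≠ 1) (hg : IsWhittakerEigen q κ g)
    {ν : Fin N →₀ ℕ} (hν : coeff ν g ≠ 0) :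
    weight (revWeight N) ν ≤ weight (revWeight N) (expo κ) := by
  have h0 : g ≠ 0 := by
    rintro rfl
    exact hν (coeff_zero _)
  obtain ⟨μ, hμ, hmax⟩ := exists_maximal_weight (revWeight N) h0
  rw [← (hg.of_maximal hq hμ hmax).2]
  exact hmax ν hν

theorem eq_smul (hq : ∀ n : ℕ, 0 < n → q ^ n ≠ 1) (hg : IsWhittakerEigen q κ g)
    (hh : IsWhittakerEigen q κ h) (hc : coeff (expo κ) h = 1) : g = coeff (expo κ) g • h := by
  rw [← sub_eq_zero]
  refine (hg.sub (hh.smul _)).eq_zero_of_coeff_eq_zero hq ?_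
  rw [coeff_sub, coeff_smul, hc, smul_eq_mul, mul_one, sub_self]

theorem coeff_scaleVars_ne_zero (hq : ∀ n : ℕ, 0 < n → q ^ n ≠ 1) (hg : IsWhittakerEigen q κ g)
    (I : Finset (Fin N)) (ν : Fin N →₀ ℕ) (hν : coeff ν (scaleVars (q : K) I g) ≠ 0)
    (w : Equiv.Perm (Fin N)) :
    weight (revWeight N) (ν.equivMapDomain w) ≤ weight (revWeight N) (expo κ) := by
  apply hg.weight_le hq
  rw [coeff_equivMapDomain_of_symmetric hg.symmetric]
  rw [coeff_scaleVars] at hν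
  exact right_ne_zero_of_mul hν

theorem coeff_vandermondePoly_mul (hq : ∀ n : ℕ, 0 < n → q ^ n ≠ 1)
    (hg : IsWhittakerEigen q κ g) :
    coeff (expo κ + staircase N) (vandermondePoly K N * g) = coeff (expo κ) g :=
  coeff_add_vandermondePoly_mul revWeight_strictAnti hg.symmetric fun _ => hg.weight_le hq

/-- The operators `M_{a,1}` and `M_{a,-1}` shift the eigenvalues by `±ω_a`. -/
theorem exists_opM_eq [CharZero K] (hq : ∀ n : ℕ, 0 < n → q ^ n ≠ 1)
    (hg : IsWhittakerEigen q κ g) {a : ℕ} (ha : 1 ≤ a) (haN : a ≤ N) {k₁ k₂ : ℕ} {k : ℤ}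
    (hk : k = (k₁ : ℤ) - k₂) (hk1 : |k| ≤ 1) {θ : Fin N →₀ ℕ}
    (hθ : (∏ i ∈ initialSegment N a, X i) ^ k₁ * monomial (staircase N) (1 : K) =
      (∏ i ∈ initialSegment N a, X i) ^ k₂ * monomial θ 1) :
    ∃ h, IsWhittakerEigen q (κ + k • fundWeight N a) h ∧ toRat h = opM N q a k (toRat g) ∧
      vandermondePoly K N * h =
        alternant (monomial θ 1 * scaleVars (q : K) (initialSegment N a) g) := by
  obtain ⟨h, hs, hh⟩ := exists_symmetric_quotient
    (monomial θ 1 * scaleVars (q : K) (initialSegment N a) g)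
  have heq : toRat h = opM N q a k (toRat g) := by
    apply mul_left_cancel₀ (toRat_vandermondePoly_ne_zero (F := K) (N := N))
    rw [hk, vandermonde_mul_opM q haN hθ hg.symmetric, ← hh, toRat, toRat, toRat, map_mul]
  refine ⟨h, ⟨hs, fun b hb hbN => ?_⟩, heq, hh⟩
  -- Moving `M_{b,0}` past `M_{a,k}` costs `q^{k min(a,b)}`, and `min(a,b) = (ω_a, ω_b)`.
  rw [heq, opM_zero_opM_one (coe_ne_one hq) ha hb hk1, hg.eigen b hb hbN, map_smul, smul_smul,
    ← zpow_add₀ q.ne_zero]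
  congr 2
  simp only [Pi.add_apply, Pi.smul_apply, smul_eq_mul]
  rw [Finset.sum_add_distrib, ← Finset.mul_sum, sum_fundWeight haN hbN]
  ring

end IsWhittakerEigen

variable [CharZero K]

theorem existsUnique_polyLimInfty (hq : ∀ n : ℕ, 0 < n → q ^ n ≠ 1) {lam : Fin N → ℤ}
    (hlam : IsPartition lam) :
    ∃! L : MvPolynomial (Fin N) K, PolyLimInfty (macdonaldP q lam) L := by
  obtain ⟨L, hL, -⟩ := exists_limit hq (isMacdonald_macdonaldP (K := K) hq hlam)
  refine ⟨L, hL, fun L' hL' => ?_⟩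
  ext m
  exact (hL' m).unique (hL m)

theorem dualWhittaker_spec (hq : ∀ n : ℕ, 0 < n → q ^ n ≠ 1) {lam : Fin N → ℤ}
    (hlam : IsPartition lam) :
    IsWhittakerEigen q lam (dualWhittaker q lam) ∧
      coeff (expo lam) (dualWhittaker q lam) = 1 := by
  obtain ⟨L, hL, hs, hc, heig⟩ := exists_limit hq (isMacdonald_macdonaldP (K := K) hq hlam)
  have hex : ∃ L, PolyLimInfty (macdonaldP q lam) L := ⟨L, hL⟩
  have h : dualWhittaker q lam = L := by
    rw [dualWhittaker, dif_pos hex]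
    exact (existsUnique_polyLimInfty hq hlam).unique hex.choose_spec hL
  rw [h]
  refine ⟨⟨hs, fun b hb hbN => ?_⟩, hc⟩
  rw [opM_eq_weightedOp, ← altOp_eq_smul_iff q 0 b _ hs]
  exact heig b hb hbN

/-- Joint eigenfunctions are unique up to a scalar, which is read off at `x^{λ+ω_a}`. Since `δ +
ω_a` is strictly decreasing, only the identity contributes. -/
theorem opM_one_dualWhittaker (hq : ∀ n : ℕ, 0 < n → q ^ n ≠ 1) {lam : Fin N → ℤ}
    (hlam : IsPartition lam) {a : ℕ} (ha : 1 ≤ a) (haN : a ≤ N) :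
    opM N q a 1 (toRat (dualWhittaker q lam)) =
      (q : K) ^ (lam ⬝ᵥ fundWeight N a) • toRat (dualWhittaker q (lam + fundWeight N a)) := by
  obtain ⟨hP, hPc⟩ := dualWhittaker_spec (K := K) hq hlam
  obtain ⟨hR, hRc⟩ := dualWhittaker_spec (K := K) hq (hlam.add_fundWeight a)
  obtain ⟨g, hg, hgr, hgv⟩ := hP.exists_opM_eq hq ha haN (k₁ := 1) (k₂ := 0) (k := 1)
    (θ := staircase N + fundExpo N a) (by norm_num) (by norm_num) (by
      rw [pow_one, pow_zero, one_mul, prod_X_initialSegment, monomial_mul, one_mul, add_comm])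
  rw [one_smul] at hg
  have hc : coeff (expo (lam + fundWeight N a)) g = (q : K) ^ (lam ⬝ᵥ fundWeight N a) := by
    have hsum : expo (lam + fundWeight N a) + staircase N =
        expo lam + (staircase N + fundExpo N a) := by
      rw [expo_add_fundWeight hlam, add_assoc, add_comm (fundExpo N a)]
    rw [← hg.coeff_vandermondePoly_mul hq, hgv, hsum,
      coeff_add_alternant_of_strictAnti revWeight_strictAnti (staircase_add_fundExpo_strictAnti a)
        (hP.coeff_scaleVars_ne_zero hq _), coeff_scaleVars, hPc, mul_one, dotProduct_fundWeight,
      ← zpow_natCast, Nat.cast_sum]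
    simp only [coe_expo hlam]
  rw [← hgr, hg.eq_smul hq hR hRc, hc, toRat_smul]

theorem opM_neg_one_dualWhittaker (hq : ∀ n : ℕ, 0 < n → q ^ n ≠ 1) {lam : Fin N → ℤ}
    (hlam : IsPartition lam) {a : ℕ} (ha : 1 ≤ a) (haN : a < N) :
    opM N q a (-1) (toRat (dualWhittaker q lam)) =
      ((q : K) ^ (lam ⬝ᵥ fundWeight N a) * (1 - (q : K) ^ (-(lam ⬝ᵥ simpleRoot N a)))) •
        toRat (dualWhittaker q (lam - fundWeight N a)) := by
  obtain ⟨p, p', rfl, hp⟩ : ∃ p p' : Fin N, a = p + 1 ∧ (p' : ℕ) = p + 1 :=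
    ⟨⟨a - 1, by omega⟩, ⟨a, haN⟩, (Nat.sub_add_cancel ha).symm, (Nat.sub_add_cancel ha).symm⟩
  have hne : p ≠ p' := fun e => by rw [e] at hp; omega
  obtain ⟨hP, hPc⟩ := dualWhittaker_spec (K := K) hq hlam
  obtain ⟨g, hg, hgr, hgv⟩ := hP.exists_opM_eq hq ha haN.le (k₁ := 0) (k₂ := 1) (k := -1)
    (θ := loweredStaircase N (p + 1)) (by norm_num) (by norm_num) (by
      rw [pow_one, pow_zero, one_mul, prod_X_initialSegment, monomial_mul, one_mul,
        fundExpo_add_loweredStaircase haN])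
  rw [neg_smul, one_smul, ← sub_eq_add_neg] at hg
  rw [dotProduct_simpleRoot lam hp]
  rcases (hlam.1 (Fin.le_def.2 (by omega) : p ≤ p')).eq_or_lt with heq | hlt
  -- If `λ_a = λ_{a+1}`, then `λ - ω_a` is not decreasing, so the eigenfunction is zero, and so is
  -- the scalar factor.
  · have hnot : ¬ IsPartition (lam - fundWeight N (p + 1)) := by
      intro h
      have h1 := h.1 (Fin.le_def.2 (by omega) : p ≤ p')
      simp only [Pi.sub_apply, fundWeight] at h1
      rw [if_neg (by omega), if_pos (by omega)] at h1
      omega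
    rw [← hgr, hg.eq_zero_of_not_isPartition hq hnot, heq, sub_self, neg_zero, zpow_zero, sub_self,
      mul_zero, zero_smul, toRat, map_zero]
  have hpart := hlam.sub_fundWeight hp hlt
  obtain ⟨hR, hRc⟩ := dualWhittaker_spec (K := K) hq hpart
  have hc : coeff (expo (lam - fundWeight N (p + 1))) g =
      (q : K) ^ (lam ⬝ᵥ fundWeight N (p + 1)) * (1 - (q : K) ^ (-(lam p - lam p'))) := by
    have hsum : expo (lam - fundWeight N (p + 1)) + staircase N =
        expo lam + loweredStaircase N (p + 1) := by
      have h1 := expo_add_fundWeight hpart (p + 1)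
      rw [sub_add_cancel] at h1
      rw [h1, ← fundExpo_add_loweredStaircase haN, add_assoc]
    -- Two permutations fix `δ - ω_a`: the identity contributes `q^{(λ,ω_a)}`, and the transposition
    -- contributes the same with `λ_a` replaced by `λ_{a+1}` and opposite sign.
    have hswap : coeff ((expo lam).equivMapDomain (Equiv.swap p p')) (dualWhittaker q lam) = 1 := by
      rw [coeff_equivMapDomain_of_symmetric hP.symmetric, hPc]
    rw [← hg.coeff_vandermondePoly_mul hq, hgv, hsum,
      coeff_add_alternant revWeight_strictAnti (loweredStaircase_antitone _)
        (hP.coeff_scaleVars_ne_zero hq _), stabilizer_loweredStaircase hp,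
      Finset.sum_pair (fun e => hne ((Equiv.swap_eq_one_iff.1 e.symm)))]
    simp only [coeff_scaleVars, Equiv.Perm.sign_one, Equiv.Perm.sign_swap hne, Equiv.symm_swap,
      hswap, Finsupp.equivMapDomain_apply]
    have hone : (expo lam).equivMapDomain (1 : Equiv.Perm (Fin N)).symm = expo lam :=
      Finsupp.equivMapDomain_refl _
    rw [hone, hPc, sum_swap_initialSegment _ hp, dotProduct_fundWeight, ← zpow_natCast,
      ← zpow_natCast]
    push_cast
    rw [sum_initialSegment_succ]
    simp only [coe_expo hlam]
    rw [mul_sub, ← zpow_add₀ q.ne_zero, sum_initialSegment_succ]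
    have hexp : lam p + ∑ j ∈ initialSegment N p, lam j + -(lam p - lam p') =
        lam p' + ∑ j ∈ initialSegment N p, lam j := by ring
    rw [hexp]
    simp only [Equiv.Perm.one_def, Equiv.refl_symm, Equiv.refl_apply]
    ring
  rw [← hgr, hg.eq_smul hq hR hRc, hc, toRat_smul]

end Eigenfunctions

end

end QWhittaker

/-! ### The theorem -/

theorem theorem3p4 {K : Type*} [Field K] [CharZero K] (q : Kˣ)
    (hq : ∀ n : ℕ, 0 < n → q ^ n ≠ 1) (N : ℕ)
    (lam : Fin N → ℤ) (hlam : QWhittaker.IsPartition lam) :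
    (∃! P : MvPolynomial (Fin N) (RatFunc K),
      QWhittaker.IsMacdonald (QWhittaker.constQ q) RatFunc.X lam P) ∧
    (∃! L : MvPolynomial (Fin N) K,
      QWhittaker.PolyLimInfty (QWhittaker.macdonaldP q lam) L) ∧
    (∀ a : ℕ, 1 ≤ a → a ≤ N →
      QWhittaker.opM N q a 1 (QWhittaker.toRat (QWhittaker.dualWhittaker q lam)) =
        (q : K) ^ (lam ⬝ᵥ QWhittaker.fundWeight N a) •
          QWhittaker.toRat
            (QWhittaker.dualWhittaker q (lam + QWhittaker.fundWeight N a))) ∧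
    (∀ a : ℕ, 1 ≤ a → a < N →
      QWhittaker.opM N q a (-1) (QWhittaker.toRat (QWhittaker.dualWhittaker q lam)) =
        ((q : K) ^ (lam ⬝ᵥ QWhittaker.fundWeight N a) *
            (1 - (q : K) ^ (-(lam ⬝ᵥ QWhittaker.simpleRoot N a)))) •
          QWhittaker.toRat
            (QWhittaker.dualWhittaker q (lam - QWhittaker.fundWeight N a))) := by
  have hex := QWhittaker.exists_isMacdonald (K := K) hq hlam
  refine ⟨⟨hex.choose, hex.choose_spec, fun Q hQ =>
    QWhittaker.isMacdonald_unique hq hQ hex.choose_spec⟩,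
    QWhittaker.existsUnique_polyLimInfty hq hlam,
    fun a ha haN => QWhittaker.opM_one_dualWhittaker hq hlam ha haN,
    fun a ha haN => QWhittaker.opM_neg_one_dualWhittaker hq hlam ha haN⟩
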